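/- **Out-Out gadget.** Let $\theta,\alpha,\beta$ satisfy $0<\theta$, $|\alpha-\beta|<\theta<\alpha+\beta\le\pi$, and let $\ell>0$. Let $u_\alpha,u_\beta$ be horizontal unit vectors at angle $\theta$, let $o$ be the origin, and let $q$ be the point above the bottom plane $\{z=0\}$ with $|q|=\ell$, $q\cdot u_\alpha=\ell\cos\alpha$, $q\cdot u_\beta=\ell\cos\beta$; let $H>0$ be its height. The corner of a prismoid at the spanning edge $oq$ consists of the $\alpha$ face and the $\beta$ face, the half-strips swept by $oq$ in directions $u_\alpha$ and $u_\beta$; let $P\subset\mathbb R^2$ be its planar development, where $e_\alpha,e_\beta$ are the directions of the bottom edges (and $o,q$ are written as in space). For the $\alpha$ face put $\cos\phi_\alpha=\frac{\cos\beta-\cos\alpha\cos\theta}{\sin\alpha\sin\theta}$ and let its spanning face crease be the line parallel to its bottom edge at distance $\frac{1-\cos\phi_\alpha}{2}\,\ell\sin\alpha$ from it, starting at the point $c_\alpha$ of $oq$; define $\phi_\beta$, $c_\beta$ and the spanning face crease of the $\beta$ face symmetrically. Let $p_\alpha$ ($p_\beta$) be the point where the ray from $o$ inside the development at angle $\frac{\alpha+\beta-\theta}{4}$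 from the bottom edge of the $\alpha$ ($\beta$) face meets the spanning face crease of that face. For $t\in[0,1]$ let $p'_\alpha(t)=(1-t)c_\alpha+t\,p_\alpha$, and consider the crease pattern on $P$ formed by the segments $p'_\alpha o$, $p'_\alpha q$, $p'_\alpha p_\beta$, $p_\beta o$, $p_\beta q$ and the spanning face creases from $p'_\alpha$ and from $p_\beta$ outwards. Let $G$ be the quadrilateral $o\,p_\alpha\,q\,p_\beta$. There are constants $R,C>0$ depending only on $\theta,\alpha,\beta$ such that for every $\ell>0$ there are a continuous, strictly decreasing height function $z:[0,1]\to[0,H]$ with $z(0)=H$, $z(1)=0$ and a motion $f_t:P\to\mathbb R^3$, jointly continuous in $t\in[0,1]$ and the point of $P$, with the following properties. 1. *Folding motion.* $f_0$ is the given prismoid corner. At every time the bottom edges are fixed, and the top edges are translated vertically, lying at height $z(t)$. At every time $t$ the crease pattern above divides $P$ into six faces with disjoint interiors, and $f_t$ is an isometry on each of them. Both faces bend away from the convex side: for $0<t<1$ the plane through the bottom and top edges of the folded $\alpha$ face strictly separates $u_\beta$ from the spanning face crease of the $\alpha$ face (its part from $p'_\alpha$ on), and symmetrically for $\beta$; for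 $t=1$ the same holds with the vertical plane through the bottom edge. 2. *Bounded size.* $G\subseteq P$; at every time all creases lie in $G$ or on the spanning face creases; $G$ and $f_t(G)$ lie within distance $RH$ of $o$. 3. *Between the planes.* $f_t(P)$ lies in $\{0\le z\le z(t)\}$ for all $t$ (so $f_1$ is flat), and for $t<1$ points of $P$ not on the bottom or top edges are mapped strictly between the two planes. 4. *Isometry.* Every $f_t$ preserves the length of every curve in $P$; hence intrinsic distances are the same at all times. 5. *No crossings.* $f_t$ is injective for $0\le t<1$; and whenever two distinct interior points of $P$, neither on a crease of the final pattern, satisfy $f_1(x)=f_1(y)$, exactly one of the layers at $x$ and $y$ lies above the other in all states close to the end, so the flat state has a well-defined stacking order inherited from the crossing-free states before it. 6. *Area.* The set of points of $P$ that lie on a crease at some but not at all times, which supports the moving creases, is contained in $G$ and has area exactly $C H^2$. -/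

import Mathlib

open Set Filter Topology MeasureTheory

noncomputable section

namespace OutOut

/-- The plane in which the two spanning faces are developed. -/
abbrev E2 := EuclideanSpace ℝ (Fin 2)

/-- Space; coordinate `2` is the vertical one, and the bottom plane is at height `0`. -/
abbrev E3 := EuclideanSpace ℝ (Fin 3)

/-! ### The prismoid spanning edge

The primary vertex `o` is the origin. The face angles at `o` are `θ` (base), `α` and `β` (spanning
faces), and the spanning edge `oq` has length `l`. -/

/-- Unit vector of the plane with argument `t`. -/
def dir2 (t : ℝ) : E2 := !₂[Real.cos t, Real.sin t]

/-- Horizontal unit vector of space with argument `t`. -/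
def dir3 (t : ℝ) : E3 := !₂[Real.cos t, Real.sin t, 0]

/-- Direction of the horizontal edges of the `α` face, in the development and in space. -/
def eA : E2 := dir2 0
def uA : E3 := dir3 0

/-- Direction of the horizontal edges of the `β` face, in the development and in space. -/
def eB (α β : ℝ) : E2 := dir2 (α + β)
def uB (θ : ℝ) : E3 := dir3 θ

/-- The non-primary vertex `q` in the development: at distance `l` from `o`, at angle `α` from the
bottom edge of the `α` face and at angle `β` from the bottom edge of the `β` face. -/
def q2 (α l : ℝ) : E2 := l • dir2 α

/-- Height of the gadget: the distance of the top plane from the bottom plane when the point `q` of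
space satisfies `|q| = l`, `q ⬝ uA = l cos α`, `q ⬝ uB = l cos β`. -/
def height (θ α β l : ℝ) : ℝ :=
  l * Real.sqrt (1 - Real.cos α ^ 2
    - ((Real.cos β - Real.cos α * Real.cos θ) / Real.sin θ) ^ 2)

/-- The vertex `q` in space when the top plane is at height `z`; it moves only vertically. Its
horizontal projection `v` satisfies `v ⬝ uA = l cos α` and `v ⬝ uB = l cos β`. -/
def q3 (θ α β l z : ℝ) : E3 :=
  !₂[l * Real.cos α, l * ((Real.cos β - Real.cos α * Real.cos θ) / Real.sin θ), z]

/-- `{a + r (b - a) + s e | 0 ≤ r ≤ 1, 0 ≤ s}`: the half-strip swept by the segment `ab` in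
direction `e`; for `a = b` it is the ray from `a` in direction `e`. -/
def halfStrip (a b e : E2) : Set E2 :=
  {x | ∃ r ∈ Icc (0 : ℝ) 1, ∃ s : ℝ, 0 ≤ s ∧ x = AffineMap.lineMap a b r + s • e}

/-- The paper near the spanning edge: the developed `α` face and `β` face, glued along `oq`. -/
def paper (α β l : ℝ) : Set E2 :=
  halfStrip 0 (q2 α l) eA ∪ halfStrip 0 (q2 α l) (eB α β)

/-- The bottom and top edges of the two faces (with `o` and `q`): where the paper is attached to the
horizontal faces. -/
def horizontalEdges (α β l : ℝ) : Set E2 :=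
  halfStrip 0 0 eA ∪ halfStrip 0 0 (eB α β) ∪
    (halfStrip (q2 α l) (q2 α l) eA ∪ halfStrip (q2 α l) (q2 α l) (eB α β))

/-! ### The crease patterns -/

/-- Cosine of the dihedral angle between the base and the spanning face with face angle `a`, the
other spanning face having face angle `b`. -/
def cosDihedral (θ a b : ℝ) : ℝ :=
  (Real.cos b - Real.cos a * Real.cos θ) / (Real.sin a * Real.sin θ)

/-- Distance from the bottom edge of the spanning face crease along which that face, of width
`l sin a`, collapses away from the convex side. -/
def creaseDist (θ a b l : ℝ) : ℝ := (1 - cosDihedral θ a b) / 2 * (l * Real.sin a)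

/-- Angle at `o` between each of the two creases of the flat state and its adjacent bottom edge. -/
def cornerAngle (θ α β : ℝ) : ℝ := (α + β - θ) / 4

/-- The points where the spanning face creases meet the spanning edge. -/
def cA (θ α β l : ℝ) : E2 := (creaseDist θ α β l / Real.sin α) • dir2 α
def cB (θ α β l : ℝ) : E2 := (creaseDist θ β α l / Real.sin β) • dir2 α

/-- `p_α` and `p_β`: the points where the creases from `o` meet the spanning face creases. -/
def pA (θ α β l : ℝ) : E2 :=
  (creaseDist θ α β l / Real.sin (cornerAngle θ α β)) • dir2 (cornerAngle θ α β)
def pB (θ α β l : ℝ) : E2 :=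
  (creaseDist θ β α l / Real.sin (cornerAngle θ α β)) • dir2 (α + β - cornerAngle θ α β)

/-- The moving point `p'_α`, on the segment from `c_α` (time `0`) to `p_α` (time `1`). -/
def pA' (θ α β l t : ℝ) : E2 := AffineMap.lineMap (cA θ α β l) (pA θ α β l) t

/-- The six faces into which the creases at time `t` divide the paper. -/
def face (θ α β l t : ℝ) : Fin 6 → Set E2 :=
  ![halfStrip 0 (pA' θ α β l t) eA,
    halfStrip (pA' θ α β l t) (q2 α l) eA,
    halfStrip 0 (pB θ α β l) (eB α β),
    halfStrip (pB θ α β l) (q2 α l) (eB α β),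
    convexHull ℝ {0, pA' θ α β l t, pB θ α β l},
    convexHull ℝ {q2 α l, pA' θ α β l t, pB θ α β l}]

/-- The creases at time `t`: from `p'_α` to `o`, `q` and `p_β`, from `p_β` to `o` and `q`, and the
spanning face creases starting at `p'_α` and `p_β`. -/
def creases (θ α β l t : ℝ) : Set E2 :=
  segment ℝ (pA' θ α β l t) 0 ∪ segment ℝ (pA' θ α β l t) (q2 α l) ∪
  segment ℝ (pA' θ α β l t) (pB θ α β l) ∪
  segment ℝ (pB θ α β l) 0 ∪ segment ℝ (pB θ α β l) (q2 α l) ∪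
  halfStrip (pA' θ α β l t) (pA' θ α β l t) eA ∪
  halfStrip (pB θ α β l) (pB θ α β l) (eB α β)

/-- The two spanning face creases, starting at the spanning edge. -/
def spanningFaceCreases (θ α β l : ℝ) : Set E2 :=
  halfStrip (cA θ α β l) (cA θ α β l) eA ∪ halfStrip (cB θ α β l) (cB θ α β l) (eB α β)

/-- The region of the paper occupied by the gadget. -/
def gadgetRegion (θ α β l : ℝ) : Set E2 :=
  convexHull ℝ {0, pA θ α β l, q2 α l, pB θ α β l}

/-- The part of the paper supporting moving creases: the points that lie on a crease at some time
but not at all times. -/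
def movingRegion (θ α β l : ℝ) : Set E2 :=
  {x | (∃ t ∈ Icc (0 : ℝ) 1, x ∈ creases θ α β l t) ∧
    ¬ ∀ t ∈ Icc (0 : ℝ) 1, x ∈ creases θ α β l t}

/-! ### The folding motion -/

/-- Triple product: its sign tells on which side of the plane spanned by `u`, `v` the point `w`
lies. -/
def triple (u v w : E3) : ℝ :=
  Matrix.det !![u 0, u 1, u 2; v 0, v 1, v 2; w 0, w 1, w 2]

/-- The upward vertical unit vector. -/
def vert : E3 := !₂[0, 0, 1]

/-- `f t`, for `t ∈ [0, 1]`, is the Out-Out folding motion with top plane at height `z t`. -/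
structure IsOutOutMotion (θ α β l : ℝ) (z : ℝ → ℝ) (f : ℝ → E2 → E3) : Prop where
  /-- The top plane descends continuously and monotonically onto the bottom plane. -/
  height_continuous : ContinuousOn z (Icc 0 1)
  height_strictAnti : StrictAntiOn z (Icc 0 1)
  height_start : z 0 = height θ α β l
  height_end : z 1 = 0
  /-- The motion is continuous in time and position. -/
  continuous : ContinuousOn (Function.uncurry f) (Icc (0 : ℝ) 1 ×ˢ paper α β l)
  /-- It starts at the unfolded prismoid, whose spanning faces are flat. -/
  start_A : ∀ r ∈ Icc (0 : ℝ) 1, ∀ s : ℝ, 0 ≤ s →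
    f 0 (r • q2 α l + s • eA) = r • q3 θ α β l (height θ α β l) + s • uA
  start_B : ∀ r ∈ Icc (0 : ℝ) 1, ∀ s : ℝ, 0 ≤ s →
    f 0 (r • q2 α l + s • eB α β) = r • q3 θ α β l (height θ α β l) + s • uB θ
  /-- Bottom edges stay fixed; top edges move only vertically, with the top plane. -/
  bottom_A : ∀ t ∈ Icc (0 : ℝ) 1, ∀ s : ℝ, 0 ≤ s → f t (s • eA) = s • uA
  bottom_B : ∀ t ∈ Icc (0 : ℝ) 1, ∀ s : ℝ, 0 ≤ s → f t (s • eB α β) = s • uB θ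
  top_A : ∀ t ∈ Icc (0 : ℝ) 1, ∀ s : ℝ, 0 ≤ s →
    f t (q2 α l + s • eA) = q3 θ α β l (z t) + s • uA
  top_B : ∀ t ∈ Icc (0 : ℝ) 1, ∀ s : ℝ, 0 ≤ s →
    f t (q2 α l + s • eB α β) = q3 θ α β l (z t) + s • uB θ
  /-- At every time the faces subdivide the paper, and each of them is moved rigidly. -/
  cover : ∀ t ∈ Icc (0 : ℝ) 1, ⋃ i, face θ α β l t i = paper α β l
  subdivision : ∀ t ∈ Icc (0 : ℝ) 1, ∀ i j, i ≠ j →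
    Disjoint (interior (face θ α β l t i)) (interior (face θ α β l t j))
  rigid : ∀ t ∈ Icc (0 : ℝ) 1, ∀ i, ∀ x ∈ face θ α β l t i, ∀ y ∈ face θ α β l t i,
    dist (f t x) (f t y) = dist x y
  /-- Both spanning faces bend away from the convex side: the plane through the bottom and top edge
  of a face separates strictly the spanning face crease of that face from the other face's bottom
  edge. -/
  out_A : ∀ t ∈ Ioo (0 : ℝ) 1,
    triple uA (q3 θ α β l (z t)) (uB θ) *
      triple uA (q3 θ α β l (z t)) (f t (pA' θ α β l t)) < 0
  out_B : ∀ t ∈ Ioo (0 : ℝ) 1,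
    triple (uB θ) (q3 θ α β l (z t)) uA *
      triple (uB θ) (q3 θ α β l (z t)) (f t (pB θ α β l)) < 0
  /-- In the flat state the vertical plane through the bottom edge does so. -/
  out_flat_A : triple uA vert (uB θ) * triple uA vert (f 1 (pA' θ α β l 1)) < 0
  out_flat_B : triple (uB θ) vert uA * triple (uB θ) vert (f 1 (pB θ α β l)) < 0

/-! ### Intrinsic distances and crossings -/

/-- `g` preserves the length of every curve in `P`. -/
def PreservesLengths (P : Set E2) (g : E2 → E3) : Prop :=
  ∀ γ : ℝ → E2, ContinuousOn γ (Icc 0 1) → MapsTo γ (Icc 0 1) P →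
    eVariationOn (g ∘ γ) (Icc 0 1) = eVariationOn γ (Icc 0 1)

/-- Intrinsic distance on the paper `P` folded by `g`: the infimum of the lengths of the images of
the curves in `P` from `x` to `y`. -/
def intrinsicDist (P : Set E2) (g : E2 → E3) (x y : E2) : ENNReal :=
  ⨅ (γ : ℝ → E2) (_ : ContinuousOn γ (Icc 0 1)) (_ : MapsTo γ (Icc 0 1) P)
    (_ : γ 0 = x) (_ : γ 1 = y), eVariationOn (g ∘ γ) (Icc 0 1)

/-- As the motion approaches its end, the layer at `x` lies above the layer at `y`: wherever points
`x'` near `x` and `y'` near `y` are on one vertical line, `x'` is the higher one. -/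
def LiesAbove (f : ℝ → E2 → E3) (x y : E2) : Prop :=
  ∀ᶠ w : ℝ × E2 × E2 in 𝓝[<] (1 : ℝ) ×ˢ (𝓝 x ×ˢ 𝓝 y),
    f w.1 w.2.1 0 = f w.1 w.2.2 0 → f w.1 w.2.1 1 = f w.1 w.2.2 1 →
      f w.1 w.2.2 2 < f w.1 w.2.1 2

/-- The motion avoids crossings: before its end no two points of the paper touch, and in the final
flat state any two distinct layers that overlap have a definite stacking order, inherited from the
states before. -/
def AvoidsCrossings (P : Set E2) (finalCreases : Set E2) (f : ℝ → E2 → E3) : Prop :=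
  (∀ t ∈ Ico (0 : ℝ) 1, InjOn (f t) P) ∧
  ∀ x ∈ interior P \ finalCreases, ∀ y ∈ interior P \ finalCreases, x ≠ y → f 1 x = f 1 y →
    Xor (LiesAbove f x y) (LiesAbove f y x)

end OutOut

end

open OutOut

noncomputable section

namespace OutOut

/-! ### The cell complex of coefficients

The developed corner and all its folded states are linear images of one complex of six cells: the
point with coefficients `w` is `w 0 • a + w 1 • b + w 2 • q + w 3 • u + w 4 • v`, where `a` and `b`
are the inner crease vertices, and `u`, `v` the directions of the horizontal edges. -/

/-! Every cell is a triangle or half-strip spanned by the vertices `o`, `a = p'_α`, `b = p_β`, `q`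
and the directions `u`, `v`, so the development and all folded states are images of one complex of
coefficients, and a folded state is given by the positions of `a`, `b` and `q`. Let z be the height
of the top plane and k = √(H² - z²). In cross section a face of width L with horizontal offset w
between its edges must bend so that the crease keeps its distances (L - w)/2 and (L + w)/2 from
them. The solution used here puts the crease at horizontal distance exactly k/2 outside the plane
through the two edges (`crease_dist_bottom`, `crease_dist_top`), with the same k for both faces. The
cells are then isometric to their developments as soon as ⟨a, b⟩ is preserved as well. That single
equation is linear in the distance σ of `a` from the spanning edge along its crease, and `slide k`
solves it (`inner_fold`, `Closes.isometric`). Since `slide` is continuous and strictly increasing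
from 0 to `SA`, each position of the moving vertex belongs to exactly one k; inverting `slide` gives
the time schedule. The equality `slide H = SA`, which says that the corner closes at the prescribed
vertex, is a trigonometric identity (`Admissible.closes`). Both embedding statements are instances
of `IsFan.inj`, a planar criterion for the six cells. For the development its delicate hypothesis is
that `o` and `q` lie on opposite sides of the line `ab`. At the final time this follows from
`opposite_sides`, because folding flat brings `q` closer to `o`; earlier times follow by
interpolation in σ. For a folded state one projects along the bisecting direction u + v and replaces
height by relative height, that is height divided by z (`Closes.fold_inj`). Relative height still
makes sense at z = 0. Hence states before the end are injective, and in the flat state the relative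
heights of overlapping layers differ and give the stacking order. Lengths are preserved because the
motion is isometric on finitely many closed pieces (`eVariationOn_eq_of_cover`). The constants `R`
and `C` come from scaling the case `l = 1`. -/

/-- Coefficients with respect to `a`, `b`, `q`, `u`, `v`. -/
abbrev Coef := Fin 5 → ℝ

/-- The six cells, in the order of `face`. -/
def cell : Fin 6 → Set Coef :=
  ![{w | (∀ i, 0 ≤ w i) ∧ w 1 = 0 ∧ w 2 = 0 ∧ w 4 = 0 ∧ w 0 ≤ 1},
    {w | (∀ i, 0 ≤ w i) ∧ w 1 = 0 ∧ w 4 = 0 ∧ w 0 + w 2 = 1},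
    {w | (∀ i, 0 ≤ w i) ∧ w 0 = 0 ∧ w 2 = 0 ∧ w 3 = 0 ∧ w 1 ≤ 1},
    {w | (∀ i, 0 ≤ w i) ∧ w 0 = 0 ∧ w 3 = 0 ∧ w 1 + w 2 = 1},
    {w | (∀ i, 0 ≤ w i) ∧ w 2 = 0 ∧ w 3 = 0 ∧ w 4 = 0 ∧ w 0 + w 1 ≤ 1},
    {w | (∀ i, 0 ≤ w i) ∧ w 3 = 0 ∧ w 4 = 0 ∧ w 0 + w 1 + w 2 = 1}]

/-- The complex of coefficients. -/
def cells : Set Coef := ⋃ i, cell i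

theorem mem_cells {w : Coef} : w ∈ cells ↔
    (((∀ i, 0 ≤ w i) ∧ w 1 = 0 ∧ w 2 = 0 ∧ w 4 = 0 ∧ w 0 ≤ 1) ∨
    ((∀ i, 0 ≤ w i) ∧ w 1 = 0 ∧ w 4 = 0 ∧ w 0 + w 2 = 1)) ∨
    (((∀ i, 0 ≤ w i) ∧ w 0 = 0 ∧ w 2 = 0 ∧ w 3 = 0 ∧ w 1 ≤ 1) ∨
    ((∀ i, 0 ≤ w i) ∧ w 0 = 0 ∧ w 3 = 0 ∧ w 1 + w 2 = 1)) ∨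
    (((∀ i, 0 ≤ w i) ∧ w 2 = 0 ∧ w 3 = 0 ∧ w 4 = 0 ∧ w 0 + w 1 ≤ 1) ∨
    ((∀ i, 0 ≤ w i) ∧ w 3 = 0 ∧ w 4 = 0 ∧ w 0 + w 1 + w 2 = 1)) := by
  have h : w ∈ cells ↔ w ∈ cell 0 ∨ w ∈ cell 1 ∨ w ∈ cell 2 ∨ w ∈ cell 3 ∨ w ∈ cell 4 ∨
      w ∈ cell 5 := by
    constructor
    · intro h
      obtain ⟨i, hi⟩ := mem_iUnion.1 h
      fin_cases i <;> simp_all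
    · rintro (h | h | h | h | h | h) <;> exact mem_iUnion.2 ⟨_, h⟩
  rw [h]
  simp only [or_assoc]
  rfl

theorem cell_subset_cells (i : Fin 6) : cell i ⊆ cells := subset_iUnion _ i

theorem coef_ext {w w' : Coef} (h0 : w 0 = w' 0) (h1 : w 1 = w' 1) (h2 : w 2 = w' 2)
    (h3 : w 3 = w' 3) (h4 : w 4 = w' 4) : w = w' := by
  funext i
  fin_cases i <;> assumption

theorem isClosed_cell (i : Fin 6) : IsClosed (cell i) := by
  have h0 : IsClosed {w : Coef | ∀ i, 0 ≤ w i} := by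
    simp only [ofPred_forall]
    exact isClosed_iInter fun i => isClosed_le continuous_const (continuous_apply i)
  have e : ∀ i, IsClosed {w : Coef | w i = 0} := fun i =>
    isClosed_eq (continuous_apply i) continuous_const
  have c : ∀ i j : Fin 5, Continuous fun w : Coef => w i + w j := fun i j =>
    (continuous_apply i).add (continuous_apply j)
  have cc : Continuous fun w : Coef => w 0 + w 1 + w 2 := (c 0 1).add (continuous_apply 2)
  fin_cases i <;> refine h0.inter ?_
  · exact (e 1).inter ((e 2).inter ((e 4).inter (isClosed_le (continuous_apply 0)
      continuous_const)))
  · exact (e 1).inter ((e 4).inter (isClosed_eq (c 0 2) continuous_const))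
  · exact (e 0).inter ((e 2).inter ((e 3).inter (isClosed_le (continuous_apply 1)
      continuous_const)))
  · exact (e 0).inter ((e 3).inter (isClosed_eq (c 1 2) continuous_const))
  · exact (e 2).inter ((e 3).inter ((e 4).inter (isClosed_le (c 0 1) continuous_const)))
  · exact (e 3).inter ((e 4).inter (isClosed_eq cc continuous_const))

theorem isClosed_cells : IsClosed cells := isClosed_iUnion_of_finite isClosed_cell

/-- Exchanging the roles of the two faces. -/
def flip (w : Coef) : Coef := ![w 1, w 0, w 2, w 4, w 3]

theorem flip_flip (w : Coef) : flip (flip w) = w :=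
  coef_ext rfl rfl rfl rfl rfl

theorem flip_mem_cells {w : Coef} (hw : w ∈ cells) : flip w ∈ cells := by
  have hf : (∀ i, 0 ≤ w i) → ∀ i, 0 ≤ flip w i := by
    intro h i
    fin_cases i <;> exact h _
  rw [mem_cells] at hw ⊢
  simp only [flip, Matrix.cons_val] at hf ⊢
  rcases hw with (⟨h, h'⟩ | ⟨h, h'⟩) | (⟨h, h'⟩ | ⟨h, h'⟩) | (⟨h, h'⟩ | ⟨h, h'⟩)
  · exact .inr (.inl (.inl ⟨hf h, by tauto⟩))
  · exact .inr (.inl (.inr ⟨hf h, by tauto⟩))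
  · exact .inl (.inl ⟨hf h, by tauto⟩)
  · exact .inl (.inr ⟨hf h, by tauto⟩)
  · exact .inr (.inr (.inl ⟨hf h, h'.1, h'.2.2.1, h'.2.1, by linarith [h'.2.2.2]⟩))
  · exact .inr (.inr (.inr ⟨hf h, h'.2.1, h'.1, by linarith [h'.2.2]⟩))

/-- Planar position of two inner vertices `a = κA q + sA u`, `b = κB q + sB v` for which the six
cells are embedded; `U = det (u, q)`, `V = det (q, v)`, `W = det (u, v)`. -/
structure IsFan (κA κB sA sB U V W : ℝ) : Prop where
  κA_pos : 0 < κA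
  κA_lt : κA < 1
  κB_pos : 0 < κB
  κB_lt : κB < 1
  sA_nonneg : 0 ≤ sA
  sB_nonneg : 0 ≤ sB
  U_pos : 0 < U
  V_pos : 0 < V
  W_nonneg : 0 ≤ W
  lower : 0 < κA * sB * V + sA * κB * U + sA * sB * W
  upper : 0 < (1 - κB) * sA * U + (1 - κA) * sB * V - sA * sB * W

/-! ### Embedding of the six cells in the plane. -/

section Fan

variable {κA κB sA sB U V W : ℝ}

theorem IsFan.symm (h : IsFan κA κB sA sB U V W) : IsFan κB κA sB sA V U W :=
  ⟨h.κB_pos, h.κB_lt, h.κA_pos, h.κA_lt, h.sB_nonneg, h.sA_nonneg, h.V_pos, h.U_pos, h.W_nonneg,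
    by linarith [h.lower], by linarith [h.upper]⟩

/-- The coordinates of the point with coefficients `w`: `det (q, ·)`, `det (u, ·)`, `det (·, v)`. -/
def acrossCoord (sA sB U V : ℝ) (w : Coef) : ℝ :=
  - sA * U * w 0 + sB * V * w 1 - U * w 3 + V * w 4
def leftCoord (κA κB sB U W : ℝ) (w : Coef) : ℝ :=
  κA * U * w 0 + (κB * U + sB * W) * w 1 + U * w 2 + W * w 4
def rightCoord (κA κB sA V W : ℝ) (w : Coef) : ℝ :=
  (κA * V + sA * W) * w 0 + κB * V * w 1 + V * w 2 + W * w 3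

theorem eq_zero_of_mul_add {c x y : ℝ} (hc : 0 < c) (hx : 0 ≤ x) (hy : 0 ≤ y)
    (h : c * x + y = 0) : x = 0 ∧ y = 0 := by
  have h1 : 0 ≤ c * x := by positivity
  have h2 : c * x = 0 := by linarith
  exact ⟨(mul_eq_zero.1 h2).resolve_left hc.ne', by linarith⟩

theorem eq_of_mul_sub {c x y : ℝ} (hc : 0 < c) (h : c * (x - y) = 0) : x = y :=
  sub_eq_zero.1 ((mul_eq_zero.1 h).resolve_left hc.ne')

/-- The determinant with `u` is at most `κA * U` on the lower cell and at least that on the upper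
one, and it determines the coefficients of `a` and `q`. The determinant with `q` then determines
that of `u`. -/
theorem IsFan.inj_left_left (h : IsFan κA κB sA sB U V W) {w w' : Coef}
    (hw : ((∀ i, 0 ≤ w i) ∧ w 1 = 0 ∧ w 2 = 0 ∧ w 4 = 0 ∧ w 0 ≤ 1) ∨
      ((∀ i, 0 ≤ w i) ∧ w 1 = 0 ∧ w 4 = 0 ∧ w 0 + w 2 = 1))
    (hw' : ((∀ i, 0 ≤ w' i) ∧ w' 1 = 0 ∧ w' 2 = 0 ∧ w' 4 = 0 ∧ w' 0 ≤ 1) ∨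
      ((∀ i, 0 ≤ w' i) ∧ w' 1 = 0 ∧ w' 4 = 0 ∧ w' 0 + w' 2 = 1))
    (hδ : acrossCoord sA sB U V w = acrossCoord sA sB U V w')
    (hA : leftCoord κA κB sB U W w = leftCoord κA κB sB U W w') : w = w' := by
  have hU := h.U_pos
  have hκ := h.κA_pos
  have hκ' := h.κA_lt
  simp only [acrossCoord, leftCoord] at hδ hA
  have key : w 0 = w' 0 → w 1 = w' 1 → w 2 = w' 2 → w 4 = w' 4 → w = w' := by
    intro h0 h1 h2 h4
    refine coef_ext h0 h1 h2 (eq_of_mul_sub hU ?_) h4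
    linear_combination -hδ - sA * U * h0 + sB * V * h1 + V * h4
  rcases hw with ⟨n, h1, h2, h4, h0⟩ | ⟨n, h1, h4, h0⟩ <;>
    rcases hw' with ⟨n', h1', h2', h4', h0'⟩ | ⟨n', h1', h4', h0'⟩ <;>
    rw [h1, h4, h1', h4'] at hA
  · rw [h2, h2'] at hA
    refine key (eq_of_mul_sub (mul_pos hκ hU) ?_) (by rw [h1, h1']) (by rw [h2, h2'])
      (by rw [h4, h4'])
    linear_combination hA
  · rw [h2] at hA
    have e : κA * (1 - w 0) + (1 - κA) * w' 2 = 0 := by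
      have : U * (κA * (1 - w 0) + (1 - κA) * w' 2) = 0 := by
        linear_combination -hA - κA * U * h0'
      exact (mul_eq_zero.1 this).resolve_left hU.ne'
    obtain ⟨e1, e2⟩ := eq_zero_of_mul_add hκ (by linarith)
      (mul_nonneg (by linarith) (n' 2)) e
    have e3 := (mul_eq_zero.1 e2).resolve_left (by linarith)
    exact key (by linarith) (by rw [h1, h1']) (by rw [h2, e3]) (by rw [h4, h4'])
  · rw [h2'] at hA
    have e : κA * (1 - w' 0) + (1 - κA) * w 2 = 0 := by
      have : U * (κA * (1 - w' 0) + (1 - κA) * w 2) = 0 := by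
        linear_combination hA - κA * U * h0
      exact (mul_eq_zero.1 this).resolve_left hU.ne'
    obtain ⟨e1, e2⟩ := eq_zero_of_mul_add hκ (by linarith)
      (mul_nonneg (by linarith) (n 2)) e
    have e3 := (mul_eq_zero.1 e2).resolve_left (by linarith)
    exact key (by linarith) (by rw [h1, h1']) (by rw [h2', e3]) (by rw [h4, h4'])
  · have e : w 2 = w' 2 := by
      refine eq_of_mul_sub (mul_pos (sub_pos.2 hκ') hU) ?_
      linear_combination hA - κA * U * h0 + κA * U * h0'
    exact key (by linarith) (by rw [h1, h1']) e (by rw [h4, h4'])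

/-- The lines `oa` and `aq` separate the left strips from the triangles: a common point has no `b`
and no `u` component, so it already belongs to a left cell. -/
theorem IsFan.inj_left_mid (h : IsFan κA κB sA sB U V W) {w w' : Coef}
    (hw : ((∀ i, 0 ≤ w i) ∧ w 1 = 0 ∧ w 2 = 0 ∧ w 4 = 0 ∧ w 0 ≤ 1) ∨
      ((∀ i, 0 ≤ w i) ∧ w 1 = 0 ∧ w 4 = 0 ∧ w 0 + w 2 = 1))
    (hw' : ((∀ i, 0 ≤ w' i) ∧ w' 2 = 0 ∧ w' 3 = 0 ∧ w' 4 = 0 ∧ w' 0 + w' 1 ≤ 1) ∨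
      ((∀ i, 0 ≤ w' i) ∧ w' 3 = 0 ∧ w' 4 = 0 ∧ w' 0 + w' 1 + w' 2 = 1))
    (hδ : acrossCoord sA sB U V w = acrossCoord sA sB U V w')
    (hA : leftCoord κA κB sB U W w = leftCoord κA κB sB U W w') : w = w' := by
  have hU := h.U_pos
  have hκ := h.κA_pos
  have hκ' := h.κA_lt
  have hs := h.sA_nonneg
  have hlo := h.lower
  have hup := h.upper
  have hw1 : w 1 = 0 := by rcases hw with hw | hw <;> exact hw.2.1
  suffices H : w' 1 = 0 ∧ w 3 = 0 by
    refine h.inj_left_left hw ?_ hδ hA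
    rcases hw' with ⟨n', h2', h3', h4', h0'⟩ | ⟨n', h3', h4', h0'⟩
    · exact .inl ⟨n', H.1, h2', h4', by linarith⟩
    · exact .inr ⟨n', H.1, h4', by linarith⟩
  have n' : (∀ i, 0 ≤ w' i) ∧ w' 3 = 0 ∧ w' 4 = 0 ∧ w' 0 + w' 1 + w' 2 ≤ 1 := by
    rcases hw' with ⟨n', h2', h3', h4', h0'⟩ | ⟨n', h3', h4', h0'⟩
    · exact ⟨n', h3', h4', by linarith⟩
    · exact ⟨n', h3', h4', h0'.le⟩
  obtain ⟨n', h3', h4', h0'⟩ := n'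
  simp only [acrossCoord, leftCoord] at hδ hA
  rw [h3', h4', hw1] at hδ
  rw [h4', hw1] at hA
  rcases hw with ⟨n, h1, h2, h4, h0⟩ | ⟨n, h1, h4, h0⟩
  · rw [h4] at hδ hA
    rw [h2] at hA
    -- Compare det(a, ·), which is `κA * acrossCoord + sA * leftCoord`: it is nonpositive on the
    -- lower left cell and nonnegative on the triangles, where `lower` is det(a, b).
    obtain ⟨e1, e2⟩ := eq_zero_of_mul_add (mul_pos hκ hU) (n 3)
      (y := (κA * sB * V + sA * κB * U + sA * sB * W) * w' 1 + sA * U * w' 2)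
      (add_nonneg (mul_nonneg hlo.le (n' 1)) (mul_nonneg (mul_nonneg hs hU.le) (n' 2)))
      (by linear_combination -κA * hδ - sA * hA)
    exact ⟨(eq_zero_of_mul_add hlo (n' 1) (mul_nonneg (mul_nonneg hs hU.le) (n' 2)) e2).1, e1⟩
  · rw [h4] at hδ hA
    -- The same with det(a - q, · - q); here `upper` is det(b - q, a - q).
    obtain ⟨e1, e2⟩ := eq_zero_of_mul_add (mul_pos (sub_pos.2 hκ') hU) (n 3)
      (y := ((1 - κB) * sA * U + (1 - κA) * sB * V - sA * sB * W) * w' 1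
        + sA * U * (1 - (w' 0 + w' 1 + w' 2)))
      (add_nonneg (mul_nonneg hup.le (n' 1)) (mul_nonneg (mul_nonneg hs hU.le) (by linarith)))
      (by linear_combination -(1 - κA) * hδ + sA * hA - sA * U * h0)
    exact ⟨(eq_zero_of_mul_add hup (n' 1) (mul_nonneg (mul_nonneg hs hU.le) (by linarith)) e2).1,
      e1⟩

/-- The line `ab` separates the two triangles, because `lower` and `upper` put `o` and `q` on
opposite sides of it. -/
theorem IsFan.inj_mid_mid (h : IsFan κA κB sA sB U V W) {w w' : Coef}
    (hw : ((∀ i, 0 ≤ w i) ∧ w 2 = 0 ∧ w 3 = 0 ∧ w 4 = 0 ∧ w 0 + w 1 ≤ 1) ∨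
      ((∀ i, 0 ≤ w i) ∧ w 3 = 0 ∧ w 4 = 0 ∧ w 0 + w 1 + w 2 = 1))
    (hw' : ((∀ i, 0 ≤ w' i) ∧ w' 2 = 0 ∧ w' 3 = 0 ∧ w' 4 = 0 ∧ w' 0 + w' 1 ≤ 1) ∨
      ((∀ i, 0 ≤ w' i) ∧ w' 3 = 0 ∧ w' 4 = 0 ∧ w' 0 + w' 1 + w' 2 = 1))
    (hδ : acrossCoord sA sB U V w = acrossCoord sA sB U V w')
    (hA : leftCoord κA κB sB U W w = leftCoord κA κB sB U W w')
    (hB : rightCoord κA κB sA V W w = rightCoord κA κB sA V W w') : w = w' := by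
  have hlo := h.lower
  have hup := h.upper
  simp only [acrossCoord, leftCoord, rightCoord] at hδ hA hB
  have main : w 3 = 0 → w 4 = 0 → w' 3 = 0 → w' 4 = 0 → w 2 = w' 2 → w = w' := by
    intro h3 h4 h3' h4' h2
    rw [h3, h4, h3', h4'] at hδ
    rw [h4, h4', h2] at hA
    rw [h3, h3', h2] at hB
    refine coef_ext (eq_of_mul_sub hlo ?_) (eq_of_mul_sub hlo ?_) h2 (by rw [h3, h3'])
      (by rw [h4, h4'])
    · linear_combination -κB * hδ + sB * hB
    · linear_combination κA * hδ + sA * hA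
  have cross : ∀ {w w' : Coef}, (∀ i, 0 ≤ w i) → (∀ i, 0 ≤ w' i) → w 2 = 0 →
      w 0 + w 1 ≤ 1 → w' 0 + w' 1 + w' 2 = 1 →
      -sA * U * w 0 + sB * V * w 1 = -sA * U * w' 0 + sB * V * w' 1 →
      κA * U * w 0 + (κB * U + sB * W) * w 1 =
        κA * U * w' 0 + (κB * U + sB * W) * w' 1 + U * w' 2 →
      (κA * V + sA * W) * w 0 + κB * V * w 1 =
        (κA * V + sA * W) * w' 0 + κB * V * w' 1 + V * w' 2 →
      w' 2 = 0 := by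
    intro w w' n n' h2 h0 h0' hδ hA hB
    -- The signed distance from the line `ab`, up to a factor, is det(b - a, ·) + lower. It equals
    -- `lower * (1 - w 0 - w 1)` on the triangle at `o` and `-upper * w' 2` on the one at `q`.
    exact (eq_zero_of_mul_add hup (n' 2) (mul_nonneg hlo.le (sub_nonneg.2 h0))
      (by linear_combination (κB - κA) * hδ - sB * hB - sA * hA -
        (κA * sB * V + sA * κB * U + sA * sB * W) * h0')).1
  rcases hw with ⟨n, h2, h3, h4, h0⟩ | ⟨n, h3, h4, h0⟩ <;>
    rcases hw' with ⟨n', h2', h3', h4', h0'⟩ | ⟨n', h3', h4', h0'⟩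
  · exact main h3 h4 h3' h4' (by rw [h2, h2'])
  · refine main h3 h4 h3' h4' ?_
    rw [h2, cross n n' h2 h0 h0' (by simpa [h3, h4, h3', h4'] using hδ)
      (by simpa [h2, h4, h4'] using hA) (by simpa [h2, h3, h3'] using hB)]
  · refine main h3 h4 h3' h4' ?_
    rw [h2', cross n' n h2' h0' h0 (by simpa [h3, h4, h3', h4'] using hδ.symm)
      (by simpa [h2', h4, h4'] using hA.symm) (by simpa [h2', h3, h3'] using hB.symm)]
  · have e : w 2 - w' 2 = -(w 0 - w' 0) - (w 1 - w' 1) := by linarith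
    refine main h3 h4 h3' h4' ?_
    rw [h3, h4, h3', h4'] at hδ
    rw [h4, h4'] at hA
    rw [h3, h3'] at hB
    refine eq_of_mul_sub (c := ((1 - κB) * sA * U + (1 - κA) * sB * V - sA * sB * W)) hup ?_
    linear_combination -((κB - κA) * hδ - sB * hB - sA * hA) +
      (κA * sB * V + sA * κB * U + sA * sB * W) * (h0' - h0)

theorem acrossCoord_flip (w : Coef) :
    acrossCoord sB sA V U (flip w) = -acrossCoord sA sB U V w := by
  simp only [acrossCoord, flip, Matrix.cons_val]
  ring

theorem leftCoord_flip (w : Coef) :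
    leftCoord κB κA sA V W (flip w) = rightCoord κA κB sA V W w := by
  simp only [leftCoord, rightCoord, flip, Matrix.cons_val]
  ring

theorem flip_nonneg {w : Coef} (h : ∀ i, 0 ≤ w i) (i : Fin 5) : 0 ≤ flip w i := by
  fin_cases i <;> exact h _

theorem flip_injective {w w' : Coef} (h : flip w = flip w') : w = w' := by
  rw [← flip_flip w, h, flip_flip]

/-- The line `oq` separates the two faces, so `acrossCoord` vanishes at a common point. By `lower`
the distances `sA` and `sB` are not both zero; on a side where the distance is positive the common
point has no component along the inner vertex, which reduces the claim to `inj_left_mid` or its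
mirror image. -/
theorem IsFan.inj_left_right (h : IsFan κA κB sA sB U V W) {w w' : Coef}
    (hw : ((∀ i, 0 ≤ w i) ∧ w 1 = 0 ∧ w 2 = 0 ∧ w 4 = 0 ∧ w 0 ≤ 1) ∨
      ((∀ i, 0 ≤ w i) ∧ w 1 = 0 ∧ w 4 = 0 ∧ w 0 + w 2 = 1))
    (hw' : ((∀ i, 0 ≤ w' i) ∧ w' 0 = 0 ∧ w' 2 = 0 ∧ w' 3 = 0 ∧ w' 1 ≤ 1) ∨
      ((∀ i, 0 ≤ w' i) ∧ w' 0 = 0 ∧ w' 3 = 0 ∧ w' 1 + w' 2 = 1))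
    (hδ : acrossCoord sA sB U V w = acrossCoord sA sB U V w')
    (hA : leftCoord κA κB sB U W w = leftCoord κA κB sB U W w')
    (hB : rightCoord κA κB sA V W w = rightCoord κA κB sA V W w') : w = w' := by
  have hU := h.U_pos
  have hV := h.V_pos
  have n : ∀ i, 0 ≤ w i := by rcases hw with hw | hw <;> exact hw.1
  have n' : ∀ i, 0 ≤ w' i := by rcases hw' with hw | hw <;> exact hw.1
  have e1 : w 1 = 0 := by rcases hw with hw | hw <;> exact hw.2.1
  have e4 : w 4 = 0 := by rcases hw with hw | hw <;> tauto
  have e0' : w' 0 = 0 := by rcases hw' with hw | hw <;> exact hw.2.1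
  have e3' : w' 3 = 0 := by rcases hw' with hw | hw <;> tauto
  have hδ' := hδ
  simp only [acrossCoord] at hδ'
  rw [e1, e4, e0', e3'] at hδ'
  have s1 : 0 ≤ sA * U * w 0 := mul_nonneg (mul_nonneg h.sA_nonneg hU.le) (n 0)
  have s2 : 0 ≤ sB * V * w' 1 := mul_nonneg (mul_nonneg h.sB_nonneg hV.le) (n' 1)
  have s3 : 0 ≤ V * w' 4 := mul_nonneg hV.le (n' 4)
  obtain ⟨e3, e⟩ := eq_zero_of_mul_add hU (n 3) (y := sA * U * w 0 + sB * V * w' 1 + V * w' 4)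
    (by linarith) (by linarith)
  have e4' : w' 4 = 0 := (mul_eq_zero.1 (by linarith : V * w' 4 = 0)).resolve_left hV.ne'
  rcases h.sB_nonneg.eq_or_lt with hs | hs
  · have hs' : 0 < sA := by
      refine h.sA_nonneg.lt_of_ne' fun h0 => ?_
      have := h.lower
      rw [← hs, h0] at this
      linarith
    have e0 : w 0 = 0 :=
      (mul_eq_zero.1 (by linarith : sA * U * w 0 = 0)).resolve_left (by positivity)
    refine flip_injective (h.symm.inj_left_mid (w := flip w') (w' := flip w) ?_ ?_ ?_ ?_).symm
    · rcases hw' with h' | h'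
      · exact .inl ⟨flip_nonneg n', e0', h'.2.2.1, e3', h'.2.2.2.2⟩
      · exact .inr ⟨flip_nonneg n', e0', e3', h'.2.2.2⟩
    · have : w 0 + w 1 + w 2 = w 2 := by rw [e0, e1]; ring
      rcases hw with h' | h'
      · refine .inl ⟨flip_nonneg n, h'.2.2.1, e4, e3, ?_⟩
        change w 1 + w 0 ≤ 1
        linarith
      · refine .inr ⟨flip_nonneg n, e4, e3, ?_⟩
        change w 1 + w 0 + w 2 = 1
        linarith [h'.2.2.2]
    · rw [acrossCoord_flip, acrossCoord_flip, hδ]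
    · rw [leftCoord_flip, leftCoord_flip, hB]
  · have e1' : w' 1 = 0 :=
      (mul_eq_zero.1 (by linarith : sB * V * w' 1 = 0)).resolve_left (by positivity)
    refine h.inj_left_mid hw ?_ hδ hA
    rcases hw' with h' | h'
    · exact .inl ⟨n', h'.2.2.1, e3', e4', by linarith⟩
    · exact .inr ⟨n', e3', e4', by linarith [h'.2.2.2]⟩

/-- The cells are embedded in the plane. -/
theorem IsFan.inj (h : IsFan κA κB sA sB U V W) {w w' : Coef} (hw : w ∈ cells) (hw' : w' ∈ cells)
    (hδ : acrossCoord sA sB U V w = acrossCoord sA sB U V w')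
    (hA : leftCoord κA κB sB U W w = leftCoord κA κB sB U W w')
    (hB : rightCoord κA κB sA V W w = rightCoord κA κB sA V W w') : w = w' := by
  have hδ' : acrossCoord sB sA V U (flip w) = acrossCoord sB sA V U (flip w') := by
    rw [acrossCoord_flip, acrossCoord_flip, hδ]
  have hA' : leftCoord κB κA sA V W (flip w) = leftCoord κB κA sA V W (flip w') := by
    rw [leftCoord_flip, leftCoord_flip, hB]
  have hf := flip_mem_cells hw
  have hf' := flip_mem_cells hw'
  rw [mem_cells] at hw hw' hf hf'
  have turn : ∀ {w : Coef}, (((∀ i, 0 ≤ w i) ∧ w 0 = 0 ∧ w 2 = 0 ∧ w 3 = 0 ∧ w 1 ≤ 1) ∨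
      ((∀ i, 0 ≤ w i) ∧ w 0 = 0 ∧ w 3 = 0 ∧ w 1 + w 2 = 1)) →
      (((∀ i, 0 ≤ flip w i) ∧ flip w 1 = 0 ∧ flip w 2 = 0 ∧ flip w 4 = 0 ∧ flip w 0 ≤ 1) ∨
      ((∀ i, 0 ≤ flip w i) ∧ flip w 1 = 0 ∧ flip w 4 = 0 ∧ flip w 0 + flip w 2 = 1)) := by
    intro w hw
    exact hw.imp (fun h => ⟨flip_nonneg h.1, h.2⟩) (fun h => ⟨flip_nonneg h.1, h.2⟩)
  have turn' : ∀ {w : Coef},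
      (((∀ i, 0 ≤ w i) ∧ w 2 = 0 ∧ w 3 = 0 ∧ w 4 = 0 ∧ w 0 + w 1 ≤ 1) ∨
      ((∀ i, 0 ≤ w i) ∧ w 3 = 0 ∧ w 4 = 0 ∧ w 0 + w 1 + w 2 = 1)) →
      (((∀ i, 0 ≤ flip w i) ∧ flip w 2 = 0 ∧ flip w 3 = 0 ∧ flip w 4 = 0 ∧
        flip w 0 + flip w 1 ≤ 1) ∨
      ((∀ i, 0 ≤ flip w i) ∧ flip w 3 = 0 ∧ flip w 4 = 0 ∧
        flip w 0 + flip w 1 + flip w 2 = 1)) := by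
    intro w hw
    refine hw.imp (fun h => ⟨flip_nonneg h.1, h.2.1, h.2.2.2.1, h.2.2.1, ?_⟩)
      (fun h => ⟨flip_nonneg h.1, h.2.2.1, h.2.1, ?_⟩)
    · exact (add_comm _ _).trans_le h.2.2.2.2
    · change w 1 + w 0 + w 2 = 1
      linarith [h.2.2.2]
  rcases hw with hw | hw | hw <;> rcases hw' with hw' | hw' | hw'
  · exact h.inj_left_left hw hw' hδ hA
  · exact h.inj_left_right hw hw' hδ hA hB
  · exact h.inj_left_mid hw hw' hδ hA
  · exact (h.inj_left_right hw' hw hδ.symm hA.symm hB.symm).symm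
  · exact flip_injective (h.symm.inj_left_left (turn hw) (turn hw') hδ' hA')
  · exact flip_injective (h.symm.inj_left_mid (turn hw) (turn' hw') hδ' hA')
  · exact (h.inj_left_mid hw' hw hδ.symm hA.symm).symm
  · exact flip_injective (h.symm.inj_left_mid (turn hw') (turn' hw) hδ'.symm hA'.symm).symm
  · exact h.inj_mid_mid hw hw' hδ hA hB

end Fan

/-! ### Realizations of the complex -/

section Ev

variable {E : Type*} [AddCommGroup E] [Module ℝ E]

/-- The point with coefficients `w`. -/
def ev (a b q u v : E) (w : Coef) : E :=
  w 0 • a + w 1 • b + w 2 • q + w 3 • u + w 4 • v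

theorem ev_flip (a b q u v : E) (w : Coef) : ev b a q v u (flip w) = ev a b q u v w := by
  simp only [ev, flip, Matrix.cons_val]
  abel

theorem ev_vec (a b q u v : E) (c0 c1 c2 c3 c4 : ℝ) :
    ev a b q u v ![c0, c1, c2, c3, c4] = c0 • a + c1 • b + c2 • q + c3 • u + c4 • v := by
  simp [ev]

theorem vec_nonneg {c0 c1 c2 c3 c4 : ℝ} (h0 : 0 ≤ c0) (h1 : 0 ≤ c1) (h2 : 0 ≤ c2) (h3 : 0 ≤ c3)
    (h4 : 0 ≤ c4) (i : Fin 5) : 0 ≤ (![c0, c1, c2, c3, c4] : Coef) i := by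
  fin_cases i <;> assumption

variable {κA κB sA sB U V W : ℝ} {a b q u v : E}

/-- The position of the inner vertices relative to the spanning edge and the horizontal edges. -/
structure IsPlaced (κA κB sA sB U V W : ℝ) (a b q u v : E) : Prop where
  fan : IsFan κA κB sA sB U V W
  left : a = κA • q + sA • u
  right : b = κB • q + sB • v
  dep : W • q = V • u + U • v

theorem IsPlaced.symm (h : IsPlaced κA κB sA sB U V W a b q u v) :
    IsPlaced κB κA sB sA V U W b a q v u :=
  ⟨h.fan.symm, h.right, h.left, by rw [h.dep, add_comm]⟩

/-- The hypothesis `hl` says that the point lies on the `u` side of the line `oq`. Eliminating `v`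
through `dep` gives its strip coordinates. -/
theorem IsPlaced.mem_left (h : IsPlaced κA κB sA sB U V W a b q u v) {c0 c1 c2 : ℝ} (h0 : 0 ≤ c0)
    (h1 : 0 ≤ c1) (h2 : 0 ≤ c2) (hs : c0 + c1 + c2 ≤ 1) (hl : c1 * (sB * V) ≤ c0 * (sA * U)) :
    ∃ r ∈ Icc (0 : ℝ) 1, ∃ s : ℝ, 0 ≤ s ∧ c0 • a + c1 • b + c2 • q = r • q + s • u := by
  have hU := h.fan.U_pos
  have hV := h.fan.V_pos
  have hW := h.fan.W_nonneg
  have hA := h.fan.sA_nonneg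
  have hB := h.fan.sB_nonneg
  have kA := h.fan.κA_pos
  have kB := h.fan.κB_pos
  have kA' := h.fan.κA_lt
  have kB' := h.fan.κB_lt
  have hup := h.fan.upper
  have hv : v = (W / U) • q - (V / U) • u := by
    have : v = (1 / U) • (W • q - V • u) := by
      rw [h.dep, add_sub_cancel_left, smul_smul, one_div_mul_cancel hU.ne', one_smul]
    rw [this]
    module
  -- This is the bound r ≤ 1 for the strip coordinate. For `sA > 0` it is `upper` combined with
  -- `hl`; for `sA = 0` the hypothesis `hl` kills the `b` contribution.
  have hP : c1 * sB * (W / U) ≤ c1 * (1 - κB) + c0 * (1 - κA) := by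
    rcases hA.eq_or_lt with hA | hA
    · rw [← hA] at hl
      have : c1 * (sB * V) = 0 := le_antisymm (by linarith) (by positivity)
      have : c1 * sB = 0 := by
        refine (mul_eq_zero.1 (?_ : (c1 * sB) * V = 0)).resolve_right hV.ne'
        linarith
      rw [this, zero_mul]
      exact add_nonneg (mul_nonneg h1 (by linarith)) (mul_nonneg h0 (by linarith))
    · refine le_of_mul_le_mul_left ?_ (mul_pos hA hU)
      have e : sA * U * (c1 * sB * (W / U)) = c1 * (sA * sB * W) := by
        field_simp
      rw [e]
      have e1 := mul_le_mul_of_nonneg_left hup.le h1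
      have e2 := mul_le_mul_of_nonneg_left hl (sub_nonneg.2 kA'.le)
      nlinarith
  refine ⟨κA * c0 + κB * c1 + c2 + c1 * sB * (W / U), ⟨by positivity, by linarith⟩,
    c0 * sA - c1 * sB * (V / U), ?_, ?_⟩
  · have : c1 * sB * (V / U) ≤ c0 * sA := by
      rw [← mul_div_assoc, div_le_iff₀ hU]
      linarith
    linarith
  · rw [h.left, h.right, hv]
    module

theorem IsPlaced.mem_corner (h : IsPlaced κA κB sA sB U V W a b q u v) {c0 c1 c2 : ℝ}
    (h0 : 0 ≤ c0) (h1 : 0 ≤ c1) (h2 : 0 ≤ c2) (hs : c0 + c1 + c2 ≤ 1) :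
    ∃ r ∈ Icc (0 : ℝ) 1, ∃ s : ℝ, 0 ≤ s ∧ (c0 • a + c1 • b + c2 • q = r • q + s • u ∨
      c0 • a + c1 • b + c2 • q = r • q + s • v) := by
  rcases le_total (c1 * (sB * V)) (c0 * (sA * U)) with hl | hl
  · obtain ⟨r, hr, s, hs, e⟩ := h.mem_left h0 h1 h2 hs hl
    exact ⟨r, hr, s, hs, .inl e⟩
  · obtain ⟨r, hr, s, hs, e⟩ := h.symm.mem_left h1 h0 h2 (by linarith) hl
    exact ⟨r, hr, s, hs, .inr (by rw [← e, add_comm (c1 • b)])⟩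

/-- The triangle on the spanning edge with apex `a` is covered by the two triangular cells. -/
theorem IsPlaced.exists_triangle (h : IsPlaced κA κB sA sB U V W a b q u v) {c n : ℝ} (hc : 0 ≤ c)
    (hn : 0 ≤ n) (hs : c + n ≤ 1) : ∃ w ∈ cells, ev a b q u v w = c • a + n • q := by
  have hU := h.fan.U_pos
  have hV := h.fan.V_pos
  have hA := h.fan.sA_nonneg
  have hB := h.fan.sB_nonneg
  set lo := κA * sB * V + sA * κB * U + sA * sB * W with hlo'
  set up := (1 - κB) * sA * U + (1 - κA) * sB * V - sA * sB * W with hup'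
  have hlo : 0 < lo := h.fan.lower
  have hup : 0 < up := h.fan.upper
  have hsum : sB * V + sA * U = lo + up := by rw [hlo', hup']; ring
  -- The segment `ab` meets the spanning edge at the fraction `lo / (lo + up)` of `oq`. The case
  -- distinction below asks on which side of `ab` the point lies.
  have hm : (sB * V) • a + (sA * U) • b = lo • q := by
    have hlo2 : lo • q = (κA * sB * V + sA * κB * U) • q + (sA * sB) • (W • q) := by
      rw [hlo']
      module
    rw [hlo2, h.dep, h.left, h.right]
    module
  have hq : q = (sB * V / lo) • a + (sA * U / lo) • b := by
    have : q = (1 / lo) • ((sB * V) • a + (sA * U) • b) := by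
      rw [hm, smul_smul, one_div_mul_cancel hlo.ne', one_smul]
    rw [this]
    module
  rcases le_or_gt (n * (lo + up)) (lo * (1 - c)) with hl | hl
  · refine ⟨![c + n * (sB * V / lo), n * (sA * U / lo), 0, 0, 0], ?_, ?_⟩
    · refine mem_cells.2 (.inr (.inr (.inl ⟨?_, rfl, rfl, rfl, ?_⟩)))
      · exact vec_nonneg (by positivity) (by positivity) le_rfl le_rfl le_rfl
      · change c + n * (sB * V / lo) + n * (sA * U / lo) ≤ 1
        have : n * (sB * V / lo) + n * (sA * U / lo) ≤ 1 - c := by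
          rw [← mul_add, ← add_div, hsum, ← mul_div_assoc, div_le_iff₀ hlo]
          linarith
        linarith
    · rw [ev_vec]
      have e : n • q = n • ((sB * V / lo) • a + (sA * U / lo) • b) := congrArg _ hq
      rw [e]
      module
  · set d := (n * (lo + up) - lo * (1 - c)) / up with hd
    have hd0 : 0 ≤ d := div_nonneg (by linarith) hup.le
    have hd1 : d ≤ 1 - c := by
      rw [hd, div_le_iff₀ hup]
      have := mul_le_mul_of_nonneg_right (by linarith : n ≤ 1 - c) (add_pos hlo hup).le
      linarith
    have hdn : (1 - c - d) * (lo / (lo + up)) + d = n := by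
      rw [hd]
      field_simp
      ring
    have hDn : 0 < lo + up := by positivity
    have e1 : 0 ≤ 1 - c - d := by linarith
    refine ⟨![c + (1 - c - d) * (sB * V / (lo + up)), (1 - c - d) * (sA * U / (lo + up)), d, 0, 0],
      ?_, ?_⟩
    · refine mem_cells.2 (.inr (.inr (.inr ⟨?_, rfl, rfl, ?_⟩)))
      · exact vec_nonneg (by positivity) (by positivity) hd0 le_rfl le_rfl
      · change c + (1 - c - d) * (sB * V / (lo + up)) + (1 - c - d) * (sA * U / (lo + up)) + d = 1
        have : (1 - c - d) * (sB * V / (lo + up)) + (1 - c - d) * (sA * U / (lo + up)) =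
            1 - c - d := by
          rw [← mul_add, ← add_div, hsum, div_self hDn.ne', mul_one]
        linarith
    · rw [ev_vec]
      have e2 : (sB * V / (lo + up)) • a + (sA * U / (lo + up)) • b = (lo / (lo + up)) • q := by
        have := congrArg (fun x => (1 / (lo + up)) • x) hm
        convert this using 1 <;> module
      calc _ = c • a + (1 - c - d) • ((sB * V / (lo + up)) • a + (sA * U / (lo + up)) • b)
            + d • q := by module
        _ = c • a + ((1 - c - d) * (lo / (lo + up)) + d) • q := by rw [e2]; module
        _ = _ := by rw [hdn]

/-- The broken line `o a q` cuts the half-strip in two: points beyond it lie in a strip cell, points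
before it in the triangle `o a q`, which `exists_triangle` covers. -/
theorem IsPlaced.exists_left (h : IsPlaced κA κB sA sB U V W a b q u v) {r s : ℝ}
    (hr : r ∈ Icc (0 : ℝ) 1) (hs : 0 ≤ s) : ∃ w ∈ cells, ev a b q u v w = r • q + s • u := by
  have kA := h.fan.κA_pos
  have kA' := sub_pos.2 h.fan.κA_lt
  have hA := h.fan.sA_nonneg
  have tri : ∀ c, 0 ≤ c → c ≤ 1 → s < c * sA → (c * κA ≤ r) → r + c * (1 - κA) ≤ 1 →
      ∃ w ∈ cells, ev a b q u v w = r • q + s • u := by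
    intro c hc hc1 hlt e1 e2
    have hA' : 0 < sA := by
      refine hA.lt_of_ne' fun h0 => ?_
      rw [h0] at hlt
      linarith
    have hc' : s / sA ≤ c := by
      rw [div_le_iff₀ hA']
      exact hlt.le
    have e3 := mul_le_mul_of_nonneg_right hc' kA.le
    have e4 := mul_le_mul_of_nonneg_right hc' kA'.le
    obtain ⟨w, hw, e⟩ := h.exists_triangle (c := s / sA) (n := r - s / sA * κA) (by positivity)
      (by linarith) (by linarith)
    refine ⟨w, hw, e.trans ?_⟩
    have e5 : s • u = (s / sA * sA) • u := by rw [div_mul_cancel₀ _ hA'.ne']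
    rw [h.left, e5]
    module
  rcases le_or_gt r κA with hκ | hκ
  · have c0 : 0 ≤ r / κA := div_nonneg hr.1 kA.le
    have c1 : r / κA ≤ 1 := (div_le_one kA).2 hκ
    have e1 : r / κA * κA = r := div_mul_cancel₀ _ kA.ne'
    rcases lt_or_ge s (r / κA * sA) with hlt | hge
    · exact tri _ c0 c1 hlt e1.le (by linarith)
    · refine ⟨![r / κA, 0, 0, s - r / κA * sA, 0], ?_, ?_⟩
      · exact mem_cells.2 (.inl (.inl ⟨vec_nonneg c0 le_rfl le_rfl (by linarith) le_rfl, rfl, rfl,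
          rfl, c1⟩))
      · rw [ev_vec, h.left]
        have : r • q = (r / κA * κA) • q := by rw [e1]
        rw [this]
        module
  · have c0 : 0 ≤ (1 - r) / (1 - κA) := div_nonneg (by linarith [hr.2]) kA'.le
    have c1 : (1 - r) / (1 - κA) ≤ 1 := (div_le_one kA').2 (by linarith)
    have e1 : (1 - r) / (1 - κA) * (1 - κA) = 1 - r := div_mul_cancel₀ _ kA'.ne'
    rcases lt_or_ge s ((1 - r) / (1 - κA) * sA) with hlt | hge
    · exact tri _ c0 c1 hlt (by nlinarith) (by linarith)
    · refine ⟨![(1 - r) / (1 - κA), 0, 1 - (1 - r) / (1 - κA),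
        s - (1 - r) / (1 - κA) * sA, 0], ?_, ?_⟩
      · refine mem_cells.2 (.inl (.inr ⟨vec_nonneg c0 le_rfl (by linarith) (by linarith) le_rfl,
          rfl, rfl, ?_⟩))
        change (1 - r) / (1 - κA) + (1 - (1 - r) / (1 - κA)) = 1
        ring
      · rw [ev_vec, h.left]
        have : r • q = (1 - (1 - r) / (1 - κA) * (1 - κA)) • q := by rw [e1, sub_sub_cancel]
        rw [this]
        module

/-- The cells cover exactly the two half-strips swept by the spanning edge. -/
theorem IsPlaced.image_cells (h : IsPlaced κA κB sA sB U V W a b q u v) :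
    ev a b q u v '' cells = {x | ∃ r ∈ Icc (0 : ℝ) 1, ∃ s : ℝ, 0 ≤ s ∧
      (x = r • q + s • u ∨ x = r • q + s • v)} := by
  have kA := h.fan.κA_pos
  have kA' := h.fan.κA_lt
  have hA := h.fan.sA_nonneg
  have left : ∀ {w : Coef}, (∀ i, 0 ≤ w i) → w 1 = 0 → w 4 = 0 → w 0 + w 2 ≤ 1 →
      ∃ r ∈ Icc (0 : ℝ) 1, ∃ s : ℝ, 0 ≤ s ∧ ev a b q u v w = r • q + s • u := by
    intro w n h1 h4 h0
    have := mul_le_mul_of_nonneg_left kA'.le (n 0)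
    refine ⟨w 0 * κA + w 2, ⟨add_nonneg (mul_nonneg (n 0) kA.le) (n 2), by linarith⟩,
      w 0 * sA + w 3, add_nonneg (mul_nonneg (n 0) hA) (n 3), ?_⟩
    rw [ev, h1, h4, h.left]
    module
  have right : ∀ {w : Coef}, (∀ i, 0 ≤ w i) → w 0 = 0 → w 3 = 0 → w 1 + w 2 ≤ 1 →
      ∃ r ∈ Icc (0 : ℝ) 1, ∃ s : ℝ, 0 ≤ s ∧ ev a b q u v w = r • q + s • v := by
    intro w n h1 h4 h0
    have := mul_le_mul_of_nonneg_left h.fan.κB_lt.le (n 1)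
    refine ⟨w 1 * κB + w 2, ⟨add_nonneg (mul_nonneg (n 1) h.fan.κB_pos.le) (n 2), by linarith⟩,
      w 1 * sB + w 4, add_nonneg (mul_nonneg (n 1) h.fan.sB_nonneg) (n 4), ?_⟩
    rw [ev, h1, h4, h.right]
    module
  have mid : ∀ {w : Coef}, (∀ i, 0 ≤ w i) → w 3 = 0 → w 4 = 0 → w 0 + w 1 + w 2 ≤ 1 →
      ∃ r ∈ Icc (0 : ℝ) 1, ∃ s : ℝ, 0 ≤ s ∧
        (ev a b q u v w = r • q + s • u ∨ ev a b q u v w = r • q + s • v) := by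
    intro w n h3 h4 h0
    have e : ev a b q u v w = w 0 • a + w 1 • b + w 2 • q := by
      rw [ev, h3, h4]
      module
    rw [e]
    exact h.mem_corner (n 0) (n 1) (n 2) h0
  ext x
  constructor
  · rintro ⟨w, hw, rfl⟩
    rcases mem_cells.1 hw with (⟨n, c⟩ | ⟨n, c⟩) | (⟨n, c⟩ | ⟨n, c⟩) | (⟨n, c⟩ | ⟨n, c⟩)
    · obtain ⟨r, hr, s, hs, e⟩ := left n c.1 c.2.2.1 (by linarith)
      exact ⟨r, hr, s, hs, .inl e⟩
    · obtain ⟨r, hr, s, hs, e⟩ := left n c.1 c.2.1 (by linarith)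
      exact ⟨r, hr, s, hs, .inl e⟩
    · obtain ⟨r, hr, s, hs, e⟩ := right n c.1 c.2.2.1 (by linarith)
      exact ⟨r, hr, s, hs, .inr e⟩
    · obtain ⟨r, hr, s, hs, e⟩ := right n c.1 c.2.1 (by linarith)
      exact ⟨r, hr, s, hs, .inr e⟩
    · exact mid n c.2.1 c.2.2.1 (by linarith)
    · exact mid n c.1 c.2.1 (by linarith)
  · rintro ⟨r, hr, s, hs, rfl | rfl⟩
    · exact h.exists_left hr hs
    · obtain ⟨w, hw, e⟩ := h.symm.exists_left hr hs
      refine ⟨flip w, flip_mem_cells hw, ?_⟩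
      rw [← e, ← ev_flip b a q v u w]

end Ev

/-! ### Lengths of curves under piecewise isometric maps -/

section Length

variable {X Y Z ι : Type*} [TopologicalSpace X] [PseudoEMetricSpace Y] [PseudoEMetricSpace Z]

/-- Induction on the number of pieces: follow the curve up to its last visit to the piece containing
its start. On that part the endpoints lie in one isometric piece, and afterwards the curve needs one
piece less. -/
theorem edist_le_eVariationOn_of_cover [DecidableEq ι] {g : ℝ → X} {φ : ℝ → Y} {ψ : ℝ → Z}
    {S : ι → Set X} (hS : ∀ i, IsClosed (S i)) {b : ℝ} :
    ∀ (F : Finset ι) {a : ℝ}, a ≤ b → ContinuousOn g (Icc a b) →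
      (∀ s ∈ Icc a b, ∃ i ∈ F, g s ∈ S i) →
      (∀ i, ∀ s ∈ Icc a b, ∀ t ∈ Icc a b, g s ∈ S i → g t ∈ S i →
        edist (φ s) (φ t) = edist (ψ s) (ψ t)) →
      edist (φ a) (φ b) ≤ eVariationOn ψ (Icc a b) := by
  intro F
  induction F using Finset.strongInduction with
  | H F ih =>
    intro a hab hg hF hiso
    obtain ⟨i, hi, hai⟩ := hF a (left_mem_Icc.2 hab)
    have hC : IsCompact (Icc a b ∩ g ⁻¹' S i) :=
      isCompact_Icc.of_isClosed_subset (hg.preimage_isClosed_of_isClosed isClosed_Icc (hS i))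
        inter_subset_left
    have hne : (Icc a b ∩ g ⁻¹' S i).Nonempty := ⟨a, left_mem_Icc.2 hab, hai⟩
    obtain ⟨hc, hci⟩ := hC.sSup_mem hne
    set c := sSup (Icc a b ∩ g ⁻¹' S i) with hcdef
    have hlast : ∀ s ∈ Ioc c b, g s ∉ S i := fun s hs h =>
      hs.1.not_ge (le_csSup hC.bddAbove ⟨⟨hc.1.trans hs.1.le, hs.2⟩, h⟩)
    have e1 : edist (φ a) (φ c) ≤ eVariationOn ψ (Icc a c) := by
      rw [hiso i a (left_mem_Icc.2 hab) c hc hai hci]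
      exact eVariationOn.edist_le _ (left_mem_Icc.2 hc.1) (right_mem_Icc.2 hc.1)
    have e2 : edist (φ c) (φ b) ≤ eVariationOn ψ (Icc c b) := by
      rcases hc.2.eq_or_lt with h | h
      · rw [h]
        simp
      have hsub : Icc c b ⊆ Icc a b := Icc_subset_Icc_left hc.1
      refine ih (F.erase i) (Finset.erase_ssubset hi) hc.2 (hg.mono hsub) ?_
        fun j s hs t ht => hiso j s (hsub hs) t (hsub ht)
      have hT : IsClosed (⋃ j ∈ F.erase i, S j) :=
        (F.erase i).finite_toSet.isClosed_biUnion fun j _ => hS j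
      have hcl : IsClosed (Icc c b ∩ g ⁻¹' ⋃ j ∈ F.erase i, S j) :=
        (hg.mono hsub).preimage_isClosed_of_isClosed isClosed_Icc hT
      have hIoc : Ioc c b ⊆ Icc c b ∩ g ⁻¹' ⋃ j ∈ F.erase i, S j := by
        intro s hs
        obtain ⟨j, hj, hsj⟩ := hF s (hsub (Ioc_subset_Icc_self hs))
        refine ⟨Ioc_subset_Icc_self hs, mem_biUnion (Finset.mem_erase.2 ⟨?_, hj⟩) hsj⟩
        rintro rfl
        exact hlast s hs hsj
      have := closure_minimal hIoc hcl
      -- The time `c` itself belongs to the discarded piece. That the other pieces cover it too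
      -- follows because they are closed and cover `Ioc c b`.
      rw [closure_Ioc h.ne] at this
      intro s hs
      obtain ⟨j, hj, hsj⟩ := mem_iUnion₂.1 (this hs).2
      exact ⟨j, hj, hsj⟩
    have e3 : eVariationOn ψ (Icc a c) + eVariationOn ψ (Icc c b) = eVariationOn ψ (Icc a b) := by
      simpa using eVariationOn.Icc_add_Icc ψ (s := univ) hc.1 hc.2 (mem_univ c)
    exact (edist_triangle _ (φ c) _).trans ((add_le_add e1 e2).trans e3.le)

theorem eVariationOn_le_of_edist_le {φ : ℝ → Y} {ψ : ℝ → Z} {a b : ℝ}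
    (h : ∀ s ∈ Icc a b, ∀ t ∈ Icc a b, s ≤ t → edist (φ s) (φ t) ≤ eVariationOn ψ (Icc s t)) :
    eVariationOn φ (Icc a b) ≤ eVariationOn ψ (Icc a b) := by
  refine iSup_le fun p => ?_
  obtain ⟨n, I, hI, hIm⟩ := p
  calc _ ≤ ∑ i ∈ Finset.range n, eVariationOn ψ (Icc (I i) (I (i + 1))) := by
        refine Finset.sum_le_sum fun i _ => ?_
        rw [edist_comm]
        exact h _ (hIm i) _ (hIm (i + 1)) (hI i.le_succ)
    _ = eVariationOn ψ (Icc (I 0) (I n)) := eVariationOn.sum' ψ hI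
    _ ≤ _ := eVariationOn.mono _ (Icc_subset_Icc (hIm 0).1 (hIm n).2)

theorem eVariationOn_eq_of_cover [Fintype ι] {g : ℝ → X} {φ : ℝ → Y} {ψ : ℝ → Z} {S : ι → Set X}
    (hS : ∀ i, IsClosed (S i)) {a b : ℝ} (hg : ContinuousOn g (Icc a b))
    (hF : ∀ s ∈ Icc a b, ∃ i, g s ∈ S i)
    (hiso : ∀ i, ∀ s ∈ Icc a b, ∀ t ∈ Icc a b, g s ∈ S i → g t ∈ S i →
      edist (φ s) (φ t) = edist (ψ s) (ψ t)) :
    eVariationOn φ (Icc a b) = eVariationOn ψ (Icc a b) := by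
  classical
  have sub : ∀ {s t}, s ∈ Icc a b → t ∈ Icc a b → Icc s t ⊆ Icc a b := fun hs ht =>
    Icc_subset_Icc hs.1 ht.2
  apply le_antisymm
  · refine eVariationOn_le_of_edist_le fun s hs t ht hst => ?_
    exact edist_le_eVariationOn_of_cover hS Finset.univ hst (hg.mono (sub hs ht))
      (fun r hr => by simpa using hF r (sub hs ht hr))
      fun i r hr r' hr' => hiso i r (sub hs ht hr) r' (sub hs ht hr')
  · refine eVariationOn_le_of_edist_le fun s hs t ht hst => ?_
    exact edist_le_eVariationOn_of_cover hS Finset.univ hst (hg.mono (sub hs ht))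
      (fun r hr => by simpa using hF r (sub hs ht hr))
      fun i r hr r' hr' h h' => (hiso i r (sub hs ht hr) r' (sub hs ht hr') h h').symm

end Length

/-! ### Continuity of the coefficients -/

/-- Compactness argument: every cluster point of `w p'` as `p'` tends to `p` lies in the closed set
`K` and solves the equation at `p`, so it is `w p` by uniqueness. Local boundedness then turns this
into convergence. -/
theorem continuousOn_of_inverse {T X Y : Type*} [TopologicalSpace T] [TopologicalSpace X]
    [TopologicalSpace Y] [T2Space X] {K : Set Y} (hK : IsClosed K) {E : T × Y → X}
    (hE : Continuous E) {D : Set (T × X)} {w : T × X → Y}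
    (hw : ∀ p ∈ D, w p ∈ K ∧ E (p.1, w p) = p.2)
    (hinj : ∀ p ∈ D, ∀ y ∈ K, E (p.1, y) = p.2 → y = w p)
    (hbdd : ∀ p ∈ D, ∃ C, IsCompact C ∧ ∀ᶠ p' in 𝓝[D] p, w p' ∈ C) : ContinuousOn w D := by
  intro p hp
  obtain ⟨C, hC, hmem⟩ := hbdd p hp
  refine hC.tendsto_nhds_of_unique_mapClusterPt hmem fun y _ hy => ?_
  obtain ⟨F, hF, hFy⟩ := mapClusterPt_iff_ultrafilter.1 hy
  have hD : ∀ᶠ p' in (F : Filter (T × X)), p' ∈ D := hF self_mem_nhdsWithin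
  have hFp : Tendsto id (F : Filter (T × X)) (𝓝 p) := hF.trans nhdsWithin_le_nhds
  have hyK : y ∈ K := hK.mem_of_tendsto hFy (hD.mono fun p' h => (hw p' h).1)
  refine hinj p hp y hyK ?_
  have h1 : Tendsto (fun p' : T × X => E (p'.1, w p')) F (𝓝 (E (p.1, y))) :=
    (hE.tendsto _).comp (((continuous_fst.tendsto p).comp hFp).prodMk_nhds hFy)
  have h2 : Tendsto (fun p' : T × X => E (p'.1, w p')) F (𝓝 p.2) :=
    ((continuous_snd.tendsto p).comp hFp).congr' (hD.mono fun p' h => ((hw p' h).2).symm)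
  exact tendsto_nhds_unique h1 h2

/-! ### The metric data of the corner -/

/-- The metric data of the corner: cosine `c` and sine `s` of the base angle, the coordinates
`pA`, `wA` (`pB`, `wB`) of the horizontal projection of `q` along and across the bottom edge of each
face, the widths `LA`, `LB` of the faces, the height `H`, and the distances `SA`, `SB` of the final
inner crease vertices from the spanning edge, measured along the creases. -/
structure Corner where
  (c s pA pB wA wB LA LB H SA SB : ℝ)
  s_pos : 0 < s
  sq_add_sq : c ^ 2 + s ^ 2 = 1
  pB_eq : pB = pA * c + wA * s
  wB_eq : wB = pA * s - wA * c
  LA_pos : 0 < LA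
  LB_pos : 0 < LB
  H_pos : 0 < H
  LA_sq : LA ^ 2 = wA ^ 2 + H ^ 2
  LB_sq : LB ^ 2 = wB ^ 2 + H ^ 2
  SA_pos : 0 < SA
  SB_pos : 0 < SB

/-- Position on the spanning edge of a crease at relative distance `k` from the flat face. -/
def ratio (L w k : ℝ) : ℝ := (L + k - w) / (2 * (L + k))

/-- Loss of the outward displacement of the crease. -/
def dip (H L k : ℝ) : ℝ := (H ^ 2 / L - (H ^ 2 - k ^ 2) / (L + k)) / 2

/-- Displacement of that position relative to the flat face. -/
def shift (L w k : ℝ) : ℝ := w * k / (2 * L * (L + k))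

theorem ratio_eq {L w k : ℝ} (hL : 0 < L) (hk : 0 ≤ k) :
    ratio L w k = ratio L w 0 + shift L w k := by
  have : L + k ≠ 0 := by positivity
  simp only [ratio, shift]
  field_simp
  ring

theorem dip_zero (H L : ℝ) : dip H L 0 = 0 := by simp [dip]

theorem dip_eq {H L w k : ℝ} (hL : 0 < L) (h : L ^ 2 = w ^ 2 + H ^ 2) (hk : 0 ≤ k) :
    dip H L k = k / 2 - shift L w k * w := by
  have : L + k ≠ 0 := by positivity
  simp only [dip, shift]
  field_simp
  linear_combination (-k) * h

theorem dip_strictMonoOn {H L : ℝ} (hL : 0 < L) : StrictMonoOn (dip H L) (Icc 0 H) := by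
  intro k hk k' hk' hlt
  have h1 : (H ^ 2 - k' ^ 2) / (L + k') < (H ^ 2 - k ^ 2) / (L + k) := by
    have e0 := hk.1
    have e1 := hk'.2
    rw [div_lt_div_iff₀ (by linarith) (by linarith)]
    have e2 : H ^ 2 - k' ^ 2 < H ^ 2 - k ^ 2 := by nlinarith
    have e3 : 0 ≤ H ^ 2 - k' ^ 2 := by nlinarith
    calc (H ^ 2 - k' ^ 2) * (L + k) ≤ (H ^ 2 - k' ^ 2) * (L + k') :=
          mul_le_mul_of_nonneg_left (by linarith) e3
      _ < _ := mul_lt_mul_of_pos_right e2 (by linarith)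
  simp only [dip]
  linarith

theorem dip_continuousOn {H L : ℝ} (hL : 0 < L) : ContinuousOn (dip H L) (Icc 0 H) := by
  unfold dip
  refine ContinuousOn.div_const (continuousOn_const.sub (ContinuousOn.div (by fun_prop)
    (by fun_prop) fun k hk => ?_)) _
  have := hk.1
  positivity

theorem dip_nonneg {H L k : ℝ} (hL : 0 < L) (hk : k ∈ Icc 0 H) : 0 ≤ dip H L k := by
  rw [← dip_zero H L]
  exact (dip_strictMonoOn hL).monotoneOn (left_mem_Icc.2 (hk.1.trans hk.2)) hk hk.1

/-- The crease of a folded face in the cross section of the face: its distance from both edges does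
not depend on `k`. -/
theorem crease_dist_bottom {H L w k z : ℝ} (hL : 0 < L) (h : L ^ 2 = w ^ 2 + H ^ 2) (hk : 0 ≤ k)
    (hz : z ^ 2 = H ^ 2 - k ^ 2) :
    (ratio L w k * w - k / 2) ^ 2 + (ratio L w k * z) ^ 2 = (ratio L w 0 * L) ^ 2 := by
  have hLk : L + k ≠ 0 := by positivity
  have e : (ratio L w k * z) ^ 2 = ratio L w k ^ 2 * (L ^ 2 - w ^ 2 - k ^ 2) := by
    rw [mul_pow, hz]
    linear_combination (-ratio L w k ^ 2) * h
  rw [e]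
  simp only [ratio, add_zero]
  field_simp
  ring

theorem crease_dist_top {H L w k z : ℝ} (hL : 0 < L) (h : L ^ 2 = w ^ 2 + H ^ 2) (hk : 0 ≤ k)
    (hz : z ^ 2 = H ^ 2 - k ^ 2) :
    (ratio L w k * w - k / 2 - w) ^ 2 + (ratio L w k * z - z) ^ 2 = (ratio L w 0 * L - L) ^ 2 := by
  have hLk : L + k ≠ 0 := by positivity
  have e : (ratio L w k * z - z) ^ 2 = (ratio L w k - 1) ^ 2 * (L ^ 2 - w ^ 2 - k ^ 2) := by
    rw [← sub_one_mul, mul_pow, hz]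
    linear_combination (-(ratio L w k - 1) ^ 2) * h
  rw [e]
  simp only [ratio, add_zero]
  field_simp
  ring

theorem ratio_mem {H L w k : ℝ} (hL : 0 < L) (hH : 0 < H) (h : L ^ 2 = w ^ 2 + H ^ 2)
    (hk : 0 ≤ k) : 0 < ratio L w k ∧ ratio L w k < 1 := by
  have h1 : |w| < L := abs_lt_of_sq_lt_sq (by nlinarith) hL.le
  obtain ⟨h2, h3⟩ := abs_lt.1 h1
  refine ⟨div_pos (by linarith) (by linarith), ?_⟩
  rw [ratio, div_lt_one (by linarith)]
  linarith

namespace Corner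

variable (G : Corner)

/-- Squared length of the spanning edge. -/
def lsq : ℝ := G.pA ^ 2 + G.LA ^ 2

theorem lsq_pos : 0 < G.lsq := by
  have := G.LA_pos
  unfold lsq
  positivity

theorem pA_mul_s : G.pA * G.s = G.wB + G.wA * G.c := by rw [G.wB_eq]; ring

theorem pB_mul_s : G.pB * G.s = G.wA + G.wB * G.c := by
  rw [G.wB_eq, G.pB_eq]
  linear_combination G.wA * G.sq_add_sq

theorem pA_eq : G.pA = G.pB * G.c + G.wB * G.s := by
  rw [G.wB_eq, G.pB_eq]
  linear_combination (-G.pA) * G.sq_add_sq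

theorem lsq_eq : G.lsq = G.pB ^ 2 + G.LB ^ 2 := by
  rw [lsq, G.LA_sq, G.LB_sq, G.wB_eq, G.pB_eq]
  linear_combination (-G.pA ^ 2 - G.wA ^ 2) * G.sq_add_sq

/-- Product of the lengths of the normals times the cosine of the exterior angle at `oq`. -/
def nn : ℝ := G.H ^ 2 * G.c - G.wA * G.wB

/-- Equal to `lsq` times the drop from the cosine of the base angle to the cosine of the developed
angle, see `c_sub_mu`. -/
def M : ℝ := G.LA * G.LB + G.nn

theorem wA_mul_wB_le : G.wA * G.wB + G.H ^ 2 ≤ G.LA * G.LB := by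
  refine abs_le_of_sq_le_sq' ?_ (mul_pos G.LA_pos G.LB_pos).le |>.2
  rw [mul_pow, G.LA_sq, G.LB_sq]
  nlinarith [mul_nonneg (sq_nonneg G.H) (sq_nonneg (G.wA - G.wB))]

theorem neg_one_lt_c : -1 < G.c := by nlinarith [G.s_pos, G.sq_add_sq]

theorem M_pos : 0 < G.M := by
  have h1 := G.wA_mul_wB_le
  have h2 := mul_pos (pow_pos G.H_pos 2) (by linarith [G.neg_one_lt_c] : 0 < G.c + 1)
  unfold M nn
  linarith

/-- With n = u × q and m = v × q one has n × m = ± det(u, v, q) q. Taking squared lengths gives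
|n|²|m|² - ⟨n, m⟩² = s² H² |q|². -/
theorem gram : G.s ^ 2 * G.lsq * G.H ^ 2 = (G.LA * G.LB - G.nn) * G.M := by
  have h1 := G.pA_mul_s
  have : G.s ^ 2 * G.lsq = (G.wB + G.wA * G.c) ^ 2 + (1 - G.c ^ 2) * (G.wA ^ 2 + G.H ^ 2) := by
    rw [lsq, G.LA_sq, ← h1]
    linear_combination (-(G.wA ^ 2 + G.H ^ 2)) * (-G.sq_add_sq)
  rw [this]
  have e : (G.LA * G.LB - G.nn) * G.M = G.LA ^ 2 * G.LB ^ 2 - G.nn ^ 2 := by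
    unfold M
    ring
  rw [e, G.LA_sq, G.LB_sq]
  unfold nn
  ring

/-- Decrease of the cosine of the angle between the images of the two points where the creases meet
the spanning edge. -/
def gain (k : ℝ) : ℝ :=
  k ^ 2 / 4 * (G.M / (G.LA * G.LB) - (G.c - G.nn / (G.LA * G.LB)) *
    ((G.H ^ 2 - k ^ 2) / ((G.LA + k) * (G.LB + k))))

/-- Write the gain as k²/4 · (m - E φ(k)), where φ is decreasing and m + E = 1 + c > 0. For E ≥ 0
the second factor is nondecreasing, and positive already at k = 0; for E < 0 a different splitting
is needed. -/
theorem gain_strictMonoOn : StrictMonoOn G.gain (Icc 0 G.H) := by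
  intro k hk k' hk' hlt
  have hA := G.LA_pos
  have hB := G.LB_pos
  have hH := G.H_pos
  have hAB := mul_pos hA hB
  have hk0 := hk.1
  have hk0' := hk'.1
  have hkH : k' ≤ G.H := hk'.2
  have hsq : k ^ 2 < k' ^ 2 := by nlinarith
  have hsq' : k' ^ 2 ≤ G.H ^ 2 := by nlinarith
  set m := G.M / (G.LA * G.LB) with hm
  set E := G.c - G.nn / (G.LA * G.LB) with hE
  have hmE : m + E = 1 + G.c := by
    rw [hm, hE, M]
    field_simp
    ring
  have hc := G.neg_one_lt_c
  have hr : ∀ j ∈ Icc 0 G.H, 0 < (G.LA + j) * (G.LB + j) := fun j hj =>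
    mul_pos (by linarith [hj.1]) (by linarith [hj.1])
  have hpk := hr k hk
  have hpk' := hr k' hk'
  have hle : (G.LA + k) * (G.LB + k) ≤ (G.LA + k') * (G.LB + k') := by
    apply mul_le_mul <;> linarith
  simp only [gain, ← hm, ← hE]
  rcases le_or_gt 0 E with h0 | h0
  · have hφ : (G.H ^ 2 - k' ^ 2) / ((G.LA + k') * (G.LB + k')) ≤
        (G.H ^ 2 - k ^ 2) / ((G.LA + k) * (G.LB + k)) :=
      div_le_div₀ (by linarith) (by linarith) hpk hle
    have hφ0 : (G.H ^ 2 - k ^ 2) / ((G.LA + k) * (G.LB + k)) ≤ G.H ^ 2 / (G.LA * G.LB) := by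
      refine div_le_div₀ (by positivity) (by linarith [sq_nonneg k]) hAB ?_
      apply mul_le_mul <;> linarith
    have hpos : 0 < m - E * (G.H ^ 2 / (G.LA * G.LB)) := by
      have e : m - E * (G.H ^ 2 / (G.LA * G.LB)) = (G.LA * G.LB - G.wA * G.wB +
          G.nn * (G.H ^ 2 / (G.LA * G.LB))) / (G.LA * G.LB) := by
        rw [hm, hE, M]
        field_simp
        rw [nn]
        ring
      rw [e]
      refine div_pos ?_ hAB
      have h1 : 0 < (G.LA * G.LB + G.nn) * (G.H ^ 2 / (G.LA * G.LB)) :=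
        mul_pos G.M_pos (by positivity)
      have h2 : G.LA * G.LB * (G.H ^ 2 / (G.LA * G.LB)) = G.H ^ 2 := by field_simp
      linarith [G.wA_mul_wB_le]
    have h1 := mul_le_mul_of_nonneg_left hφ h0
    have h2 := mul_le_mul_of_nonneg_left hφ0 h0
    refine mul_lt_mul (by linarith) (by linarith) (by linarith) (by positivity)
  -- For E < 0, subtract from the value at H the product of (H² - k²)/4 with m + E ρ(k). Here ρ
  -- increases and stays at most 1, so the second factor is nonincreasing and at least m + E > 0,
  -- while the first strictly decreases.
  · have key : ∀ j ∈ Icc 0 G.H, j ^ 2 / 4 *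
        (m - E * ((G.H ^ 2 - j ^ 2) / ((G.LA + j) * (G.LB + j)))) = G.H ^ 2 / 4 * m -
        (G.H ^ 2 - j ^ 2) / 4 * (m + E * (j ^ 2 / ((G.LA + j) * (G.LB + j)))) := by
      intro j hj
      ring
    rw [key k hk, key k' hk']
    have hrle : k ^ 2 / ((G.LA + k) * (G.LB + k)) ≤ k' ^ 2 / ((G.LA + k') * (G.LB + k')) := by
      rw [div_le_div_iff₀ hpk hpk']
      have e1 : k * (G.LA + k') ≤ k' * (G.LA + k) := by nlinarith
      have e2 : k * (G.LB + k') ≤ k' * (G.LB + k) := by nlinarith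
      have := mul_le_mul e1 e2 (by positivity) (by positivity)
      linarith
    have hr1 : k' ^ 2 / ((G.LA + k') * (G.LB + k')) ≤ 1 := by
      rw [div_le_one hpk']
      nlinarith
    have h1 := mul_le_mul_of_nonpos_left hrle h0.le
    have h2 := mul_le_mul_of_nonpos_left hr1 h0.le
    have h3 : 0 < m + E * (k' ^ 2 / ((G.LA + k') * (G.LB + k'))) := by linarith
    have h4 := mul_lt_mul_of_pos_right
      (by linarith : (G.H ^ 2 - k' ^ 2) / 4 < (G.H ^ 2 - k ^ 2) / 4)
      h3
    have h5 := mul_le_mul_of_nonneg_left (by linarith :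
      m + E * (k' ^ 2 / ((G.LA + k') * (G.LB + k'))) ≤
      m + E * (k ^ 2 / ((G.LA + k) * (G.LB + k))))
      (by linarith : 0 ≤ (G.H ^ 2 - k ^ 2) / 4)
    linarith

theorem gain_zero : G.gain 0 = 0 := by simp [gain]

theorem gain_nonneg {k : ℝ} (hk : k ∈ Icc 0 G.H) : 0 ≤ G.gain k := by
  rw [← G.gain_zero]
  exact G.gain_strictMonoOn.monotoneOn (left_mem_Icc.2 (hk.1.trans hk.2)) hk hk.1

theorem gain_continuousOn : ContinuousOn G.gain (Icc 0 G.H) := by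
  unfold gain
  refine ContinuousOn.mul (by fun_prop) (continuousOn_const.sub (continuousOn_const.mul
    (ContinuousOn.div (by fun_prop) (by fun_prop) fun k hk => ?_)))
  have h1 := hk.1
  have := G.LA_pos
  have := G.LB_pos
  positivity

/-- The gain is what the folding of the two faces does to an inner product. -/
theorem gain_eq {k : ℝ} (hk : 0 ≤ k) : -G.gain k =
    ratio G.LA G.wA 0 * shift G.LB G.wB k * G.LB ^ 2 +
      ratio G.LB G.wB 0 * shift G.LA G.wA k * G.LA ^ 2 +
      shift G.LA G.wA k * shift G.LB G.wB k * (G.H ^ 2 - G.wA * G.wB * G.c) -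
      ratio G.LA G.wA k * ratio G.LB G.wB k * k ^ 2 - ratio G.LA G.wA k * k * G.wB / 2 -
      ratio G.LB G.wB k * k * G.wA / 2 +
      k / 2 * (shift G.LA G.wA k * (G.wB + G.wA * G.c) + shift G.LB G.wB k * (G.wA + G.wB * G.c)) -
      k ^ 2 * G.c / 4 := by
  have hA : G.LA ≠ 0 := G.LA_pos.ne'
  have hB : G.LB ≠ 0 := G.LB_pos.ne'
  have hA' : G.LA + k ≠ 0 := by linarith [G.LA_pos]
  have hB' : G.LB + k ≠ 0 := by linarith [G.LB_pos]
  have eA := dip_eq G.LA_pos G.LA_sq hk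
  have eB := dip_eq G.LB_pos G.LB_sq hk
  -- The terms containing the cosine `c` of the base angle in the last two lines and the mixed shift
  -- term factor as the product of the two dips.
  have e : (shift G.LA G.wA k * shift G.LB G.wB k * (- G.wA * G.wB * G.c)) + k / 2 *
      (shift G.LA G.wA k * (G.wA * G.c) + shift G.LB G.wB k * (G.wB * G.c)) - k ^ 2 * G.c / 4 =
      - G.c * (dip G.H G.LA k * dip G.H G.LB k) := by
    rw [eA, eB]
    ring
  have e' : -G.gain k = ratio G.LA G.wA 0 * shift G.LB G.wB k * G.LB ^ 2 +
      ratio G.LB G.wB 0 * shift G.LA G.wA k * G.LA ^ 2 +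
      shift G.LA G.wA k * shift G.LB G.wB k * G.H ^ 2 -
      ratio G.LA G.wA k * ratio G.LB G.wB k * k ^ 2 - ratio G.LA G.wA k * k * G.wB / 2 -
      ratio G.LB G.wB k * k * G.wA / 2 +
      k / 2 * (shift G.LA G.wA k * G.wB + shift G.LB G.wB k * G.wA) -
      G.c * (dip G.H G.LA k * dip G.H G.LB k) := by
    simp only [gain, M, nn, ratio, shift, dip, add_zero]
    field_simp
    ring
  rw [e']
  linear_combination -e

end Corner

/-- Serves to turn the parameter k of the folded states into the position of the moving vertex.
Surjectivity is the intermediate value theorem, and an order isomorphism of intervals is a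
homeomorphism. -/
theorem exists_continuousOn_inverse {f : ℝ → ℝ} {a b : ℝ} (hab : a ≤ b)
    (hf : StrictMonoOn f (Icc a b)) (hc : ContinuousOn f (Icc a b)) :
    ∃ g : ℝ → ℝ, ContinuousOn g (Icc (f a) (f b)) ∧ StrictMonoOn g (Icc (f a) (f b)) ∧
      ∀ y ∈ Icc (f a) (f b), g y ∈ Icc a b ∧ f (g y) = y := by
  have hex : ∀ y ∈ Icc (f a) (f b), ∃ x ∈ Icc a b, f x = y := fun y hy =>
    intermediate_value_Icc hab hc hy
  have hfab : f a ≤ f b := hf.monotoneOn (left_mem_Icc.2 hab) (right_mem_Icc.2 hab) hab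
  let F : Icc a b → Icc (f a) (f b) := fun x => ⟨f x,
    hf.monotoneOn (left_mem_Icc.2 hab) x.2 x.2.1, hf.monotoneOn x.2 (right_mem_Icc.2 hab) x.2.2⟩
  have hF : StrictMono F := fun x y h => hf x.2 y.2 h
  have hs : Function.Surjective F := fun y => by
    obtain ⟨x, hx, e⟩ := hex y y.2
    exact ⟨⟨x, hx⟩, Subtype.ext e⟩
  let e := hF.orderIsoOfSurjective F hs
  have he : ∀ y, f (e.symm y) = y := fun y => congrArg Subtype.val (e.apply_symm_apply y)
  refine ⟨fun y => e.symm (projIcc _ _ hfab y), ?_, ?_, ?_⟩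
  · exact (continuous_subtype_val.comp (e.symm.continuous.comp continuous_projIcc)).continuousOn
  · intro y hy y' hy' hlt
    simp only [projIcc_of_mem _ hy, projIcc_of_mem _ hy']
    exact e.symm.strictMono hlt
  · intro y hy
    simp only [projIcc_of_mem _ hy]
    exact ⟨(e.symm _).2, he _⟩

/-! ### The moving vertex as a function of the parameter k. -/

namespace Corner

variable (G : Corner)

/-- Difference between the cosines of the base angle and of the developed angle. -/
def mu : ℝ := G.M / G.lsq

/-- Position of the moving vertex on its crease when the folded state is the one of parameter
`k`. -/
def slide (k : ℝ) : ℝ :=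
  (G.gain k + G.s * G.SB * dip G.H G.LA k) / (G.mu * G.SB - G.s * dip G.H G.LB k)

/-- The corner, with a developed angle of at most `π`, folds flat. -/
structure Closes : Prop where
  convex : 0 ≤ G.pA * G.LB + G.pB * G.LA
  den_pos : 0 < G.mu * G.SB - G.s * dip G.H G.LB G.H
  slide_H : G.slide G.H = G.SA

theorem H_mem : G.H ∈ Icc 0 G.H := right_mem_Icc.2 G.H_pos.le

variable {G}

theorem Closes.den_pos' (h : G.Closes) {k : ℝ} (hk : k ∈ Icc 0 G.H) :
    0 < G.mu * G.SB - G.s * dip G.H G.LB k := by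
  have := mul_le_mul_of_nonneg_left
    ((dip_strictMonoOn G.LB_pos).monotoneOn hk G.H_mem hk.2) G.s_pos.le
  linarith [h.den_pos]

/-- The numerator strictly increases from 0, and the denominator decreases but stays positive by
`den_pos`. -/
theorem Closes.slide_strictMonoOn (h : G.Closes) : StrictMonoOn G.slide (Icc 0 G.H) := by
  intro k hk k' hk' hlt
  have h1 := G.gain_strictMonoOn hk hk' hlt
  have h2 := mul_lt_mul_of_pos_left (dip_strictMonoOn G.LA_pos hk hk' hlt)
    (mul_pos G.s_pos G.SB_pos)
  have h3 := mul_lt_mul_of_pos_left (dip_strictMonoOn G.LB_pos hk hk' hlt) G.s_pos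
  have h4 := mul_nonneg (mul_nonneg G.s_pos.le G.SB_pos.le) (dip_nonneg G.LA_pos hk)
  exact div_lt_div₀ (by linarith) (by linarith) (by linarith [G.gain_nonneg hk]) (h.den_pos' hk')

theorem Closes.slide_continuousOn (h : G.Closes) : ContinuousOn G.slide (Icc 0 G.H) :=
  (G.gain_continuousOn.add (continuousOn_const.mul (dip_continuousOn G.LA_pos))).div
    (continuousOn_const.sub (continuousOn_const.mul (dip_continuousOn G.LB_pos)))
    fun _ hk => (h.den_pos' hk).ne'

theorem slide_zero : G.slide 0 = 0 := by simp [slide, gain_zero, dip_zero]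

theorem Closes.slide_eq (h : G.Closes) {k : ℝ} (hk : k ∈ Icc 0 G.H) :
    G.slide k * (G.mu * G.SB - G.s * dip G.H G.LB k) = G.gain k + G.s * G.SB * dip G.H G.LA k :=
  div_mul_cancel₀ _ (h.den_pos' hk).ne'

theorem Closes.slide_nonneg (h : G.Closes) {k : ℝ} (hk : k ∈ Icc 0 G.H) : 0 ≤ G.slide k := by
  rw [← slide_zero (G := G)]
  exact h.slide_strictMonoOn.monotoneOn (left_mem_Icc.2 G.H_pos.le) hk hk.1

/-- The slide equation reads μ σ `SB` = gain + s `SB` dip_A + s σ dip_B; dropping the nonnegative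
gain and the last term leaves the claim times `SB`. -/
theorem Closes.dip_le_slide (h : G.Closes) {k : ℝ} (hk : k ∈ Icc 0 G.H) :
    G.s * dip G.H G.LA k ≤ G.mu * G.slide k := by
  have h1 := h.slide_eq hk
  have h2 := mul_nonneg (h.slide_nonneg hk) (mul_nonneg G.s_pos.le (dip_nonneg G.LB_pos hk))
  refine le_of_mul_le_mul_right ?_ G.SB_pos
  linarith [G.gain_nonneg hk]

theorem Closes.dip_le_SB (h : G.Closes) {k : ℝ} (hk : k ∈ Icc 0 G.H) :
    G.s * dip G.H G.LB k ≤ G.mu * G.SB := by linarith [h.den_pos' hk]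

/-- Over the horizontal plane, the folded crease vertex stays on the convex side of the line
through `q` parallel to the bottom edge of the other face. -/
theorem inner_side_aux {s c H wA wB LA LB lsq mu M nn σ k pA : ℝ} (hs : 0 < s) (hH : 0 < H)
    (hA : 0 < LA) (hM : 0 < M) (hl : 0 < lsq) (hmu : mu = M / lsq)
    (hgram : s ^ 2 * lsq * H ^ 2 = (LA * LB - nn) * M) (hnn : nn = H ^ 2 * c - wA * wB)
    (hpA : pA * s = wB + wA * c) (hLA : LA ^ 2 = wA ^ 2 + H ^ 2)
    (hAB : 0 ≤ LA * LB + wA * wB) (hB : 0 < LB) (hk : 0 ≤ k) (hσ : s * dip H LA k ≤ mu * σ) :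
    0 ≤ (σ - pA * shift LA wA k) * s + k / 2 * c := by
  have e1 := dip_eq hA hLA hk
  have hlt : 0 < LA + k := by linarith
  -- By `hgram` the coefficient is s²/μ, so this is the hypothesis `hσ` multiplied by s/μ.
  have h1 : (LA * LB - nn) / H ^ 2 * dip H LA k ≤ s * σ := by
    have hmp : 0 < mu := hmu ▸ div_pos hM hl
    have : (LA * LB - nn) / H ^ 2 = s ^ 2 / mu := by
      rw [hmu]
      field_simp
      linarith
    rw [this, div_mul_eq_mul_div, div_le_iff₀ hmp]
    have := mul_le_mul_of_nonneg_left hσ hs.le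
    linarith
  -- The quantity is the slack of `h1` plus an explicit remainder, which is nonnegative because `LA
  -- * LB + wA * wB` is.
  have h2 : (σ - pA * shift LA wA k) * s + k / 2 * c =
      s * σ - (LA * LB - nn) / H ^ 2 * dip H LA k +
      k / (2 * LA * (LA + k)) * (LA * LB + k * LA * (LA * LB + wA * wB) / H ^ 2) := by
    have h3 : (σ - pA * shift LA wA k) * s + k / 2 * c =
        s * σ - shift LA wA k * wB + c * dip H LA k := by
      rw [e1]
      linear_combination (-shift LA wA k) * hpA
    rw [h3, hnn]
    simp only [dip, shift]
    field_simp
    ring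
  rw [h2]
  have : 0 ≤ k / (2 * LA * (LA + k)) * (LA * LB + k * LA * (LA * LB + wA * wB) / H ^ 2) := by
    positivity
  linarith

theorem neg_wA_mul_wB_le : 0 ≤ G.LA * G.LB + G.wA * G.wB := by
  have := abs_le_of_sq_le_sq' (a := G.wA * G.wB) (b := G.LA * G.LB) (by
    rw [mul_pow, mul_pow, G.LA_sq, G.LB_sq]
    have := sq_nonneg G.H
    nlinarith [mul_nonneg this (sq_nonneg G.wA), mul_nonneg this (sq_nonneg G.wB),
      mul_nonneg this this]) (mul_pos G.LA_pos G.LB_pos).le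
  linarith [this.1]

theorem Closes.inner_side_A (h : G.Closes) {k : ℝ} (hk : k ∈ Icc 0 G.H) :
    0 ≤ (G.slide k - G.pA * shift G.LA G.wA k) * G.s + k / 2 * G.c :=
  inner_side_aux G.s_pos G.H_pos G.LA_pos G.M_pos G.lsq_pos rfl G.gram rfl G.pA_mul_s G.LA_sq
    neg_wA_mul_wB_le G.LB_pos hk.1 (h.dip_le_slide hk)

theorem Closes.inner_side_B (h : G.Closes) {k : ℝ} (hk : k ∈ Icc 0 G.H) :
    0 ≤ (G.SB - G.pB * shift G.LB G.wB k) * G.s + k / 2 * G.c :=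
  inner_side_aux (wB := G.wA) (LB := G.LA) (nn := G.nn) G.s_pos G.H_pos G.LB_pos G.M_pos G.lsq_pos
    rfl (by rw [mul_comm G.LB]; exact G.gram) (by rw [mul_comm G.wB]; rfl) G.pB_mul_s G.LB_sq
    (by rw [mul_comm G.LB, mul_comm G.wB]; exact neg_wA_mul_wB_le) G.LA_pos hk.1 (h.dip_le_SB hk)

/-! ### The development and the folded states -/

variable (G)

/-- Cosine and sine of the developed angle at `o`. -/
def cD : ℝ := (G.pA * G.pB - G.LA * G.LB) / G.lsq
def sD : ℝ := (G.pA * G.LB + G.pB * G.LA) / G.lsq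

theorem lsq_mul_c : G.lsq * G.c = G.pA * G.pB + G.nn := by
  rw [lsq, G.LA_sq, nn, G.wB_eq, G.pB_eq]
  ring

theorem c_sub_mu : G.c - G.mu = G.cD := by
  have := G.lsq_pos.ne'
  rw [mu, cD, M]
  field_simp
  linarith [G.lsq_mul_c]

theorem cD_sq_add_sD_sq : G.cD ^ 2 + G.sD ^ 2 = 1 := by
  have := G.lsq_pos.ne'
  have e : (G.pA * G.pB - G.LA * G.LB) ^ 2 + (G.pA * G.LB + G.pB * G.LA) ^ 2 = G.lsq ^ 2 := by
    rw [sq G.lsq]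
    nth_rw 2 [lsq_eq]
    rw [lsq]
    ring
  rw [cD, sD, div_pow, div_pow, ← add_div, e, div_self (by positivity)]

theorem q_inner_v : G.pA * G.cD + G.LA * G.sD = G.pB := by
  have := G.lsq_pos.ne'
  rw [cD, sD]
  field_simp
  rw [lsq]
  ring

theorem q_det_v : G.pA * G.sD - G.LA * G.cD = G.LB := by
  have := G.lsq_pos.ne'
  rw [cD, sD]
  field_simp
  rw [lsq]
  ring

abbrev κA : ℝ := ratio G.LA G.wA 0
abbrev κB : ℝ := ratio G.LB G.wB 0

/-- The moving crease vertex along and across the bottom edge, in the cross section of its face. -/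
def xA (σ : ℝ) : ℝ := G.κA * G.pA + σ
def xB : ℝ := G.κB * G.pB + G.SB
def yA (k : ℝ) : ℝ := ratio G.LA G.wA k * G.wA - k / 2
def yB (k : ℝ) : ℝ := ratio G.LB G.wB k * G.wB - k / 2

variable {G}

/-- The left side is the inner product of the two folded crease vertices, the right side that of
their developments. Once each ratio is split into its value at 0 and its shift, their equality is
exactly the slide equation `hσ` together with `gain_eq`. -/
theorem inner_fold {σ k z : ℝ} (hk : 0 ≤ k) (hz : z ^ 2 = G.H ^ 2 - k ^ 2)
    (hσ : σ * (G.mu * G.SB - G.s * dip G.H G.LB k) = G.gain k + G.s * G.SB * dip G.H G.LA k) :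
    G.xA σ * G.xB * G.c + G.xA σ * G.yB k * G.s + G.yA k * G.xB * G.s - G.yA k * G.yB k * G.c +
      ratio G.LA G.wA k * z * (ratio G.LB G.wB k * z) =
    G.κA * G.κB * G.lsq + G.κA * G.SB * G.pB + σ * G.κB * G.pA + σ * G.SB * G.cD := by
  have hg := G.gain_eq hk
  rw [dip_eq G.LA_pos G.LA_sq hk, dip_eq G.LB_pos G.LB_sq hk] at hσ
  rw [← c_sub_mu]
  simp only [xA, xB, yA, yB, κA, κB]
  rw [ratio_eq G.LA_pos hk, ratio_eq G.LB_pos hk] at *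
  generalize ratio G.LA G.wA 0 = κ at *
  generalize ratio G.LB G.wB 0 = κ' at *
  generalize shift G.LA G.wA k = r at *
  generalize shift G.LB G.wB k = r' at *
  have R2 := G.pA_eq
  have R4 := G.pB_eq
  have R5 := G.wB_eq
  have R3 : G.wA = G.pB * G.s - G.wB * G.c := by linarith [G.pB_mul_s]
  have R1 : G.pA * G.pB * G.c + G.pA * G.wB * G.s + G.wA * G.pB * G.s - G.wA * G.wB * G.c =
      G.lsq - G.H ^ 2 := by
    rw [lsq, G.LA_sq]
    linear_combination (-G.pA) * R2 - G.wA * R3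
  have L1 : G.lsq = G.pA ^ 2 + G.LA ^ 2 := rfl
  have L2 := G.lsq_eq
  have L3 : G.lsq - G.pB ^ 2 - G.pA ^ 2 + G.pA * G.pB * G.c = G.H ^ 2 - G.wA * G.wB * G.c := by
    rw [L1]
    linear_combination (-G.pB) * R4 - G.wA * G.pB_mul_s + G.LA_sq
  linear_combination (κ + r) * (κ' + r') * R1 - (σ - r * G.pA) * (κ' + r') * R2 +
    k / 2 * (κ' + r') * R3 - (G.SB - r' * G.pB) * (κ + r) * R4 + k / 2 * (κ + r) * R5 +
    (κ + r) * (κ' + r') * hz + hσ - hg + σ * r' * R2 + G.SB * r * R4 +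
    k / 2 * r * G.pA_mul_s + k / 2 * r' * G.pB_mul_s + κ * r' * L2 + κ' * r * L1 + r * r' * L3

end Corner

/-! ### Rigidity of the cells through inner products of their edges. -/

section Gram

variable {E F : Type*} [NormedAddCommGroup E] [InnerProductSpace ℝ E] [NormedAddCommGroup F]
  [InnerProductSpace ℝ F]

theorem norm_comb_eq {a b : E} {a' b' : F} (haa : inner ℝ a a = inner ℝ a' a')
    (hbb : inner ℝ b b = inner ℝ b' b') (hab : inner ℝ a b = inner ℝ a' b') (x y : ℝ) :
    ‖x • a + y • b‖ = ‖x • a' + y • b'‖ := by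
  rw [← sq_eq_sq₀ (norm_nonneg _) (norm_nonneg _), ← real_inner_self_eq_norm_sq,
    ← real_inner_self_eq_norm_sq]
  simp only [inner_add_left, inner_add_right, inner_smul_left, inner_smul_right,
    real_inner_comm a b, real_inner_comm a' b', haa, hbb, hab]

theorem ev_add (a b q u v : E) (w w' : Coef) :
    ev a b q u v (w + w') = ev a b q u v w + ev a b q u v w' := by
  simp only [ev, Pi.add_apply]
  module

theorem ev_smul (a b q u v : E) (r : ℝ) (w : Coef) :
    ev a b q u v (r • w) = r • ev a b q u v w := by
  simp only [ev, Pi.smul_apply, smul_eq_mul]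
  module

/-- A vertex of each cell, and two directions spanning it. -/
def apex : Fin 6 → Coef :=
  ![0, ![0, 0, 1, 0, 0], 0, ![0, 0, 1, 0, 0], 0, ![0, 0, 1, 0, 0]]
def edge₁ : Fin 6 → Coef :=
  ![![1, 0, 0, 0, 0], ![1, 0, -1, 0, 0], ![0, 1, 0, 0, 0], ![0, 1, -1, 0, 0], ![1, 0, 0, 0, 0],
    ![1, 0, -1, 0, 0]]
def edge₂ : Fin 6 → Coef :=
  ![![0, 0, 0, 1, 0], ![0, 0, 0, 1, 0], ![0, 0, 0, 0, 1], ![0, 0, 0, 0, 1], ![0, 1, 0, 0, 0],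
    ![0, 1, -1, 0, 0]]

/-- The parametrization of the plane spanned by a cell. -/
def chart (i : Fin 6) (c d : ℝ) : Coef := apex i + c • edge₁ i + d • edge₂ i

theorem exists_chart {i : Fin 6} {w : Coef} (hw : w ∈ cell i) : ∃ c d, w = chart i c d := by
  fin_cases i
  · obtain ⟨-, h1, h2, h4, -⟩ := hw
    exact ⟨w 0, w 3, by apply coef_ext <;> simp [chart, apex, edge₁, edge₂, *]⟩
  · obtain ⟨-, h1, h4, h0⟩ := hw
    exact ⟨w 0, w 3, by apply coef_ext <;> simp [chart, apex, edge₁, edge₂, *] <;> linarith⟩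
  · obtain ⟨-, h1, h2, h4, -⟩ := hw
    exact ⟨w 1, w 4, by apply coef_ext <;> simp [chart, apex, edge₁, edge₂, *]⟩
  · obtain ⟨-, h1, h4, h0⟩ := hw
    exact ⟨w 1, w 4, by apply coef_ext <;> simp [chart, apex, edge₁, edge₂, *] <;> linarith⟩
  · obtain ⟨-, h1, h2, h4, -⟩ := hw
    exact ⟨w 0, w 1, by apply coef_ext <;> simp [chart, apex, edge₁, edge₂, *]⟩
  · obtain ⟨-, h1, h4, h0⟩ := hw
    exact ⟨w 0, w 1, by apply coef_ext <;> simp [chart, apex, edge₁, edge₂, *] <;> linarith⟩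

theorem ev_chart (a b q u v : E) (i : Fin 6) (c d : ℝ) :
    ev a b q u v (chart i c d) =
      ev a b q u v (apex i) + c • ev a b q u v (edge₁ i) + d • ev a b q u v (edge₂ i) := by
  simp only [chart, ev_add, ev_smul]

/-- Two placements of the same metric type induce isometric cells. -/
structure Isometric (a b q u v : E) (a' b' q' u' v' : F) : Prop where
  aa : inner ℝ a a = inner ℝ a' a'
  bb : inner ℝ b b = inner ℝ b' b'
  uu : inner ℝ u u = inner ℝ u' u'
  vv : inner ℝ v v = inner ℝ v' v'
  ab : inner ℝ a b = inner ℝ a' b'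
  au : inner ℝ a u = inner ℝ a' u'
  bv : inner ℝ b v = inner ℝ b' v'
  qu : inner ℝ q u = inner ℝ q' u'
  qv : inner ℝ q v = inner ℝ q' v'
  qa : inner ℝ (a - q) (a - q) = inner ℝ (a' - q') (a' - q')
  qb : inner ℝ (b - q) (b - q) = inner ℝ (b' - q') (b' - q')

/-- A cell is determined up to congruence by the Gram matrix of its two edges. The norm of `q` is
not among the data: `o` and `q` share no cell, and their distance does change. -/
theorem Isometric.inner_edge {a b q u v : E} {a' b' q' u' v' : F}
    (h : Isometric a b q u v a' b' q' u' v') (i : Fin 6) :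
    inner ℝ (ev a b q u v (edge₁ i)) (ev a b q u v (edge₁ i)) =
      inner ℝ (ev a' b' q' u' v' (edge₁ i)) (ev a' b' q' u' v' (edge₁ i)) ∧
    inner ℝ (ev a b q u v (edge₂ i)) (ev a b q u v (edge₂ i)) =
      inner ℝ (ev a' b' q' u' v' (edge₂ i)) (ev a' b' q' u' v' (edge₂ i)) ∧
    inner ℝ (ev a b q u v (edge₁ i)) (ev a b q u v (edge₂ i)) =
      inner ℝ (ev a' b' q' u' v' (edge₁ i)) (ev a' b' q' u' v' (edge₂ i)) := by
  -- Polarization: the three side lengths of the triangle `a b q` are known, that of `ab` from `aa`,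
  -- `bb` and `ab`.
  have qab : inner ℝ (a - q) (b - q) = inner ℝ (a' - q') (b' - q') := by
    have h1 := h.qa
    have h2 := h.qb
    simp only [inner_sub_left, inner_sub_right] at h1 h2 ⊢
    rw [real_inner_comm a q, real_inner_comm a' q'] at h1
    rw [real_inner_comm b q, real_inner_comm b' q'] at h2
    rw [real_inner_comm b q, real_inner_comm b' q', h.ab]
    linarith [h.aa, h.bb, real_inner_comm a q, real_inner_comm a' q']
  have qau : inner ℝ (a - q) u = inner ℝ (a' - q') u' := by
    rw [inner_sub_left, inner_sub_left, h.au, h.qu]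
  have qbv : inner ℝ (b - q) v = inner ℝ (b' - q') v' := by
    rw [inner_sub_left, inner_sub_left, h.bv, h.qv]
  fin_cases i <;> simp only [edge₁, edge₂, ev, Fin.reduceFinMk, Matrix.cons_val,
    zero_smul, one_smul, neg_smul, zero_add, add_zero, ← sub_eq_add_neg, Fin.zero_eta, Fin.mk_one, Fin.isValue]
  exacts [⟨h.aa, h.uu, h.au⟩, ⟨h.qa, h.uu, qau⟩, ⟨h.bb, h.vv, h.bv⟩, ⟨h.qb, h.vv, qbv⟩,
    ⟨h.aa, h.bb, h.ab⟩, ⟨h.qa, h.qb, qab⟩]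

theorem Isometric.dist_chart {a b q u v : E} {a' b' q' u' v' : F}
    (h : Isometric a b q u v a' b' q' u' v') (i : Fin 6) (c d c' d' : ℝ) :
    dist (ev a b q u v (chart i c d)) (ev a b q u v (chart i c' d')) =
      dist (ev a' b' q' u' v' (chart i c d)) (ev a' b' q' u' v' (chart i c' d')) := by
  obtain ⟨h1, h2, h3⟩ := h.inner_edge i
  rw [dist_eq_norm, dist_eq_norm, ev_chart, ev_chart, ev_chart, ev_chart]
  refine (congrArg norm ?_).trans ((norm_comb_eq h1 h2 h3 (c - c') (d - d')).trans
    (congrArg norm ?_)) <;> module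

end Gram

/-- Two triangles with a common base and apexes `0`, `q`: if they can be moved rigidly about the
base so that the apexes get closer, then they lie on opposite sides of the base. -/
theorem opposite_sides {a₁ a₂ b₁ b₂ q₁ q₂ a₁' a₂' b₁' b₂' q₁' q₂' : ℝ}
    (ha : a₁ ^ 2 + a₂ ^ 2 = a₁' ^ 2 + a₂' ^ 2) (hb : b₁ ^ 2 + b₂ ^ 2 = b₁' ^ 2 + b₂' ^ 2)
    (hab : a₁ * b₁ + a₂ * b₂ = a₁' * b₁' + a₂' * b₂')
    (hqa : (a₁ - q₁) ^ 2 + (a₂ - q₂) ^ 2 = (a₁' - q₁') ^ 2 + (a₂' - q₂') ^ 2)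
    (hqb : (b₁ - q₁) ^ 2 + (b₂ - q₂) ^ 2 = (b₁' - q₁') ^ 2 + (b₂' - q₂') ^ 2)
    (hq : q₁' ^ 2 + q₂' ^ 2 < q₁ ^ 2 + q₂ ^ 2) (hlo : 0 < a₁ * b₂ - a₂ * b₁) :
    0 < (b₁ - q₁) * (a₂ - q₂) - (b₂ - q₂) * (a₁ - q₁) := by
  obtain ⟨X, hX⟩ : ∃ r, r = (a₁ * b₂ - a₂ * b₁) := ⟨_, rfl⟩
  obtain ⟨Y, hY⟩ : ∃ r, r = (b₁ - q₁) * (a₂ - q₂) - (b₂ - q₂) * (a₁ - q₁) := ⟨_, rfl⟩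
  obtain ⟨X', hX'⟩ : ∃ r, r = (a₁' * b₂' - a₂' * b₁') := ⟨_, rfl⟩
  obtain ⟨Y', hY'⟩ : ∃ r, r = (b₁' - q₁') * (a₂' - q₂') - (b₂' - q₂') * (a₁' - q₁') := ⟨_, rfl⟩
  obtain ⟨n, hn⟩ : ∃ r, r = (b₁ - a₁) ^ 2 + (b₂ - a₂) ^ 2 := ⟨_, rfl⟩
  rw [← hX] at hlo
  rw [← hY]
  have hn' : n = (b₁' - a₁') ^ 2 + (b₂' - a₂') ^ 2 := by
    rw [hn]
    linear_combination ha + hb - 2 * hab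
  have hnpos : 0 < n := by
    refine lt_of_le_of_ne (hn ▸ by positivity) fun h0 => ?_
    have s1 := sq_nonneg (b₁ - a₁)
    have s2 := sq_nonneg (b₂ - a₂)
    have e1 : b₁ - a₁ = 0 := pow_eq_zero_iff two_ne_zero |>.1 (by linarith)
    have e2 : b₂ - a₂ = 0 := pow_eq_zero_iff two_ne_zero |>.1 (by linarith)
    have : X = 0 := by
      rw [hX, sub_eq_zero.1 e1, sub_eq_zero.1 e2]
      ring
    linarith
  have hXX : X ^ 2 = X' ^ 2 := by
    have e1 : X ^ 2 = (a₁ ^ 2 + a₂ ^ 2) * (b₁ ^ 2 + b₂ ^ 2) - (a₁ * b₁ + a₂ * b₂) ^ 2 := by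
      rw [hX]
      ring
    rw [e1, ha, hb, hab, hX']
    ring
  have hin : (a₁ - q₁) * (b₁ - q₁) + (a₂ - q₂) * (b₂ - q₂) =
      (a₁' - q₁') * (b₁' - q₁') + (a₂' - q₂') * (b₂' - q₂') := by
    linear_combination hqa / 2 + hqb / 2 - (ha + hb - 2 * hab) / 2
  have hYY : Y ^ 2 = Y' ^ 2 := by
    have e1 : Y ^ 2 = ((a₁ - q₁) ^ 2 + (a₂ - q₂) ^ 2) * ((b₁ - q₁) ^ 2 + (b₂ - q₂) ^ 2) -
        ((a₁ - q₁) * (b₁ - q₁) + (a₂ - q₂) * (b₂ - q₂)) ^ 2 := by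
      rw [hY]
      ring
    rw [e1, hqa, hqb, hin, hY']
    ring
  -- `X` and `Y` are twice the oriented areas of the triangles over the base `ab`. The components
  -- along the base are rigid, so the squared distance of the apexes changes only through the
  -- product of the signed heights.
  have hd : X * Y - X' * Y' = n * ((q₁ ^ 2 + q₂ ^ 2) - (q₁' ^ 2 + q₂' ^ 2)) / 2 := by
    have e1 : X * Y = -(n * (-a₁ * (q₁ - a₁) - a₂ * (q₂ - a₂))) +
        ((b₁ - a₁) * -a₁ + (b₂ - a₂) * -a₂) *
          ((b₁ - a₁) * (q₁ - a₁) + (b₂ - a₂) * (q₂ - a₂)) := by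
      rw [hX, hY, hn]
      ring
    have e2 : X' * Y' = -(n * (-a₁' * (q₁' - a₁') - a₂' * (q₂' - a₂'))) +
        ((b₁' - a₁') * -a₁' + (b₂' - a₂') * -a₂') *
          ((b₁' - a₁') * (q₁' - a₁') + (b₂' - a₂') * (q₂' - a₂')) := by
      rw [hX', hY', hn']
      ring
    have e3 : (b₁ - a₁) * -a₁ + (b₂ - a₂) * -a₂ = (b₁' - a₁') * -a₁' + (b₂' - a₂') * -a₂' := by
      linear_combination ha - hab
    have e4 : (b₁ - a₁) * (q₁ - a₁) + (b₂ - a₂) * (q₂ - a₂) =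
        (b₁' - a₁') * (q₁' - a₁') + (b₂' - a₂') * (q₂' - a₂') := by
      linear_combination hqa - hin
    rw [e1, e2, e3, e4]
    linear_combination n / 2 * (-ha - hqa)
  have hpos : 0 < X * Y - X' * Y' := by
    rw [hd]
    have := mul_pos hnpos (sub_pos.2 hq)
    linarith
  -- Rigidity preserves `X ^ 2` and `Y ^ 2`, so `X * Y` can only change sign. As it is larger than
  -- `X' * Y'`, it is positive.
  have hprod : (X * Y - X' * Y') * (X * Y + X' * Y') = 0 := by
    have : X ^ 2 * Y ^ 2 = X' ^ 2 * Y' ^ 2 := by rw [hXX, hYY]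
    linear_combination this
  have := (mul_eq_zero.1 hprod).resolve_left hpos.ne'
  exact pos_of_mul_pos_right (by linarith) hlo.le

/-! ### Coordinates of the development and of the folded states; both embed the cells. -/

namespace Corner

variable (G : Corner)

def q2v : E2 := !₂[G.pA, G.LA]
def u2 : E2 := !₂[1, 0]
def v2 : E2 := !₂[G.cD, G.sD]
def a2 (σ : ℝ) : E2 := G.κA • G.q2v + σ • u2
def b2 : E2 := G.κB • G.q2v + G.SB • G.v2
def q3v (z : ℝ) : E3 := !₂[G.pA, G.wA, z]
def u3 : E3 := !₂[1, 0, 0]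
def v3 : E3 := !₂[G.c, G.s, 0]
def a3 (σ k z : ℝ) : E3 := !₂[G.xA σ, G.yA k, ratio G.LA G.wA k * z]
def b3 (k z : ℝ) : E3 :=
  !₂[G.xB * G.c + G.yB k * G.s, G.xB * G.s - G.yB k * G.c, ratio G.LB G.wB k * z]

variable {G}

theorem wA_eq : G.wA = G.pB * G.s - G.wB * G.c := by linarith [G.pB_mul_s]

/-- Every folded state is isometric to the development on each cell. -/
theorem Closes.isometric (h : G.Closes) {k z : ℝ} (hk : k ∈ Icc 0 G.H)
    (hz : z ^ 2 = G.H ^ 2 - k ^ 2) :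
    Isometric (G.a3 (G.slide k) k z) (G.b3 k z) (G.q3v z) u3 G.v3 (G.a2 (G.slide k)) G.b2 G.q2v u2
      G.v2 := by
  have hcs := G.sq_add_sq
  have hD := G.cD_sq_add_sD_sq
  have hqv := G.q_inner_v
  have hl := G.lsq_eq
  have dA := crease_dist_bottom G.LA_pos G.LA_sq hk.1 hz
  have dA' := crease_dist_top G.LA_pos G.LA_sq hk.1 hz
  have dB := crease_dist_bottom G.LB_pos G.LB_sq hk.1 hz
  have dB' := crease_dist_top G.LB_pos G.LB_sq hk.1 hz
  have hin := inner_fold hk.1 hz (h.slide_eq hk)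
  have hl' : G.lsq = G.pA ^ 2 + G.LA ^ 2 := rfl
  constructor
  all_goals
    simp only [a3, b3, q3v, u3, v3, a2, b2, q2v, u2, v2, PiLp.inner_apply, Fin.sum_univ_succ,
      PiLp.add_apply, PiLp.sub_apply, PiLp.smul_apply, smul_eq_mul, RCLike.inner_apply,
      conj_trivial,
      Matrix.cons_val, Finset.univ_unique, Fin.default_eq_zero, Finset.sum_singleton,
      Matrix.cons_val_zero, Fin.succ_zero_eq_one, Fin.succ_one_eq_two, Fin.isValue]
  · simp only [xA, yA]
    linear_combination dA
  · simp only [xB, yB]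
    linear_combination ((G.κB * G.pB + G.SB) ^ 2 +
      (ratio G.LB G.wB k * G.wB - k / 2) ^ 2) * hcs + dB + G.κB ^ 2 * (hl' - hl) -
      2 * G.κB * G.SB * hqv - G.SB ^ 2 * hD
  · ring
  · linear_combination hcs - hD
  · linear_combination hin + G.κA * G.κB * hl' - G.κA * G.SB * hqv
  · simp only [xA]
    ring
  · simp only [xB]
    linear_combination (G.κB * G.pB + G.SB) * hcs - G.κB * hqv - G.SB * hD
  · ring
  · linear_combination -G.pB_eq - hqv
  · simp only [xA, yA]
    linear_combination dA'
  · have e1 : G.xB * G.c + G.yB k * G.s - G.pA =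
        (G.xB - G.pB) * G.c + (G.yB k - G.wB) * G.s := by linear_combination -G.pA_eq
    have e2 : G.xB * G.s - G.yB k * G.c - G.wA =
        (G.xB - G.pB) * G.s - (G.yB k - G.wB) * G.c := by linear_combination -G.wA_eq
    rw [e1, e2]
    simp only [xB, yB]
    linear_combination ((G.κB * G.pB + G.SB - G.pB) ^ 2 +
      (ratio G.LB G.wB k * G.wB - k / 2 - G.wB) ^ 2) * hcs + dB' +
      (G.κB - 1) ^ 2 * (hl' - hl) - 2 * (G.κB - 1) * G.SB * hqv - G.SB ^ 2 * hD

theorem κA_mem : 0 < G.κA ∧ G.κA < 1 := ratio_mem G.LA_pos G.H_pos G.LA_sq le_rfl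

theorem κB_mem : 0 < G.κB ∧ G.κB < 1 := ratio_mem G.LB_pos G.H_pos G.LB_sq le_rfl

theorem Closes.sD_nonneg (h : G.Closes) : 0 ≤ G.sD := div_nonneg h.convex G.lsq_pos.le

theorem Closes.lower_pos (h : G.Closes) {σ : ℝ} (hσ : 0 ≤ σ) :
    0 < G.κA * G.SB * G.LB + σ * G.κB * G.LA + σ * G.SB * G.sD := by
  have := mul_pos (mul_pos (G.κA_mem).1 G.SB_pos) G.LB_pos
  have := mul_nonneg (mul_nonneg hσ (G.κB_mem).1.le) G.LA_pos.le
  have := mul_nonneg (mul_nonneg hσ G.SB_pos.le) h.sD_nonneg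
  linarith

/-- The flat state moves the triangles `o a b` and `q a b` rigidly in the plane and shortens `oq`,
since its horizontal projection has squared length `pA ^ 2 + wA ^ 2`, less than `pA ^ 2 + LA ^ 2`.
Hence `opposite_sides` applies. -/
theorem Closes.upper_pos_end (h : G.Closes) :
    0 < (1 - G.κB) * G.SA * G.LA + (1 - G.κA) * G.SB * G.LB - G.SA * G.SB * G.sD := by
  have hz : (0 : ℝ) ^ 2 = G.H ^ 2 - G.H ^ 2 := by ring
  have I := h.isometric G.H_mem hz
  rw [h.slide_H] at I
  have h1 := I.aa
  have h2 := I.bb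
  have h3 := I.ab
  have h4 := I.qa
  have h5 := I.qb
  simp only [a3, b3, q3v, a2, b2, q2v, u2, v2, PiLp.inner_apply, Fin.sum_univ_succ,
      PiLp.add_apply, PiLp.sub_apply, PiLp.smul_apply, smul_eq_mul, RCLike.inner_apply,
      conj_trivial,
      Matrix.cons_val, Finset.univ_unique, Fin.default_eq_zero, Finset.sum_singleton,
      Matrix.cons_val_zero, Fin.succ_zero_eq_one, Fin.succ_one_eq_two, Fin.isValue]
    at h1 h2 h3 h4 h5
  have hd := G.q_det_v
  have key := opposite_sides (a₁ := G.κA * G.pA + G.SA) (a₂ := G.κA * G.LA)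
    (b₁ := G.κB * G.pA + G.SB * G.cD) (b₂ := G.κB * G.LA + G.SB * G.sD) (q₁ := G.pA) (q₂ := G.LA)
    (a₁' := G.xA G.SA) (a₂' := G.yA G.H) (b₁' := G.xB * G.c + G.yB G.H * G.s)
    (b₂' := G.xB * G.s - G.yB G.H * G.c) (q₁' := G.pA) (q₂' := G.wA) (by linarith) (by linarith)
    (by linarith) (by linarith) (by linarith)
    (by linarith [G.LA_sq, pow_pos G.H_pos 2]) (by
      have := h.lower_pos G.SA_pos.le
      linear_combination this - G.κA * G.SB * hd)
  linear_combination key + (1 - G.κA) * G.SB * hd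

/-- The expression is affine in σ and positive at both ends of the interval. -/
theorem Closes.upper_pos (h : G.Closes) {σ : ℝ} (hσ : σ ∈ Icc 0 G.SA) :
    0 < (1 - G.κB) * σ * G.LA + (1 - G.κA) * G.SB * G.LB - σ * G.SB * G.sD := by
  have h1 := h.upper_pos_end
  have h2 : 0 < (1 - G.κA) * G.SB * G.LB :=
    mul_pos (mul_pos (by linarith [(G.κA_mem).2]) G.SB_pos) G.LB_pos
  have h3 := mul_le_mul_of_nonneg_right hσ.2 h2.le
  have hS := G.SA_pos
  refine pos_of_mul_pos_right (a := G.SA) ?_ hS.le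
  rcases hσ.1.eq_or_lt with h0 | h0
  · rw [← h0]
    have := mul_pos hS h2
    linarith
  · have := mul_pos h0 h1
    linarith

/-- The development embeds the cells. -/
theorem Closes.placed (h : G.Closes) {σ : ℝ} (hσ : σ ∈ Icc 0 G.SA) :
    IsPlaced G.κA G.κB σ G.SB G.LA G.LB G.sD (G.a2 σ) G.b2 G.q2v u2 G.v2 := by
  refine ⟨⟨(G.κA_mem).1, (G.κA_mem).2, (G.κB_mem).1, (G.κB_mem).2, hσ.1, G.SB_pos.le, G.LA_pos,
    G.LB_pos, h.sD_nonneg, h.lower_pos hσ.1, h.upper_pos hσ⟩, rfl, rfl, ?_⟩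
  have hd := G.q_det_v
  ext i
  fin_cases i
  · simp [q2v, u2, v2]
    linarith
  · simp [q2v, u2, v2]
    ring

theorem ev_dev_zero (σ : ℝ) (w : Coef) : ev (G.a2 σ) G.b2 G.q2v u2 G.v2 w 0 =
    w 0 * (G.κA * G.pA + σ) + w 1 * (G.κB * G.pA + G.SB * G.cD) + w 2 * G.pA + w 3 +
      w 4 * G.cD := by
  simp [ev, a2, b2, q2v, u2, v2]
  ring

theorem ev_dev_one (σ : ℝ) (w : Coef) : ev (G.a2 σ) G.b2 G.q2v u2 G.v2 w 1 =
    w 0 * (G.κA * G.LA) + w 1 * (G.κB * G.LA + G.SB * G.sD) + w 2 * G.LA + w 4 * G.sD := by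
  simp [ev, a2, b2, q2v, u2, v2]
  ring

theorem Closes.dev_inj (h : G.Closes) {σ : ℝ} (hσ : σ ∈ Icc 0 G.SA) :
    InjOn (ev (G.a2 σ) G.b2 G.q2v u2 G.v2) cells := by
  intro w hw w' hw' e
  have hd := G.q_det_v
  have e0 := congrArg (fun x : E2 => x 0) e
  have e1 := congrArg (fun x : E2 => x 1) e
  simp only [ev_dev_zero, ev_dev_one] at e0 e1
  refine (h.placed hσ).fan.inj hw hw' ?_ ?_ ?_
  · simp only [acrossCoord]
    linear_combination G.pA * e1 - G.LA * e0 - (w 1 * G.SB - w' 1 * G.SB + w 4 - w' 4) * hd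
  · simp only [leftCoord]
    linear_combination e1
  · simp only [rightCoord]
    linear_combination G.sD * e0 - G.cD * e1 -
      ((w 0 - w' 0) * G.κA + (w 1 - w' 1) * G.κB + w 2 - w' 2) * hd

/-- Relative height of a point of a folded state. -/
def relHeight (k : ℝ) (w : Coef) : ℝ :=
  w 0 * ratio G.LA G.wA k + w 1 * ratio G.LB G.wB k + w 2

variable (G) in
/-- Horizontal position of a point of the folded state. -/
def horiz (σ k : ℝ) (w : Coef) : Fin 2 → ℝ :=
  ![w 0 * G.xA σ + w 1 * (G.xB * G.c + G.yB k * G.s) + w 2 * G.pA + w 3 + w 4 * G.c,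
    w 0 * G.yA k + w 1 * (G.xB * G.s - G.yB k * G.c) + w 2 * G.wA + w 4 * G.s]

/-- Relative height and horizontal position determine a point of the folded state. This holds also
in the flat state. -/
theorem Closes.fold_inj (h : G.Closes) {k : ℝ} (hk : k ∈ Icc 0 G.H) {w w' : Coef} (hw : w ∈ cells)
    (hw' : w' ∈ cells) (e : G.horiz (G.slide k) k w = G.horiz (G.slide k) k w')
    (eh : G.relHeight k w = G.relHeight k w') : w = w' := by
  have hA := ratio_mem G.LA_pos G.H_pos G.LA_sq hk.1
  have hB := ratio_mem G.LB_pos G.H_pos G.LB_sq hk.1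
  have hs := G.s_pos
  have hk0 := hk.1
  -- Project along the bisecting direction u + v, with det(u + v, ·) as transverse coordinate.
  -- Relative to the point of the same relative height on the segment `oq`, the images of `a` and
  -- `b` lie at distances `σA` and `σB` in units of those of `u` and `v`.
  set σA := (k / 2 + ((G.slide k - G.pA * shift G.LA G.wA k) * G.s + k / 2 * G.c)) / G.s with hσA
  set σB := (k / 2 + ((G.SB - G.pB * shift G.LB G.wB k) * G.s + k / 2 * G.c)) / G.s with hσB
  have hA0 : 0 ≤ σA := div_nonneg (by linarith [h.inner_side_A hk]) hs.le
  have hB0 : 0 < σB := by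
    refine div_pos ?_ hs
    rcases hk0.eq_or_lt with h0 | h0
    · rw [← h0]
      simpa [shift] using mul_pos G.SB_pos hs
    · linarith [h.inner_side_B hk]
  have hA1 : σA * G.s = k / 2 + ((G.slide k - G.pA * shift G.LA G.wA k) * G.s + k / 2 * G.c) :=
    div_mul_cancel₀ _ hs.ne'
  have hB1 : σB * G.s = k / 2 + ((G.SB - G.pB * shift G.LB G.wB k) * G.s + k / 2 * G.c) :=
    div_mul_cancel₀ _ hs.ne'
  -- The images of `u` and `v` are opposite, hence W = 0, and `lower` and `upper` become sums of
  -- nonnegative terms. The inner side lemmas put `a` and `b` on the correct sides.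
  have fan : IsFan (ratio G.LA G.wA k) (ratio G.LB G.wB k) σA σB G.s G.s 0 := by
    refine ⟨hA.1, hA.2, hB.1, hB.2, hA0, hB0.le, hs, hs, le_rfl, ?_, ?_⟩
    · have := mul_pos (mul_pos hA.1 hB0) hs
      have := mul_nonneg (mul_nonneg hA0 hB.1.le) hs.le
      linarith
    · have := mul_pos (mul_pos (by linarith : 0 < 1 - ratio G.LA G.wA k) hB0) hs
      have := mul_nonneg (mul_nonneg (by linarith : 0 ≤ 1 - ratio G.LB G.wB k) hA0) hs.le
      linarith
  have e0 := congrFun e 0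
  have e1 := congrFun e 1
  simp only [horiz, Matrix.cons_val, relHeight, xA, xB, yA, yB, κA, κB] at e0 e1 eh
  refine fan.inj hw hw' ?_ ?_ ?_
  -- The combination `(1 + c) * e1 - s * e0` is the comparison of det(u + v, ·); the multiple of
  -- `eh` removes the contribution of `q`.
  · simp only [acrossCoord]
    simp only [ratio_eq G.LA_pos hk.1, ratio_eq G.LB_pos hk.1] at e0 e1 eh
    linear_combination (-(w 0 - w' 0)) * hA1 + (w 1 - w' 1) * hB1 +
      (1 + G.c) * e1 - G.s * e0 - (G.wA * (1 + G.c) - G.pA * G.s) * eh -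
      k / 2 * (w 1 - w' 1) * G.sq_add_sq + (w 1 - w' 1) *
        (ratio G.LB G.wB 0 + shift G.LB G.wB k) * (G.wB * G.sq_add_sq - G.pA_mul_s - G.pB_mul_s)
  · simp only [leftCoord]
    linear_combination G.s * eh
  · simp only [rightCoord]
    linear_combination G.s * eh

end Corner

theorem cells_bounds {w : Coef} (hw : w ∈ cells) :
    (∀ i, 0 ≤ w i) ∧ w 0 + w 1 + w 2 ≤ 1 ∧ (w 3 = 0 ∨ w 4 = 0) := by
  rcases mem_cells.1 hw with (⟨n, c⟩ | ⟨n, c⟩) | (⟨n, c⟩ | ⟨n, c⟩) | (⟨n, c⟩ | ⟨n, c⟩)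
  · exact ⟨n, by linarith, .inr c.2.2.1⟩
  · exact ⟨n, by linarith, .inr c.2.1⟩
  · exact ⟨n, by linarith, .inl c.2.2.1⟩
  · exact ⟨n, by linarith, .inl c.2.1⟩
  · exact ⟨n, by linarith, .inl c.2.1⟩
  · exact ⟨n, by linarith, .inl c.1⟩

namespace Corner

variable (G : Corner)

theorem norm_u2 : ‖u2‖ = 1 := by
  simp [u2, EuclideanSpace.norm_eq]

theorem norm_v2 : ‖G.v2‖ = 1 := by
  simp [v2, EuclideanSpace.norm_eq, G.cD_sq_add_sD_sq]

/-- A time parametrization of the folded states for which the moving vertex has constant speed. -/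
structure IsSchedule (κ : ℝ → ℝ) : Prop where
  cont : ContinuousOn κ (Icc 0 1)
  mono : StrictMonoOn κ (Icc 0 1)
  mem : ∀ t ∈ Icc (0 : ℝ) 1, κ t ∈ Icc 0 G.H
  slide_eq : ∀ t ∈ Icc (0 : ℝ) 1, G.slide (κ t) = t * G.SA

/-- Height of the top plane. -/
def alt (k : ℝ) : ℝ := √(G.H ^ 2 - k ^ 2)

/-- The point of the development with coefficients `w`. -/
def dev (t : ℝ) : Coef → E2 := ev (G.a2 (t * G.SA)) G.b2 G.q2v u2 G.v2

/-- The point of the folded state with coefficients `w`. -/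
def fold (k : ℝ) : Coef → E3 :=
  ev (G.a3 (G.slide k) k (G.alt k)) (G.b3 k (G.alt k)) (G.q3v (G.alt k)) u3 G.v3

/-- The developed corner. -/
def sheet : Set E2 :=
  {x | ∃ r ∈ Icc (0 : ℝ) 1, ∃ s : ℝ, 0 ≤ s ∧ (x = r • G.q2v + s • u2 ∨ x = r • G.q2v + s • G.v2)}

/-- The coefficients of a point of the development. -/
def coef (t : ℝ) : E2 → Coef := Function.invFunOn (G.dev t) cells

def motion (κ : ℝ → ℝ) (t : ℝ) (x : E2) : E3 := G.fold (κ t) (G.coef t x)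

variable {G}

/-- Time is the position of the moving vertex divided by `SA`, so the schedule is the inverse of
`slide` after rescaling. -/
theorem Closes.exists_schedule (h : G.Closes) : ∃ κ, G.IsSchedule κ := by
  obtain ⟨g, hc, hm, hg⟩ := exists_continuousOn_inverse G.H_pos.le h.slide_strictMonoOn
    h.slide_continuousOn
  rw [slide_zero, h.slide_H] at hc hm hg
  have hS := G.SA_pos
  have hmap : ∀ t ∈ Icc (0 : ℝ) 1, t * G.SA ∈ Icc 0 G.SA := fun t ht =>
    ⟨mul_nonneg ht.1 hS.le, by nlinarith [ht.2]⟩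
  exact ⟨fun t => g (t * G.SA), hc.comp (by fun_prop) hmap,
    fun t ht t' ht' hlt => hm (hmap t ht) (hmap t' ht') (mul_lt_mul_of_pos_right hlt hS),
    fun t ht => (hg _ (hmap t ht)).1, fun t ht => (hg _ (hmap t ht)).2⟩

theorem sA_mem {t : ℝ} (ht : t ∈ Icc (0 : ℝ) 1) : t * G.SA ∈ Icc 0 G.SA :=
  ⟨mul_nonneg ht.1 G.SA_pos.le, by nlinarith [ht.2, G.SA_pos]⟩

section Schedule

variable {κ : ℝ → ℝ}

theorem IsSchedule.zero (hκ : G.IsSchedule κ) (h : G.Closes) : κ 0 = 0 := by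
  have h0 : (0 : ℝ) ∈ Icc (0 : ℝ) 1 := by simp
  refine h.slide_strictMonoOn.injOn (hκ.mem 0 h0) (left_mem_Icc.2 G.H_pos.le) ?_
  rw [hκ.slide_eq 0 h0, slide_zero, zero_mul]

theorem IsSchedule.one (hκ : G.IsSchedule κ) (h : G.Closes) : κ 1 = G.H := by
  have h0 : (1 : ℝ) ∈ Icc (0 : ℝ) 1 := by simp
  refine h.slide_strictMonoOn.injOn (hκ.mem 1 h0) G.H_mem ?_
  rw [hκ.slide_eq 1 h0, h.slide_H, one_mul]

theorem alt_sq {k : ℝ} (hk : k ∈ Icc 0 G.H) : G.alt k ^ 2 = G.H ^ 2 - k ^ 2 := by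
  refine Real.sq_sqrt ?_
  have := pow_le_pow_left₀ hk.1 hk.2 2
  linarith

theorem alt_nonneg (k : ℝ) : 0 ≤ G.alt k := Real.sqrt_nonneg _

theorem alt_zero : G.alt 0 = G.H := by
  rw [alt, zero_pow two_ne_zero, sub_zero, Real.sqrt_sq G.H_pos.le]

theorem alt_H : G.alt G.H = 0 := by simp [alt]

theorem alt_pos {k : ℝ} (hk : 0 ≤ k) (hk' : k < G.H) : 0 < G.alt k := by
  refine Real.sqrt_pos.2 ?_
  have := pow_lt_pow_left₀ hk' hk two_ne_zero
  linarith

variable (G) in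
theorem alt_continuous : Continuous G.alt := by
  unfold alt
  fun_prop

theorem alt_strictAntiOn : StrictAntiOn G.alt (Icc 0 G.H) := by
  intro k hk k' hk' hlt
  refine Real.sqrt_lt_sqrt ?_ ?_
  · have := pow_le_pow_left₀ hk'.1 hk'.2 2
    linarith
  · have := pow_lt_pow_left₀ hlt hk.1 two_ne_zero
    linarith

theorem IsSchedule.lt (hκ : G.IsSchedule κ) (h : G.Closes) {t : ℝ} (ht : t ∈ Ico (0 : ℝ) 1) :
    κ t < G.H := by
  rw [← hκ.one h]
  exact hκ.mono (Ico_subset_Icc_self ht) (by simp) ht.2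

theorem IsSchedule.pos (hκ : G.IsSchedule κ) (h : G.Closes) {t : ℝ} (ht : t ∈ Ioc (0 : ℝ) 1) :
    0 < κ t := by
  rw [← hκ.zero h]
  exact hκ.mono (by simp) (Ioc_subset_Icc_self ht) ht.1

/-! ### Coefficients of points of the development -/

theorem Closes.image_dev (h : G.Closes) {t : ℝ} (ht : t ∈ Icc (0 : ℝ) 1) :
    G.dev t '' cells = G.sheet :=
  (h.placed (sA_mem ht)).image_cells

theorem Closes.coef_mem (h : G.Closes) {t : ℝ} (ht : t ∈ Icc (0 : ℝ) 1) {x : E2}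
    (hx : x ∈ G.sheet) : G.coef t x ∈ cells ∧ G.dev t (G.coef t x) = x := by
  rw [← h.image_dev ht] at hx
  exact ⟨Function.invFunOn_mem hx, Function.invFunOn_eq hx⟩

theorem Closes.coef_dev (h : G.Closes) {t : ℝ} (ht : t ∈ Icc (0 : ℝ) 1) {w : Coef}
    (hw : w ∈ cells) : G.coef t (G.dev t w) = w := by
  have hx : G.dev t w ∈ G.sheet := h.image_dev ht ▸ mem_image_of_mem _ hw
  obtain ⟨h1, h2⟩ := h.coef_mem ht hx
  exact h.dev_inj (sA_mem ht) h1 hw h2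

theorem Closes.motion_dev (h : G.Closes) {t : ℝ} (ht : t ∈ Icc (0 : ℝ) 1) {w : Coef}
    (hw : w ∈ cells) : G.motion κ t (G.dev t w) = G.fold (κ t) w := by
  rw [motion, h.coef_dev ht hw]

variable (G) in
theorem dev_continuous : Continuous fun p : ℝ × Coef => G.dev p.1 p.2 := by
  unfold dev ev a2
  fun_prop

variable (G) in
/-- A bound for the coefficients of a point. -/
def bound (x : E2) : ℝ := 1 + ‖x‖ + ‖G.q2v‖ + G.SA + ‖G.b2‖ + ‖G.q2v‖

/-- The coefficients of `a`, `b`, `q` are at most 1. Of the other two one vanishes, so their sum is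
the norm of the unbounded part of the point, which the triangle inequality bounds. -/
theorem coef_le {t : ℝ} (ht : t ∈ Icc (0 : ℝ) 1) {w : Coef} (hw : w ∈ cells) (i : Fin 5) :
    w i ≤ G.bound (G.dev t w) := by
  obtain ⟨n, hs, h34⟩ := cells_bounds hw
  have hq := norm_nonneg G.q2v
  have hb := norm_nonneg G.b2
  have hx := norm_nonneg (G.dev t w)
  have hS := G.SA_pos
  have ha : ‖G.a2 (t * G.SA)‖ ≤ ‖G.q2v‖ + G.SA := by
    have e1 : ‖G.κA • G.q2v‖ ≤ ‖G.q2v‖ := by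
      rw [norm_smul, Real.norm_of_nonneg (G.κA_mem).1.le]
      nlinarith [(G.κA_mem).2]
    have e2 : ‖(t * G.SA) • u2‖ ≤ G.SA := by
      rw [norm_smul, Real.norm_of_nonneg (sA_mem ht).1, norm_u2, mul_one]
      exact (sA_mem ht).2
    exact (norm_add_le _ _).trans (add_le_add e1 e2)
  have small : ∀ j : Fin 5, w j ≤ 1 → w j ≤ G.bound (G.dev t w) := fun j hj => by
    unfold bound
    linarith
  have sm : ∀ (j : Fin 5) (y : E2), w j ≤ 1 → ‖w j • y‖ ≤ ‖y‖ := fun j y hj => by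
    rw [norm_smul, Real.norm_of_nonneg (n j)]
    nlinarith [norm_nonneg y]
  have w0 : w 0 ≤ 1 := by linarith [n 1, n 2]
  have w1 : w 1 ≤ 1 := by linarith [n 0, n 2]
  have w2 : w 2 ≤ 1 := by linarith [n 0, n 1]
  have big : w 3 + w 4 ≤ G.bound (G.dev t w) := by
    have e : ‖w 3 • u2 + w 4 • G.v2‖ = w 3 + w 4 := by
      rcases h34 with h0 | h0
      · rw [h0, zero_smul, zero_add, zero_add, norm_smul, G.norm_v2, mul_one,
          Real.norm_of_nonneg (n 4)]
      · rw [h0, zero_smul, add_zero, add_zero, norm_smul, norm_u2, mul_one,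
          Real.norm_of_nonneg (n 3)]
    have e' : w 3 • u2 + w 4 • G.v2 = G.dev t w - w 0 • G.a2 (t * G.SA) - w 1 • G.b2 -
        w 2 • G.q2v := by
      simp only [dev, ev]
      module
    rw [← e, e']
    have := norm_sub_le (G.dev t w - w 0 • G.a2 (t * G.SA) - w 1 • G.b2) (w 2 • G.q2v)
    have := norm_sub_le (G.dev t w - w 0 • G.a2 (t * G.SA)) (w 1 • G.b2)
    have := norm_sub_le (G.dev t w) (w 0 • G.a2 (t * G.SA))
    have := sm 0 (G.a2 (t * G.SA)) w0
    have := sm 1 G.b2 w1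
    have := sm 2 G.q2v w2
    unfold bound
    linarith
  fin_cases i
  · exact small 0 w0
  · exact small 1 w1
  · exact small 2 w2
  · exact (le_add_of_nonneg_right (n 4)).trans big
  · exact (le_add_of_nonneg_left (n 3)).trans big

theorem Closes.coef_continuousOn (h : G.Closes) :
    ContinuousOn (fun p : ℝ × E2 => G.coef p.1 p.2) (Icc (0 : ℝ) 1 ×ˢ G.sheet) := by
  refine continuousOn_of_inverse isClosed_cells G.dev_continuous
    (fun p hp => h.coef_mem hp.1 hp.2) (fun p hp y hy e => ?_) fun p hp => ?_
  · rw [← e]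
    exact (h.coef_dev hp.1 hy).symm
  · refine ⟨Icc 0 fun _ => G.bound p.2 + 1, isCompact_Icc, ?_⟩
    have hc : Continuous fun p : ℝ × E2 => G.bound p.2 := by
      unfold bound
      fun_prop
    have := (hc.continuousWithinAt (s := Icc (0 : ℝ) 1 ×ˢ G.sheet) (x := p)).eventually_lt_const
      (lt_add_one (G.bound p.2))
    filter_upwards [this, self_mem_nhdsWithin] with p' h1 h2
    obtain ⟨h3, h4⟩ := h.coef_mem h2.1 h2.2
    refine ⟨(cells_bounds h3).1, fun i => ?_⟩
    have := coef_le (G := G) h2.1 h3 i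
    rw [h4] at this
    exact this.trans h1.le

/-! ### Folded states -/

theorem ratio_continuousOn {L w H : ℝ} (hL : 0 < L) : ContinuousOn (ratio L w) (Icc 0 H) := by
  unfold ratio
  refine ContinuousOn.div (by fun_prop) (by fun_prop) fun k hk => ?_
  have := hk.1
  positivity

theorem continuousOn_toE3 {X : Type*} [TopologicalSpace X] {S : Set X} {f g k : X → ℝ}
    (hf : ContinuousOn f S) (hg : ContinuousOn g S) (hk : ContinuousOn k S) :
    ContinuousOn (fun x => (!₂[f x, g x, k x] : E3)) S := by
  refine (PiLp.continuous_toLp 2 fun _ : Fin 3 => ℝ).comp_continuousOn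
    (continuousOn_pi.2 fun i => ?_)
  fin_cases i <;> assumption

theorem Closes.fold_continuousOn (h : G.Closes) :
    ContinuousOn (fun p : ℝ × Coef => G.fold p.1 p.2) (Icc 0 G.H ×ˢ univ) := by
  have hfst : MapsTo Prod.fst (Icc 0 G.H ×ˢ (univ : Set Coef)) (Icc 0 G.H) := fun p hp => hp.1
  have rA := (ratio_continuousOn (w := G.wA) (H := G.H) G.LA_pos).comp continuousOn_fst hfst
  have rB := (ratio_continuousOn (w := G.wB) (H := G.H) G.LB_pos).comp continuousOn_fst hfst
  have sl := h.slide_continuousOn.comp continuousOn_fst hfst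
  have al : ContinuousOn (fun p : ℝ × Coef => G.alt p.1) (Icc 0 G.H ×ˢ univ) :=
    (G.alt_continuous.comp continuous_fst).continuousOn
  simp only [Function.comp_def] at rA rB sl
  have yA : ContinuousOn (fun p : ℝ × Coef => G.yA p.1) (Icc 0 G.H ×ˢ univ) := by
    simp only [Corner.yA]
    fun_prop
  have yB : ContinuousOn (fun p : ℝ × Coef => G.yB p.1) (Icc 0 G.H ×ˢ univ) := by
    simp only [Corner.yB]
    fun_prop
  have cA := continuousOn_toE3 ((continuousOn_const (c := G.κA * G.pA)).add sl) yA (rA.mul al)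
  have cB := continuousOn_toE3
    ((continuousOn_const (c := G.xB * G.c)).add (yB.mul (continuousOn_const (c := G.s))))
    ((continuousOn_const (c := G.xB * G.s)).sub (yB.mul (continuousOn_const (c := G.c))))
    (rB.mul al)
  have cq := continuousOn_toE3 (continuousOn_const (c := G.pA)) (continuousOn_const (c := G.wA)) al
  have cw : ∀ i, ContinuousOn (fun p : ℝ × Coef => p.2 i) (Icc 0 G.H ×ˢ univ) := fun i =>
    ((continuous_apply i).comp continuous_snd).continuousOn
  exact ((((cw 0).smul cA).add ((cw 1).smul cB)).add ((cw 2).smul cq)).add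
    ((cw 3).smul continuousOn_const) |>.add ((cw 4).smul continuousOn_const)

theorem Closes.motion_continuousOn (h : G.Closes) (hκ : G.IsSchedule κ) :
    ContinuousOn (Function.uncurry (G.motion κ)) (Icc (0 : ℝ) 1 ×ˢ G.sheet) := by
  have hc : ContinuousOn (fun p : ℝ × E2 => (κ p.1, G.coef p.1 p.2)) (Icc (0 : ℝ) 1 ×ˢ G.sheet) :=
    (hκ.cont.comp continuousOn_fst fun _ hp => hp.1).prodMk h.coef_continuousOn
  have hm : MapsTo (fun p : ℝ × E2 => (κ p.1, G.coef p.1 p.2)) (Icc (0 : ℝ) 1 ×ˢ G.sheet)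
      (Icc 0 G.H ×ˢ univ) := fun p hp => mk_mem_prod (hκ.mem _ hp.1) (mem_univ _)
  have hu : Function.uncurry (G.motion κ) = fun p : ℝ × E2 => G.fold (κ p.1) (G.coef p.1 p.2) := rfl
  have hf := h.fold_continuousOn
  rw [hu]
  generalize G.fold = φ at hf ⊢
  exact hf.comp hc hm

theorem fold_zero (k : ℝ) (w : Coef) : G.fold k w 0 = G.horiz (G.slide k) k w 0 := by
  simp [fold, ev, a3, b3, q3v, u3, v3, horiz]

theorem fold_one (k : ℝ) (w : Coef) : G.fold k w 1 = G.horiz (G.slide k) k w 1 := by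
  simp [fold, ev, a3, b3, q3v, u3, v3, horiz]

theorem fold_two (k : ℝ) (w : Coef) : G.fold k w 2 = G.alt k * G.relHeight k w := by
  simp [fold, ev, a3, b3, q3v, u3, v3, relHeight]
  ring

theorem horiz_eq {k : ℝ} {w w' : Coef} (h0 : G.fold k w 0 = G.fold k w' 0)
    (h1 : G.fold k w 1 = G.fold k w' 1) : G.horiz (G.slide k) k w = G.horiz (G.slide k) k w' := by
  rw [fold_zero, fold_zero] at h0
  rw [fold_one, fold_one] at h1
  funext i
  fin_cases i <;> assumption

theorem Closes.isometric_fold (h : G.Closes) (hκ : G.IsSchedule κ) {t : ℝ}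
    (ht : t ∈ Icc (0 : ℝ) 1) (i : Fin 6) (c d c' d' : ℝ) :
    dist (G.fold (κ t) (chart i c d)) (G.fold (κ t) (chart i c' d')) =
      dist (G.dev t (chart i c d)) (G.dev t (chart i c' d')) := by
  have := (h.isometric (hκ.mem t ht) (alt_sq (hκ.mem t ht))).dist_chart i c d c' d'
  simpa only [fold, dev, hκ.slide_eq t ht] using this

theorem Closes.dist_fold (h : G.Closes) (hκ : G.IsSchedule κ) {t : ℝ}
    (ht : t ∈ Icc (0 : ℝ) 1) {i : Fin 6} {w w' : Coef} (hw : w ∈ cell i) (hw' : w' ∈ cell i) :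
    dist (G.fold (κ t) w) (G.fold (κ t) w') = dist (G.dev t w) (G.dev t w') := by
  obtain ⟨c, d, rfl⟩ := exists_chart hw
  obtain ⟨c', d', rfl⟩ := exists_chart hw'
  exact h.isometric_fold hκ ht i c d c' d'

theorem Closes.dist_motion (h : G.Closes) (hκ : G.IsSchedule κ) {t : ℝ}
    (ht : t ∈ Icc (0 : ℝ) 1) {i : Fin 6} {x y : E2} (hx : x ∈ G.dev t '' cell i)
    (hy : y ∈ G.dev t '' cell i) : dist (G.motion κ t x) (G.motion κ t y) = dist x y := by
  obtain ⟨w, hw, rfl⟩ := hx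
  obtain ⟨w', hw', rfl⟩ := hy
  rw [h.motion_dev ht (cell_subset_cells i hw), h.motion_dev ht (cell_subset_cells i hw'),
    h.dist_fold hκ ht hw hw']

theorem Closes.preservesLengths (h : G.Closes) (hκ : G.IsSchedule κ) {t : ℝ}
    (ht : t ∈ Icc (0 : ℝ) 1) : PreservesLengths G.sheet (G.motion κ t) := by
  intro γ hγ hP
  have hc : ContinuousOn (fun x => G.coef t x) G.sheet :=
    h.coef_continuousOn.comp (f := fun x => (t, x)) (by fun_prop) fun x hx => ⟨ht, hx⟩
  refine eVariationOn_eq_of_cover isClosed_cell (hc.comp hγ hP)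
    (fun s hs => mem_iUnion.1 (h.coef_mem ht (hP hs)).1) fun i s hs r hr h1 h2 => ?_
  rw [edist_dist, edist_dist, Function.comp_apply, Function.comp_apply,
    h.dist_motion hκ ht ⟨_, h1, (h.coef_mem ht (hP hs)).2⟩ ⟨_, h2, (h.coef_mem ht (hP hr)).2⟩]

theorem relHeight_mem {k : ℝ} (hk : 0 ≤ k) {w : Coef} (hw : w ∈ cells) :
    G.relHeight k w ∈ Icc (0 : ℝ) 1 := by
  obtain ⟨n, hs, -⟩ := cells_bounds hw
  have hA := ratio_mem G.LA_pos G.H_pos G.LA_sq hk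
  have hB := ratio_mem G.LB_pos G.H_pos G.LB_sq hk
  have := mul_nonneg (n 0) hA.1.le
  have := mul_nonneg (n 1) hB.1.le
  have := mul_nonneg (n 0) (sub_nonneg.2 hA.2.le)
  have := mul_nonneg (n 1) (sub_nonneg.2 hB.2.le)
  have := n 2
  constructor <;> unfold relHeight <;> linarith

theorem relHeight_eq_zero {k : ℝ} (hk : 0 ≤ k) {w : Coef} (hw : w ∈ cells)
    (h : G.relHeight k w = 0) : w 0 = 0 ∧ w 1 = 0 ∧ w 2 = 0 := by
  obtain ⟨n, hs, -⟩ := cells_bounds hw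
  have hA := ratio_mem G.LA_pos G.H_pos G.LA_sq hk
  have hB := ratio_mem G.LB_pos G.H_pos G.LB_sq hk
  have h0 := mul_nonneg (n 0) hA.1.le
  have h1 := mul_nonneg (n 1) hB.1.le
  have h2 := n 2
  unfold relHeight at h
  exact ⟨(mul_eq_zero.1 (by linarith : w 0 * ratio G.LA G.wA k = 0)).resolve_right hA.1.ne',
    (mul_eq_zero.1 (by linarith : w 1 * ratio G.LB G.wB k = 0)).resolve_right hB.1.ne',
    by linarith⟩

theorem relHeight_eq_one {k : ℝ} (hk : 0 ≤ k) {w : Coef} (hw : w ∈ cells)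
    (h : G.relHeight k w = 1) : w 0 = 0 ∧ w 1 = 0 ∧ w 2 = 1 := by
  obtain ⟨n, hs, -⟩ := cells_bounds hw
  have hA := ratio_mem G.LA_pos G.H_pos G.LA_sq hk
  have hB := ratio_mem G.LB_pos G.H_pos G.LB_sq hk
  have h0 := mul_nonneg (n 0) (sub_nonneg.2 hA.2.le)
  have h1 := mul_nonneg (n 1) (sub_nonneg.2 hB.2.le)
  unfold relHeight at h
  have e0 := (mul_eq_zero.1 (by linarith : w 0 * (1 - ratio G.LA G.wA k) = 0)).resolve_right
    (by linarith)
  have e1 := (mul_eq_zero.1 (by linarith : w 1 * (1 - ratio G.LB G.wB k) = 0)).resolve_right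
    (by linarith)
  rw [e0, e1] at h
  exact ⟨e0, e1, by linarith⟩

theorem Closes.motion_two_mem (h : G.Closes) (hκ : G.IsSchedule κ) {t : ℝ}
    (ht : t ∈ Icc (0 : ℝ) 1) {x : E2} (hx : x ∈ G.sheet) :
    G.motion κ t x 2 ∈ Icc 0 (G.alt (κ t)) := by
  have := relHeight_mem (G := G) (hκ.mem t ht).1 (h.coef_mem ht hx).1
  rw [motion, fold_two]
  exact ⟨mul_nonneg (alt_nonneg _) this.1, mul_le_of_le_one_right (alt_nonneg _) this.2⟩

/-- Before the end the factor `alt` is positive, so a point of space determines the relative height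
and `fold_inj` applies. -/
theorem Closes.motion_injOn (h : G.Closes) (hκ : G.IsSchedule κ) {t : ℝ}
    (ht : t ∈ Ico (0 : ℝ) 1) : InjOn (G.motion κ t) G.sheet := by
  have ht' := Ico_subset_Icc_self ht
  intro x hx y hy e
  obtain ⟨hx1, hx2⟩ := h.coef_mem ht' hx
  obtain ⟨hy1, hy2⟩ := h.coef_mem ht' hy
  rw [← hx2, ← hy2]
  congr 1
  have e0 := congrArg (fun p : E3 => p 0) e
  have e1 := congrArg (fun p : E3 => p 1) e
  have e2 := congrArg (fun p : E3 => p 2) e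
  simp only [motion] at e0 e1 e2
  rw [fold_two, fold_two] at e2
  exact h.fold_inj (hκ.mem t ht') hx1 hy1 (horiz_eq e0 e1)
    (mul_left_cancel₀ (alt_pos (hκ.mem t ht').1 (hκ.lt h ht)).ne' e2)

end Schedule

end Corner

/-! ### Seams between cells and the stacking order of the flat state. -/

/-- The common edges of the cells, in the order of `creases`. -/
def seams : Set Coef :=
  {w | (∀ i, 0 ≤ w i) ∧ ((w 1 = 0 ∧ w 2 = 0 ∧ w 3 = 0 ∧ w 4 = 0 ∧ w 0 ≤ 1) ∨
    (w 1 = 0 ∧ w 3 = 0 ∧ w 4 = 0 ∧ w 0 + w 2 = 1) ∨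
    (w 2 = 0 ∧ w 3 = 0 ∧ w 4 = 0 ∧ w 0 + w 1 = 1) ∨
    (w 0 = 0 ∧ w 2 = 0 ∧ w 3 = 0 ∧ w 4 = 0 ∧ w 1 ≤ 1) ∨
    (w 0 = 0 ∧ w 3 = 0 ∧ w 4 = 0 ∧ w 1 + w 2 = 1) ∨
    (w 0 = 1 ∧ w 1 = 0 ∧ w 2 = 0 ∧ w 4 = 0) ∨
    (w 0 = 0 ∧ w 1 = 1 ∧ w 2 = 0 ∧ w 3 = 0))}

theorem mem_seams_of_mem_cell {i j : Fin 6} (hij : i ≠ j) {w : Coef} (hi : w ∈ cell i)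
    (hj : w ∈ cell j) : w ∈ seams := by
  wlog hlt : i < j generalizing i j
  · exact this hij.symm hj hi (lt_of_le_of_ne (not_lt.1 hlt) hij.symm)
  have n : ∀ i, 0 ≤ w i := (cells_bounds (cell_subset_cells i hi)).1
  have n0 := n 0
  have n1 := n 1
  have n2 := n 2
  refine ⟨n, ?_⟩
  fin_cases i <;> fin_cases j <;> first | exact absurd hlt (by decide) | skip
  all_goals
    simp only [cell, Fin.reduceFinMk, Matrix.cons_val, Fin.zero_eta, Fin.mk_one, Fin.isValue,
      mem_ofPred_eq] at hi hj
    grind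

namespace Corner

variable {G : Corner} {κ : ℝ → ℝ}

/-- No cell is degenerate in the development: up to sign the determinants are `κA * LA`, `(1 - κA) *
LA`, their analogues for `B`, and the quantities of `lower_pos` and `upper_pos`. -/
theorem Closes.det_edge_ne (h : G.Closes) {t : ℝ} (ht : t ∈ Icc (0 : ℝ) 1) (i : Fin 6) :
    G.dev t (edge₁ i) 0 * G.dev t (edge₂ i) 1 - G.dev t (edge₁ i) 1 * G.dev t (edge₂ i) 0 ≠ 0 := by
  have hd := G.q_det_v
  have hlo := h.lower_pos (sA_mem (G := G) ht).1
  have hup := h.upper_pos (sA_mem (G := G) ht)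
  have h1 := mul_pos (G.κA_mem).1 G.LA_pos
  have h2 := mul_pos (sub_pos.2 (G.κA_mem).2) G.LA_pos
  have h3 := mul_pos (G.κB_mem).1 G.LB_pos
  have h4 := mul_pos (sub_pos.2 (G.κB_mem).2) G.LB_pos
  simp only [dev, ev_dev_zero, ev_dev_one]
  fin_cases i <;> simp only [edge₁, edge₂, Fin.reduceFinMk, Matrix.cons_val, Fin.zero_eta,
    Fin.mk_one, Fin.isValue]
  · exact ne_of_lt (by linarith)
  · exact ne_of_gt (by linarith)
  · exact ne_of_gt (by linear_combination h3 - G.κB * hd)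
  · exact ne_of_lt (by linear_combination h4 + (G.κB - 1) * hd)
  · exact ne_of_gt (by linear_combination hlo - G.κA * G.SB * hd)
  · exact ne_of_lt (by linear_combination hup + (G.κA - 1) * G.SB * hd)

theorem inner_E2 (x y : E2) : inner ℝ x y = x 0 * y 0 + x 1 * y 1 := by
  simp [PiLp.inner_apply, Fin.sum_univ_succ, mul_comm]

theorem inner_E3 (x y : E3) : inner ℝ x y = x 0 * y 0 + x 1 * y 1 + x 2 * y 2 := by
  simp [PiLp.inner_apply, Fin.sum_univ_succ, mul_comm, add_assoc]

/-- The squared determinant of two plane vectors is their Gram determinant, which isometry carries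
over from the development since the flat state has height 0. -/
theorem Closes.det_flat_ne (h : G.Closes) (i : Fin 6) :
    G.fold G.H (edge₁ i) 0 * G.fold G.H (edge₂ i) 1 -
      G.fold G.H (edge₁ i) 1 * G.fold G.H (edge₂ i) 0 ≠ 0 := by
  have hd := h.det_edge_ne (t := 1) (by simp) i
  have I := (h.isometric G.H_mem (alt_sq G.H_mem)).inner_edge i
  have e : ev (G.a2 (G.slide G.H)) G.b2 G.q2v u2 G.v2 = G.dev 1 := by
    rw [dev, h.slide_H, one_mul]
  rw [e] at I
  obtain ⟨h1, h2, h3⟩ := I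
  change inner ℝ (G.fold G.H _) (G.fold G.H _) = _ at h1 h2 h3
  rw [inner_E2, inner_E3] at h1 h2 h3
  simp only [fold_two, alt_H, zero_mul, mul_zero, add_zero] at h1 h2 h3
  refine fun h0 => hd (pow_eq_zero_iff two_ne_zero |>.1 ?_)
  set a := G.fold G.H (edge₁ i) 0
  set b := G.fold G.H (edge₁ i) 1
  set c := G.fold G.H (edge₂ i) 0
  set d := G.fold G.H (edge₂ i) 1
  have e1 : (a * d - b * c) ^ 2 = (a * a + b * b) * (c * c + d * d) - (a * c + b * d) ^ 2 := by ring
  rw [h0, h1, h2, h3] at e1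
  linear_combination -e1

/-- A point inside a face of the final pattern can be moved along during the last moments of the
motion so that it stays on a given vertical line. -/
theorem Closes.exists_coincidence (h : G.Closes) (hκ : G.IsSchedule κ) {x y : E2}
    (hx : x ∈ interior G.sheet) (hy : y ∈ G.sheet) {i : Fin 6}
    (hi : ∀ j ≠ i, G.coef 1 x ∉ cell j) (hxy : G.motion κ 1 x = G.motion κ 1 y) :
    ∃ ξ : ℝ → E2, Tendsto ξ (𝓝[Icc 0 1] 1) (𝓝 x) ∧ ∀ᶠ t in 𝓝[Icc 0 1] 1,
      G.motion κ t (ξ t) 0 = G.motion κ t y 0 ∧ G.motion κ t (ξ t) 1 = G.motion κ t y 1 := by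
  have h1 : (1 : ℝ) ∈ Icc (0 : ℝ) 1 := by simp
  have hxs := interior_subset hx
  have only : ∀ {w : Coef}, w ∈ cells → (∀ j ≠ i, w ∉ cell j) → w ∈ cell i := by
    intro w hw hn
    obtain ⟨j, hj⟩ := mem_iUnion.1 hw
    by_cases hji : j = i
    · exact hji ▸ hj
    · exact absurd hj (hn j hji)
  obtain ⟨c₀, d₀, h0⟩ := exists_chart (only (h.coef_mem h1 hxs).1 hi)
  have hfold : ∀ w j, ContinuousWithinAt (fun t => G.fold (κ t) w j) (Icc 0 1) 1 := by
    intro w j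
    have := h.fold_continuousOn.comp (f := fun t => (κ t, w)) (hκ.cont.prodMk continuousOn_const)
      (fun t ht => mk_mem_prod (hκ.mem t ht) (mem_univ _)) 1 h1
    exact (EuclideanSpace.proj (𝕜 := ℝ) j).continuous.continuousAt.comp_continuousWithinAt this
  have hB : ∀ j, ContinuousWithinAt (fun t => G.motion κ t y j) (Icc 0 1) 1 := by
    intro j
    have := (h.motion_continuousOn hκ).comp (f := fun t => (t, y)) (by fun_prop)
      (fun t ht => mk_mem_prod ht hy) 1 h1
    exact (EuclideanSpace.proj (𝕜 := ℝ) j).continuous.continuousAt.comp_continuousWithinAt this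
  set O : ℝ → Fin 3 → ℝ := fun t => G.fold (κ t) (apex i)
  set X : ℝ → Fin 3 → ℝ := fun t => G.fold (κ t) (edge₁ i)
  set Y : ℝ → Fin 3 → ℝ := fun t => G.fold (κ t) (edge₂ i)
  set B : ℝ → Fin 3 → ℝ := fun t => G.motion κ t y
  have hO : ∀ j, ContinuousWithinAt (fun t => O t j) (Icc 0 1) 1 := hfold _
  have hX : ∀ j, ContinuousWithinAt (fun t => X t j) (Icc 0 1) 1 := hfold _
  have hY : ∀ j, ContinuousWithinAt (fun t => Y t j) (Icc 0 1) 1 := hfold _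
  have hchart : ∀ t c d j, G.fold (κ t) (chart i c d) j = O t j + c * X t j + d * Y t j := by
    intro t c d j
    simp only [fold, ev_chart]
    rfl
  set D : ℝ → ℝ := fun t => X t 0 * Y t 1 - X t 1 * Y t 0 with hD
  have hDc : ContinuousWithinAt D (Icc 0 1) 1 := ((hX 0).mul (hY 1)).sub ((hX 1).mul (hY 0))
  have hD1 : D 1 ≠ 0 := by
    have := h.det_flat_ne i
    rwa [← hκ.one h] at this
  -- Cramer's rule for the point of the plane of cell `i` above or below the image of `y`. The
  -- determinant `D` is nonzero at time 1, so `c` and `d` are continuous there.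
  set c : ℝ → ℝ := fun t => ((B t 0 - O t 0) * Y t 1 - (B t 1 - O t 1) * Y t 0) / D t with hc
  set d : ℝ → ℝ := fun t => (X t 0 * (B t 1 - O t 1) - X t 1 * (B t 0 - O t 0)) / D t with hd
  have hcc : ContinuousWithinAt c (Icc 0 1) 1 :=
    ((((hB 0).sub (hO 0)).mul (hY 1)).sub (((hB 1).sub (hO 1)).mul (hY 0))).div hDc hD1
  have hdc : ContinuousWithinAt d (Icc 0 1) 1 :=
    (((hX 0).mul ((hB 1).sub (hO 1))).sub ((hX 1).mul ((hB 0).sub (hO 0)))).div hDc hD1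
  have eB : ∀ j, B 1 j = O 1 j + c₀ * X 1 j + d₀ * Y 1 j := by
    intro j
    rw [← hchart, ← h0]
    exact congrArg (fun p : E3 => p j) hxy.symm
  have ec : c 1 = c₀ := by
    rw [hc]
    simp only
    rw [div_eq_iff hD1, eB 0, eB 1, hD]
    ring
  have ed : d 1 = d₀ := by
    rw [hd]
    simp only
    rw [div_eq_iff hD1, eB 0, eB 1, hD]
    ring
  have hξ : ContinuousWithinAt (fun t => G.dev t (chart i (c t) (d t))) (Icc 0 1) 1 := by
    have : Continuous fun p : ℝ × ℝ => chart i p.1 p.2 := by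
      unfold chart
      fun_prop
    have hch : ContinuousWithinAt (fun t => chart i (c t) (d t)) (Icc 0 1) 1 :=
      this.continuousAt.comp_continuousWithinAt (f := fun t => (c t, d t)) (hcc.prodMk hdc)
    have hp : ContinuousWithinAt (fun t => (t, chart i (c t) (d t))) (Icc 0 1) 1 :=
      continuousWithinAt_id.prodMk hch
    simpa only [Function.comp_def] using G.dev_continuous.continuousAt.comp_continuousWithinAt hp
  have hlim : Tendsto (fun t => G.dev t (chart i (c t) (d t))) (𝓝[Icc 0 1] 1) (𝓝 x) := by
    have := hξ.tendsto
    rwa [ec, ed, ← h0, (h.coef_mem h1 hxs).2] at this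
  refine ⟨_, hlim, ?_⟩
  have hsheet : ∀ᶠ t in 𝓝[Icc 0 1] 1, G.dev t (chart i (c t) (d t)) ∈ G.sheet :=
    (hlim.eventually (isOpen_interior.mem_nhds hx)).mono fun t ht => interior_subset ht
  have hcoef : Tendsto (fun t => G.coef t (G.dev t (chart i (c t) (d t)))) (𝓝[Icc 0 1] 1)
      (𝓝 (G.coef 1 x)) := by
    have T : Tendsto (fun p : ℝ × E2 => G.coef p.1 p.2) (𝓝[Icc (0 : ℝ) 1 ×ˢ G.sheet] (1, x))
        (𝓝 (G.coef 1 x)) := h.coef_continuousOn (1, x) (mk_mem_prod h1 hxs)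
    have T' : Tendsto (fun t => (t, G.dev t (chart i (c t) (d t)))) (𝓝[Icc 0 1] 1)
        (𝓝[Icc (0 : ℝ) 1 ×ˢ G.sheet] (1, x)) := by
      refine tendsto_nhdsWithin_iff.2 ⟨?_, ?_⟩
      · exact (tendsto_id.mono_left nhdsWithin_le_nhds).prodMk_nhds hlim
      · filter_upwards [hsheet, self_mem_nhdsWithin] with t h2 h3 using mk_mem_prod h3 h2
    simpa only [Function.comp_def] using T.comp T'
  -- The other cells are closed and miss the coefficients of `x`, so near the end the moving point
  -- stays in cell `i`, where the chart computes its image.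
  have hcell : ∀ᶠ t in 𝓝[Icc 0 1] 1, ∀ j ≠ i,
      G.coef t (G.dev t (chart i (c t) (d t))) ∉ cell j := by
    refine eventually_all.2 fun j => ?_
    by_cases hji : j = i
    · simp [hji]
    · filter_upwards [hcoef.eventually ((isClosed_cell j).isOpen_compl.mem_nhds (hi j hji))]
        with t ht _ using ht
  filter_upwards [hsheet, hcell, self_mem_nhdsWithin, hDc.eventually_ne hD1] with t h2 h3 h4 h5
  obtain ⟨h6, h7⟩ := h.coef_mem h4 h2
  obtain ⟨c', d', h8⟩ := exists_chart (only h6 h3)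
  have e : G.motion κ t (G.dev t (chart i (c t) (d t))) = G.fold (κ t) (chart i (c t) (d t)) := by
    rw [motion, h8]
    rw [h8] at h7
    rw [← dist_eq_zero, h.isometric_fold hκ h4, h7, dist_self]
  rw [e, hchart, hchart]
  constructor
  · change _ = B t 0
    rw [hc, hd]
    simp only
    field_simp
    rw [hD]
    ring
  · change _ = B t 1
    rw [hc, hd]
    simp only
    field_simp
    rw [hD]
    ring

/-- The relative height is jointly continuous up to the final time, so the strict inequality
persists nearby; before the end height is relative height times the positive `alt`. -/
theorem Closes.liesAbove (h : G.Closes) (hκ : G.IsSchedule κ) {x y : E2}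
    (hx : x ∈ interior G.sheet) (hy : y ∈ interior G.sheet)
    (hlt : G.relHeight G.H (G.coef 1 y) < G.relHeight G.H (G.coef 1 x)) :
    LiesAbove (G.motion κ) x y := by
  have h1 : (1 : ℝ) ∈ Icc (0 : ℝ) 1 := by simp
  have hr : ContinuousOn (fun p : ℝ × E2 => G.relHeight (κ p.1) (G.coef p.1 p.2))
      (Icc (0 : ℝ) 1 ×ˢ G.sheet) := by
    have hfst : MapsTo (fun p : ℝ × E2 => κ p.1) (Icc (0 : ℝ) 1 ×ˢ G.sheet) (Icc 0 G.H) :=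
      fun p hp => hκ.mem _ hp.1
    have hk : ContinuousOn (fun p : ℝ × E2 => κ p.1) (Icc (0 : ℝ) 1 ×ˢ G.sheet) :=
      hκ.cont.comp continuousOn_fst fun _ hp => hp.1
    have rA := (ratio_continuousOn (w := G.wA) (H := G.H) G.LA_pos).comp hk hfst
    have rB := (ratio_continuousOn (w := G.wB) (H := G.H) G.LB_pos).comp hk hfst
    have hw := continuousOn_pi.1 h.coef_continuousOn
    exact (((hw 0).mul rA).add ((hw 1).mul rB)).add (hw 2)
  have hlim : ∀ {z : E2} {g : ℝ × E2 × E2 → E2}, z ∈ interior G.sheet →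
      Tendsto g (𝓝[<] (1 : ℝ) ×ˢ (𝓝 x ×ˢ 𝓝 y)) (𝓝 z) →
      Tendsto (fun w => G.relHeight (κ w.1) (G.coef w.1 (g w))) (𝓝[<] (1 : ℝ) ×ˢ (𝓝 x ×ˢ 𝓝 y))
        (𝓝 (G.relHeight G.H (G.coef 1 z))) ∧
      ∀ᶠ w in 𝓝[<] (1 : ℝ) ×ˢ (𝓝 x ×ˢ 𝓝 y), g w ∈ G.sheet := by
    intro z g hz hg
    have hmem : ∀ᶠ w in 𝓝[<] (1 : ℝ) ×ˢ (𝓝 x ×ˢ 𝓝 y), g w ∈ G.sheet :=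
      (hg.eventually (isOpen_interior.mem_nhds hz)).mono fun t ht => interior_subset ht
    refine ⟨?_, hmem⟩
    rw [← hκ.one h]
    have T : Tendsto (fun p : ℝ × E2 => G.relHeight (κ p.1) (G.coef p.1 p.2))
        (𝓝[Icc (0 : ℝ) 1 ×ˢ G.sheet] (1, z)) (𝓝 (G.relHeight (κ 1) (G.coef 1 z))) :=
      hr (1, z) (mk_mem_prod h1 (interior_subset hz))
    have T' : Tendsto (fun w => (w.1, g w)) (𝓝[<] (1 : ℝ) ×ˢ (𝓝 x ×ˢ 𝓝 y))
        (𝓝[Icc (0 : ℝ) 1 ×ˢ G.sheet] (1, z)) := by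
      refine tendsto_nhdsWithin_iff.2 ⟨?_, ?_⟩
      · exact (tendsto_fst.mono_right nhdsWithin_le_nhds).prodMk_nhds hg
      · filter_upwards [hmem, tendsto_fst.eventually (Ico_mem_nhdsLT zero_lt_one)] with w h2 h3
          using mk_mem_prod (Ico_subset_Icc_self h3) h2
    simpa only [Function.comp_def] using T.comp T'
  obtain ⟨hX, hX'⟩ := hlim hx (g := fun w => w.2.1) (tendsto_fst.comp tendsto_snd)
  obtain ⟨hY, hY'⟩ := hlim hy (g := fun w => w.2.2) (tendsto_snd.comp tendsto_snd)
  filter_upwards [hY.eventually_lt hX hlt, tendsto_fst.eventually (Ico_mem_nhdsLT zero_lt_one)]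
    with w h2 h3 _ _
  rw [motion, motion, fold_two, fold_two]
  exact mul_lt_mul_of_pos_left h2 (alt_pos (hκ.mem _ (Ico_subset_Icc_self h3)).1 (hκ.lt h h3))

/-- `LiesAbove` would hold vacuously if no nearby points shared a vertical line.
`exists_coincidence` supplies such pairs arbitrarily close to the end, where both orders cannot
hold. -/
theorem Closes.not_liesAbove (h : G.Closes) (hκ : G.IsSchedule κ) {x y : E2}
    (hx : x ∈ interior G.sheet) (hy : y ∈ interior G.sheet) (hseam : G.coef 1 x ∉ seams)
    (hxy : G.motion κ 1 x = G.motion κ 1 y) (hab : LiesAbove (G.motion κ) x y) :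
    ¬ LiesAbove (G.motion κ) y x := by
  intro hba
  obtain ⟨i, hi⟩ := mem_iUnion.1 (h.coef_mem (t := 1) (by simp) (interior_subset hx)).1
  obtain ⟨ξ, hξ, hev⟩ := h.exists_coincidence hκ hx (interior_subset hy) (i := i)
    (fun j hj hj' => hseam (mem_seams_of_mem_cell hj hj' hi)) hxy
  have hle : 𝓝[<] (1 : ℝ) ≤ 𝓝[Icc 0 1] 1 :=
    nhdsWithin_le_iff.2 (mem_of_superset (Ico_mem_nhdsLT zero_lt_one) Ico_subset_Icc_self)
  have t1 : Tendsto (fun t => (t, ξ t, y)) (𝓝[<] (1 : ℝ)) (𝓝[<] (1 : ℝ) ×ˢ (𝓝 x ×ˢ 𝓝 y)) :=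
    tendsto_id.prodMk ((hξ.mono_left hle).prodMk tendsto_const_nhds)
  have t2 : Tendsto (fun t => (t, y, ξ t)) (𝓝[<] (1 : ℝ)) (𝓝[<] (1 : ℝ) ×ˢ (𝓝 y ×ˢ 𝓝 x)) :=
    tendsto_id.prodMk (tendsto_const_nhds.prodMk (hξ.mono_left hle))
  obtain ⟨t, h2, h3, h4⟩ := ((t1.eventually hab).and ((t2.eventually hba).and
    (hle hev))).exists
  exact lt_asymm (h2 h4.1 h4.2) (h3 h4.1.symm h4.2.symm)

/-- Relative heights decide. They differ, since equal ones together with equal horizontal positions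
would give x = y by `fold_inj` in the flat state. -/
theorem Closes.xor_liesAbove (h : G.Closes) (hκ : G.IsSchedule κ) {x y : E2}
    (hx : x ∈ interior G.sheet) (hy : y ∈ interior G.sheet) (hx' : G.coef 1 x ∉ seams)
    (hy' : G.coef 1 y ∉ seams) (hne : x ≠ y) (hxy : G.motion κ 1 x = G.motion κ 1 y) :
    Xor (LiesAbove (G.motion κ) x y) (LiesAbove (G.motion κ) y x) := by
  have h1 : (1 : ℝ) ∈ Icc (0 : ℝ) 1 := by simp
  obtain ⟨hx1, hx2⟩ := h.coef_mem h1 (interior_subset hx)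
  obtain ⟨hy1, hy2⟩ := h.coef_mem h1 (interior_subset hy)
  rcases lt_trichotomy (G.relHeight G.H (G.coef 1 x)) (G.relHeight G.H (G.coef 1 y))
    with hr | hr | hr
  · have hab := h.liesAbove hκ hy hx hr
    exact .inr ⟨hab, h.not_liesAbove hκ hy hx hy' hxy.symm hab⟩
  · refine absurd ?_ hne
    rw [← hx2, ← hy2]
    congr 1
    have e := hxy
    simp only [motion, hκ.one h] at e
    exact h.fold_inj G.H_mem hx1 hy1 (horiz_eq (congrArg (fun p : E3 => p 0) e)
      (congrArg (fun p : E3 => p 1) e)) hr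
  · have hab := h.liesAbove hκ hx hy hr
    exact .inl ⟨hab, h.not_liesAbove hκ hx hy hx' hxy hab⟩

end Corner

/-! ### Convex hulls of three and four points. -/

section Hull

variable {E : Type*} [AddCommGroup E] [Module ℝ E]

theorem convexHull_triple (x y z : E) : convexHull ℝ {x, y, z} =
    {p | ∃ a b c : ℝ, 0 ≤ a ∧ 0 ≤ b ∧ 0 ≤ c ∧ a + b + c = 1 ∧ p = a • x + b • y + c • z} := by
  apply Subset.antisymm
  · refine convexHull_min ?_ ?_
    · rintro p (rfl | rfl | rfl)
      · exact ⟨1, 0, 0, by simp, by simp, by simp, by simp, by simp⟩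
      · exact ⟨0, 1, 0, by simp, by simp, by simp, by simp, by simp⟩
      · exact ⟨0, 0, 1, by simp, by simp, by simp, by simp, by simp⟩
    · rintro p ⟨a, b, c, ha, hb, hc, hs, rfl⟩ p' ⟨a', b', c', ha', hb', hc', hs', rfl⟩ r r' hr hr' e
      refine ⟨r * a + r' * a', r * b + r' * b', r * c + r' * c', by positivity, by positivity,
        by positivity, ?_, by module⟩
      linear_combination r * hs + r' * hs' + e
  · rintro p ⟨a, b, c, ha, hb, hc, hs, rfl⟩
    have h := convex_convexHull ℝ ({x, y, z} : Set E)
    have hx : x ∈ convexHull ℝ {x, y, z} := subset_convexHull ℝ _ (by simp)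
    have hy : y ∈ convexHull ℝ {x, y, z} := subset_convexHull ℝ _ (by simp)
    have hz : z ∈ convexHull ℝ {x, y, z} := subset_convexHull ℝ _ (by simp)
    have := h.sum_mem (t := Finset.univ) (w := ![a, b, c]) (z := ![x, y, z])
      (fun i _ => by fin_cases i <;> assumption) (by simpa [Fin.sum_univ_succ, add_assoc] using hs)
      (fun i _ => by fin_cases i <;> assumption)
    simpa [Fin.sum_univ_succ, add_assoc] using this

theorem convexHull_zero_triple_subset (x y z : E) : convexHull ℝ {0, x, y, z} ⊆
    {p | ∃ a b c : ℝ, 0 ≤ a ∧ 0 ≤ b ∧ 0 ≤ c ∧ a + b + c ≤ 1 ∧ p = a • x + b • y + c • z} := by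
  refine convexHull_min ?_ ?_
  · rintro p (rfl | rfl | rfl | rfl)
    · exact ⟨0, 0, 0, by simp, by simp, by simp, by simp, by simp⟩
    · exact ⟨1, 0, 0, by simp, by simp, by simp, by simp, by simp⟩
    · exact ⟨0, 1, 0, by simp, by simp, by simp, by simp, by simp⟩
    · exact ⟨0, 0, 1, by simp, by simp, by simp, by simp, by simp⟩
  · rintro p ⟨a, b, c, ha, hb, hc, hs, rfl⟩ p' ⟨a', b', c', ha', hb', hc', hs', rfl⟩ r r' hr hr' e
    refine ⟨r * a + r' * a', r * b + r' * b', r * c + r' * c', by positivity, by positivity,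
      by positivity, ?_, by module⟩
    linarith [mul_le_mul_of_nonneg_left hs hr, mul_le_mul_of_nonneg_left hs' hr']

end Hull

/-! ### Dictionary between the stated geometry and the cells. -/

theorem mem_halfStrip_self {a e x : E2} : x ∈ halfStrip a a e ↔ ∃ s : ℝ, 0 ≤ s ∧ x = a + s • e := by
  simp only [halfStrip, AffineMap.lineMap_same, mem_ofPred_eq,
    AffineMap.const_apply]
  exact ⟨fun ⟨_, _, h⟩ => h, fun h => ⟨0, by simp, h⟩⟩

theorem halfStrip_zero (a e : E2) :
    halfStrip 0 a e = {x | ∃ r ∈ Icc (0 : ℝ) 1, ∃ s : ℝ, 0 ≤ s ∧ x = r • a + s • e} := by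
  simp only [halfStrip, AffineMap.lineMap_apply_module, smul_zero, zero_add]

/-- The corner `G` is the spanning edge with the given angles and length. -/
structure Corner.Realizes (G : Corner) (θ α β l : ℝ) : Prop where
  q2_eq : q2 α l = G.q2v
  eA_eq : eA = Corner.u2
  eB_eq : eB α β = G.v2
  uA_eq : uA = Corner.u3
  uB_eq : uB θ = G.v3
  q3_eq : ∀ z, q3 θ α β l z = G.q3v z
  height_eq : height θ α β l = G.H
  cA_eq : cA θ α β l = G.κA • G.q2v
  cB_eq : cB θ α β l = G.κB • G.q2v
  pA_eq : OutOut.pA θ α β l = G.a2 G.SA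
  pB_eq : OutOut.pB θ α β l = G.b2

variable {G : Corner} {θ α β l : ℝ} {κ : ℝ → ℝ}

namespace Corner

theorem Realizes.pA'_eq (R : G.Realizes θ α β l) (t : ℝ) : pA' θ α β l t = G.a2 (t * G.SA) := by
  rw [pA', R.cA_eq, R.pA_eq, AffineMap.lineMap_apply_module, a2, a2]
  module

theorem Realizes.paper_eq (R : G.Realizes θ α β l) : paper α β l = G.sheet := by
  rw [paper, halfStrip_zero, halfStrip_zero, R.q2_eq, R.eA_eq, R.eB_eq]
  ext x
  constructor
  · rintro (⟨r, hr, s, hs, e⟩ | ⟨r, hr, s, hs, e⟩)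
    · exact ⟨r, hr, s, hs, .inl e⟩
    · exact ⟨r, hr, s, hs, .inr e⟩
  · rintro ⟨r, hr, s, hs, e | e⟩
    · exact .inl ⟨r, hr, s, hs, e⟩
    · exact .inr ⟨r, hr, s, hs, e⟩

theorem dev_vec (t c0 c1 c2 c3 c4 : ℝ) : G.dev t ![c0, c1, c2, c3, c4] =
    c0 • G.a2 (t * G.SA) + c1 • G.b2 + c2 • G.q2v + c3 • u2 + c4 • G.v2 :=
  ev_vec ..

theorem fold_vec (k c0 c1 c2 c3 c4 : ℝ) : G.fold k ![c0, c1, c2, c3, c4] =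
    c0 • G.a3 (G.slide k) k (G.alt k) + c1 • G.b3 k (G.alt k) + c2 • G.q3v (G.alt k) + c3 • u3 +
      c4 • G.v3 :=
  ev_vec ..

theorem Realizes.face_eq (R : G.Realizes θ α β l) (t : ℝ) (i : Fin 6) :
    face θ α β l t i = G.dev t '' cell i := by
  ext x
  fin_cases i
  · change x ∈ halfStrip _ _ _ ↔ _
    rw [halfStrip_zero, R.pA'_eq, R.eA_eq]
    constructor
    · rintro ⟨r, hr, s, hs, rfl⟩
      refine ⟨![r, 0, 0, s, 0], ⟨vec_nonneg hr.1 le_rfl le_rfl hs le_rfl, rfl, rfl, rfl, hr.2⟩, ?_⟩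
      rw [dev_vec]
      module
    · rintro ⟨w, ⟨n, h1, h2, h4, h0⟩, rfl⟩
      refine ⟨w 0, ⟨n 0, h0⟩, w 3, n 3, ?_⟩
      rw [dev, ev, h1, h2, h4]
      module
  · change x ∈ halfStrip _ _ _ ↔ _
    rw [halfStrip, R.pA'_eq, R.eA_eq, R.q2_eq]
    constructor
    · rintro ⟨r, hr, s, hs, rfl⟩
      refine ⟨![1 - r, 0, r, s, 0],
        ⟨vec_nonneg (by linarith [hr.2]) le_rfl hr.1 hs le_rfl, rfl, rfl,
        sub_add_cancel 1 r⟩, ?_⟩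
      rw [dev_vec, AffineMap.lineMap_apply_module]
      module
    · rintro ⟨w, ⟨n, h1, h4, h0⟩, rfl⟩
      refine ⟨w 2, ⟨n 2, by linarith [n 0]⟩, w 3, n 3, ?_⟩
      rw [dev, ev, h1, h4, AffineMap.lineMap_apply_module, eq_sub_of_add_eq h0]
      module
  · change x ∈ halfStrip _ _ _ ↔ _
    rw [halfStrip_zero, R.pB_eq, R.eB_eq]
    constructor
    · rintro ⟨r, hr, s, hs, rfl⟩
      refine ⟨![0, r, 0, 0, s], ⟨vec_nonneg le_rfl hr.1 le_rfl le_rfl hs, rfl, rfl, rfl, hr.2⟩, ?_⟩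
      rw [dev_vec]
      module
    · rintro ⟨w, ⟨n, h1, h2, h4, h0⟩, rfl⟩
      refine ⟨w 1, ⟨n 1, h0⟩, w 4, n 4, ?_⟩
      rw [dev, ev, h1, h2, h4]
      module
  · change x ∈ halfStrip _ _ _ ↔ _
    rw [halfStrip, R.pB_eq, R.eB_eq, R.q2_eq]
    constructor
    · rintro ⟨r, hr, s, hs, rfl⟩
      refine ⟨![0, 1 - r, r, 0, s],
        ⟨vec_nonneg le_rfl (by linarith [hr.2]) hr.1 le_rfl hs, rfl, rfl,
        sub_add_cancel 1 r⟩, ?_⟩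
      rw [dev_vec, AffineMap.lineMap_apply_module]
      module
    · rintro ⟨w, ⟨n, h1, h4, h0⟩, rfl⟩
      refine ⟨w 2, ⟨n 2, by linarith [n 1]⟩, w 4, n 4, ?_⟩
      rw [dev, ev, h1, h4, AffineMap.lineMap_apply_module, eq_sub_of_add_eq h0]
      module
  · change x ∈ convexHull ℝ _ ↔ _
    rw [convexHull_triple, R.pA'_eq, R.pB_eq]
    constructor
    · rintro ⟨c, a, b, hc, ha, hb, hs, rfl⟩
      refine ⟨![a, b, 0, 0, 0], ⟨vec_nonneg ha hb le_rfl le_rfl le_rfl, rfl, rfl, rfl,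
        (by linarith : a + b ≤ 1)⟩, ?_⟩
      rw [dev_vec]
      module
    · rintro ⟨w, ⟨n, h2, h3, h4, h0⟩, rfl⟩
      refine ⟨1 - w 0 - w 1, w 0, w 1, by linarith, n 0, n 1, by ring, ?_⟩
      rw [dev, ev, h2, h3, h4]
      module
  · change x ∈ convexHull ℝ _ ↔ _
    rw [convexHull_triple, R.pA'_eq, R.pB_eq, R.q2_eq]
    constructor
    · rintro ⟨c, a, b, hc, ha, hb, hs, rfl⟩
      refine ⟨![a, b, c, 0, 0], ⟨vec_nonneg ha hb hc le_rfl le_rfl, rfl, rfl,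
        (by linarith : a + b + c = 1)⟩, ?_⟩
      rw [dev_vec]
      module
    · rintro ⟨w, ⟨n, h3, h4, h0⟩, rfl⟩
      refine ⟨w 2, w 0, w 1, n 2, n 0, n 1, by linarith, ?_⟩
      rw [dev, ev, h3, h4]
      module

theorem Realizes.mem_creases (R : G.Realizes θ α β l) (t : ℝ) {w : Coef} (hw : w ∈ seams) :
    G.dev t w ∈ creases θ α β l t := by
  obtain ⟨n, h⟩ := hw
  have seg : ∀ {x y z : E2} {a b : ℝ}, 0 ≤ a → 0 ≤ b → a + b = 1 → z = a • x + b • y →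
      z ∈ segment ℝ x y := fun ha hb hs e => ⟨_, _, ha, hb, hs, e.symm⟩
  rw [creases, R.pA'_eq, R.pB_eq, R.q2_eq, R.eA_eq, R.eB_eq]
  rcases h with ⟨h1, h2, h3, h4, h0⟩ | ⟨h1, h3, h4, h0⟩ | ⟨h2, h3, h4, h0⟩ | ⟨h1, h2, h3, h4, h0⟩ |
    ⟨h1, h3, h4, h0⟩ | ⟨h0, h1, h2, h4⟩ | ⟨h0, h1, h2, h3⟩
  · refine .inl (.inl (.inl (.inl (.inl (.inl (seg (n 0) (sub_nonneg.2 h0) (by ring) ?_))))))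
    rw [dev, ev, h1, h2, h3, h4]
    module
  · refine .inl (.inl (.inl (.inl (.inl (.inr (seg (n 0) (n 2) h0 ?_))))))
    rw [dev, ev, h1, h3, h4]
    module
  · refine .inl (.inl (.inl (.inl (.inr (seg (n 0) (n 1) h0 ?_)))))
    rw [dev, ev, h2, h3, h4]
    module
  · refine .inl (.inl (.inl (.inr (seg (n 1) (sub_nonneg.2 h0) (by ring) ?_))))
    rw [dev, ev, h1, h2, h3, h4]
    module
  · refine .inl (.inl (.inr (seg (n 1) (n 2) h0 ?_)))
    rw [dev, ev, h1, h3, h4]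
    module
  · refine .inl (.inr (mem_halfStrip_self.2 ⟨w 3, n 3, ?_⟩))
    rw [dev, ev, h0, h1, h2, h4]
    module
  · refine .inr (mem_halfStrip_self.2 ⟨w 4, n 4, ?_⟩)
    rw [dev, ev, h0, h1, h2, h3]
    module

end Corner

/-! ### Creases are null sets; subdivision and initial state. -/

theorem volume_line (p d : E2) : volume {x : E2 | ∃ s : ℝ, x = p + s • d} = 0 := by
  have h := Measure.addHaar_affineSubspace (volume : Measure E2)
    (AffineSubspace.mk' p (Submodule.span ℝ {d})) fun htop => by
      have h1 := congrArg AffineSubspace.direction htop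
      rw [AffineSubspace.direction_mk', AffineSubspace.direction_top] at h1
      have h2 := finrank_span_finset_le_card (R := ℝ) ({d} : Finset E2)
      rw [Finset.coe_singleton, Set.finrank, h1, finrank_top, finrank_euclideanSpace_fin,
        Finset.card_singleton] at h2
      omega
  refine measure_mono_null ?_ h
  rintro x ⟨s, rfl⟩
  rw [SetLike.mem_coe, AffineSubspace.mem_mk', vsub_eq_sub, add_sub_cancel_left]
  exact Submodule.smul_mem _ _ (Submodule.mem_span_singleton_self d)

theorem volume_segment (x y : E2) : volume (segment ℝ x y) = 0 := by
  refine measure_mono_null ?_ (volume_line x (y - x))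
  rw [segment_eq_image']
  rintro _ ⟨s, -, rfl⟩
  exact ⟨s, rfl⟩

theorem volume_ray (a e : E2) : volume (halfStrip a a e) = 0 := by
  refine measure_mono_null ?_ (volume_line a e)
  intro x hx
  obtain ⟨s, -, h⟩ := mem_halfStrip_self.1 hx
  exact ⟨s, h⟩

theorem volume_creases (θ α β l t : ℝ) : volume (creases θ α β l t) = 0 := by
  simp only [creases, measure_union_null_iff, volume_segment, volume_ray, and_self]

namespace Corner

/-- Two faces meet only in creases, so the intersection of their interiors is an open null set and
hence empty. -/
theorem Closes.subdivision (h : G.Closes) (R : G.Realizes θ α β l) {t : ℝ}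
    (ht : t ∈ Icc (0 : ℝ) 1) {i j : Fin 6} (hij : i ≠ j) :
    Disjoint (interior (face θ α β l t i)) (interior (face θ α β l t j)) := by
  rw [disjoint_iff_inter_eq_empty]
  refine (isOpen_interior.inter isOpen_interior).eq_empty_of_measure_zero (μ := volume)
    (measure_mono_null ?_ (volume_creases θ α β l t))
  rintro x ⟨hi, hj⟩
  have hi := interior_subset hi
  have hj := interior_subset hj
  rw [R.face_eq] at hi hj
  obtain ⟨w, hw, rfl⟩ := hi
  obtain ⟨w', hw', e⟩ := hj
  have := h.dev_inj (sA_mem ht) (cell_subset_cells j hw') (cell_subset_cells i hw) e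
  subst this
  exact R.mem_creases t (mem_seams_of_mem_cell hij hw hw')

theorem Closes.cover (h : G.Closes) (R : G.Realizes θ α β l) {t : ℝ} (ht : t ∈ Icc (0 : ℝ) 1) :
    ⋃ i, face θ α β l t i = paper α β l := by
  simp only [R.face_eq]
  rw [← image_iUnion, R.paper_eq]
  exact h.image_dev ht

/-- In the initial state the two faces are flat. -/
theorem Closes.motion_start (h : G.Closes) (hκ : G.IsSchedule κ) {r s s' : ℝ}
    (hr : r ∈ Icc (0 : ℝ) 1) (hs : 0 ≤ s) (hs' : 0 ≤ s') (hss : s = 0 ∨ s' = 0) :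
    G.motion κ 0 (r • G.q2v + s • u2 + s' • G.v2) = r • G.q3v G.H + s • u3 + s' • G.v3 := by
  have h0 : (0 : ℝ) ∈ Icc (0 : ℝ) 1 := by simp
  have hx : r • G.q2v + s • u2 + s' • G.v2 ∈ G.sheet := by
    rcases hss with rfl | rfl
    · exact ⟨r, hr, s', hs', .inr (by module)⟩
    · exact ⟨r, hr, s, hs, .inl (by module)⟩
  obtain ⟨hw, e⟩ := h.coef_mem h0 hx
  rw [motion]
  set w := G.coef 0 (r • G.q2v + s • u2 + s' • G.v2)
  have n := (cells_bounds hw).1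
  have hSB := G.SB_pos
  have hLA := G.LA_pos
  have hLB := G.LB_pos
  have hd := G.q_det_v
  have e0 := congrArg (fun x : E2 => x 0) e
  have e1 := congrArg (fun x : E2 => x 1) e
  simp only [dev, ev_dev_zero, ev_dev_one, zero_mul, add_zero] at e0 e1
  simp only [q2v, u2, v2, PiLp.add_apply, PiLp.smul_apply, smul_eq_mul, Matrix.cons_val_zero,
    Matrix.cons_val_one, mul_one, mul_zero, add_zero, Matrix.cons_val_fin_one] at e0 e1
  -- Comparison of det(q, ·); at time 0 the vertex `a` lies on `oq` and contributes nothing. Both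
  -- sides are differences of two nonnegative terms of which one vanishes, so the terms agree one by
  -- one.
  have key : (w 1 * G.SB + w 4) * G.LB - w 3 * G.LA = s' * G.LB - s * G.LA := by
    linear_combination G.pA * e1 - G.LA * e0 + (s' - w 1 * G.SB - w 4) * hd
  have n1 := mul_nonneg (n 1) hSB.le
  have hsplit : w 1 * G.SB + w 4 = s' ∧ w 3 = s := by
    have hz : w 3 = 0 ∨ (w 1 = 0 ∧ w 4 = 0) := by
      rcases mem_cells.1 hw with (⟨n, c⟩ | ⟨n, c⟩) | (⟨n, c⟩ | ⟨n, c⟩) | (⟨n, c⟩ | ⟨n, c⟩)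
      · exact .inr ⟨c.1, c.2.2.1⟩
      · exact .inr ⟨c.1, c.2.1⟩
      · exact .inl c.2.2.1
      · exact .inl c.2.1
      · exact .inl c.2.1
      · exact .inl c.1
    have hprod : (w 1 * G.SB + w 4) = 0 ∨ w 3 = 0 := by
      rcases hz with hz | ⟨h1, h4⟩
      · exact .inr hz
      · exact .inl (by rw [h1, h4]; ring)
    have hy : 0 ≤ w 1 * G.SB + w 4 := add_nonneg n1 (n 4)
    have n3 := n 3
    generalize w 1 * G.SB + w 4 = y at *
    generalize w 3 = y' at *
    have d1 : 0 ≤ (y - s') * (y' - s) := by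
      have : (y - s') * G.LB = (y' - s) * G.LA := by linear_combination key
      have h2 : (y - s') * (y' - s) * G.LA = (y - s') ^ 2 * G.LB := by
        linear_combination (y - s') * (-this)
      refine nonneg_of_mul_nonneg_left (b := G.LA) ?_ hLA
      rw [h2]
      positivity
    have d2 : (y - s') * (y' - s) = -(y * s) - s' * y' := by
      rcases hprod with h1 | h1 <;> rcases hss with h2 | h2 <;> rw [h1, h2] <;> ring
    have z1 : y * s = 0 := by nlinarith [mul_nonneg hy hs, mul_nonneg hs' n3]
    have z2 : s' * y' = 0 := by nlinarith [mul_nonneg hy hs, mul_nonneg hs' n3]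
    have z3 : (y - s') * (y' - s) = 0 := by rw [d2, z1, z2]; ring
    rcases mul_eq_zero.1 z3 with z | z
    · have : (y' - s) * G.LA = 0 := by linear_combination G.LB * z - key
      exact ⟨by linarith, by linarith [(mul_eq_zero.1 this).resolve_right hLA.ne']⟩
    · have : (y - s') * G.LB = 0 := by linear_combination G.LA * z + key
      exact ⟨by linarith [(mul_eq_zero.1 this).resolve_right hLB.ne'], by linarith⟩
  obtain ⟨k4, k3⟩ := hsplit
  have kr : w 0 * G.κA + w 1 * G.κB + w 2 = r := by
    refine mul_right_cancel₀ hLA.ne' ?_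
    linear_combination e1 - G.sD * k4
  rw [hκ.zero h, fold, slide_zero, alt_zero, ev]
  have ea : G.a3 0 0 G.H = G.κA • G.q3v G.H := by
    ext i
    fin_cases i <;> simp [a3, q3v, xA, yA]
  have eb : G.b3 0 G.H = G.κB • G.q3v G.H + G.SB • G.v3 := by
    ext i
    fin_cases i
    · simp [b3, q3v, xB, yB, v3]
      linear_combination -ratio G.LB G.wB 0 * G.pA_eq
    · simp [b3, q3v, xB, yB, v3]
      linear_combination -ratio G.LB G.wB 0 * wA_eq (G := G)
    · simp [b3, q3v, v3]
  rw [ea, eb, ← kr, ← k4, ← k3]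
  module

end Corner

/-! ### Boundary conditions, bending direction and absence of crossings. -/

namespace Corner

variable {G : Corner} {θ α β l : ℝ} {κ : ℝ → ℝ}

theorem Closes.motion_bottom_A (h : G.Closes) {t : ℝ} (ht : t ∈ Icc (0 : ℝ) 1) {s : ℝ}
    (hs : 0 ≤ s) : G.motion κ t (s • u2) = s • u3 := by
  have := h.motion_dev (κ := κ) ht (w := ![0, 0, 0, s, 0]) (mem_cells.2 (.inl (.inl
    ⟨vec_nonneg le_rfl le_rfl le_rfl hs le_rfl, rfl, rfl, rfl, zero_le_one⟩)))
  simpa [dev_vec, fold_vec] using this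

theorem Closes.motion_bottom_B (h : G.Closes) {t : ℝ} (ht : t ∈ Icc (0 : ℝ) 1) {s : ℝ}
    (hs : 0 ≤ s) : G.motion κ t (s • G.v2) = s • G.v3 := by
  have := h.motion_dev (κ := κ) ht (w := ![0, 0, 0, 0, s]) (mem_cells.2 (.inr (.inl (.inl
    ⟨vec_nonneg le_rfl le_rfl le_rfl le_rfl hs, rfl, rfl, rfl, zero_le_one⟩))))
  simpa [dev_vec, fold_vec] using this

theorem Closes.motion_top_A (h : G.Closes) {t : ℝ} (ht : t ∈ Icc (0 : ℝ) 1) {s : ℝ}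
    (hs : 0 ≤ s) : G.motion κ t (G.q2v + s • u2) = G.q3v (G.alt (κ t)) + s • u3 := by
  have := h.motion_dev (κ := κ) ht (w := ![0, 0, 1, s, 0]) (mem_cells.2 (.inl (.inr
    ⟨vec_nonneg le_rfl le_rfl zero_le_one hs le_rfl, rfl, rfl, zero_add 1⟩)))
  simpa [dev_vec, fold_vec] using this

theorem Closes.motion_top_B (h : G.Closes) {t : ℝ} (ht : t ∈ Icc (0 : ℝ) 1) {s : ℝ}
    (hs : 0 ≤ s) : G.motion κ t (G.q2v + s • G.v2) = G.q3v (G.alt (κ t)) + s • G.v3 := by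
  have := h.motion_dev (κ := κ) ht (w := ![0, 0, 1, 0, s]) (mem_cells.2 (.inr (.inl (.inr
    ⟨vec_nonneg le_rfl le_rfl zero_le_one le_rfl hs, rfl, rfl, zero_add 1⟩))))
  simpa [dev_vec, fold_vec] using this

theorem Closes.motion_a (h : G.Closes) (hκ : G.IsSchedule κ) {t : ℝ} (ht : t ∈ Icc (0 : ℝ) 1) :
    G.motion κ t (G.a2 (t * G.SA)) = G.a3 (t * G.SA) (κ t) (G.alt (κ t)) := by
  have := h.motion_dev (κ := κ) ht (w := ![1, 0, 0, 0, 0]) (mem_cells.2 (.inl (.inl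
    ⟨vec_nonneg zero_le_one le_rfl le_rfl le_rfl le_rfl, rfl, rfl, rfl, le_rfl⟩)))
  rw [← hκ.slide_eq t ht]
  simpa [dev_vec, fold_vec, hκ.slide_eq t ht] using this

theorem Closes.motion_b (h : G.Closes) {t : ℝ} (ht : t ∈ Icc (0 : ℝ) 1) :
    G.motion κ t G.b2 = G.b3 (κ t) (G.alt (κ t)) := by
  have := h.motion_dev (κ := κ) ht (w := ![0, 1, 0, 0, 0]) (mem_cells.2 (.inr (.inl (.inl
    ⟨vec_nonneg le_rfl zero_le_one le_rfl le_rfl le_rfl, rfl, rfl, rfl, le_rfl⟩))))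
  simpa [dev_vec, fold_vec] using this

theorem triple_eq (u v w : E3) : triple u v w = u 0 * (v 1 * w 2 - v 2 * w 1) -
    u 1 * (v 0 * w 2 - v 2 * w 0) + u 2 * (v 0 * w 1 - v 1 * w 0) := by
  simp [triple, Matrix.det_fin_three]
  ring

theorem triple_A (z : ℝ) : triple u3 (G.q3v z) G.v3 = -(z * G.s) := by
  simp [triple_eq, u3, q3v, v3]

theorem triple_B (z : ℝ) : triple G.v3 (G.q3v z) u3 = z * G.s := by
  simp [triple_eq, u3, q3v, v3]
  ring

theorem triple_a (σ k z : ℝ) : triple u3 (G.q3v z) (G.a3 σ k z) = z * k / 2 := by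
  simp [triple_eq, u3, q3v, a3, yA]
  ring

theorem triple_b (k z : ℝ) : triple G.v3 (G.q3v z) (G.b3 k z) = -(z * k / 2) := by
  simp [triple_eq, v3, q3v, b3, yB]
  linear_combination (-ratio G.LB G.wB k * z) * G.pA_mul_s +
    z * (ratio G.LB G.wB k * G.wB - k / 2) * G.sq_add_sq

theorem triple_vert_A : triple u3 vert G.v3 = -G.s := by
  simp [triple_eq, u3, vert, v3]

theorem triple_vert_B : triple G.v3 vert u3 = G.s := by
  simp [triple_eq, u3, vert, v3]

theorem triple_vert_a (σ k z : ℝ) : triple u3 vert (G.a3 σ k z) = -G.yA k := by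
  simp [triple_eq, u3, vert, a3]

theorem triple_vert_b (k z : ℝ) : triple G.v3 vert (G.b3 k z) = G.yB k := by
  simp [triple_eq, v3, vert, b3]
  linear_combination G.yB k * G.sq_add_sq

/-- In the flat state the crease has the coordinate (w - L)/2 across the bottom edge, and w < L. -/
theorem flat_crease_neg {H L w : ℝ} (hL : 0 < L) (hH : 0 < H) (h : L ^ 2 = w ^ 2 + H ^ 2) :
    ratio L w H * w - H / 2 < 0 := by
  have h1 : w < L := (abs_lt.1 (abs_lt_of_sq_lt_sq (by nlinarith) hL.le)).2
  have e : ratio L w H * w - H / 2 = (w - L) / 2 := by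
    have : L + H ≠ 0 := by positivity
    rw [ratio]
    field_simp
    linear_combination h
  rw [e]
  linarith

theorem Closes.isOutOutMotion (h : G.Closes) (R : G.Realizes θ α β l) (hκ : G.IsSchedule κ) :
    IsOutOutMotion θ α β l (fun t => G.alt (κ t)) (G.motion κ) where
  height_continuous := G.alt_continuous.comp_continuousOn hκ.cont
  height_strictAnti t ht t' ht' hlt :=
    alt_strictAntiOn (hκ.mem t ht) (hκ.mem t' ht') (hκ.mono ht ht' hlt)
  height_start := by
    rw [hκ.zero h, alt_zero, R.height_eq]
  height_end := by
    rw [hκ.one h, alt_H]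
  continuous := by
    rw [R.paper_eq]
    exact h.motion_continuousOn hκ
  start_A r hr s hs := by
    rw [R.q2_eq, R.eA_eq, R.uA_eq, R.q3_eq, R.height_eq]
    simpa using h.motion_start hκ hr hs le_rfl (.inr rfl)
  start_B r hr s hs := by
    rw [R.q2_eq, R.eB_eq, R.uB_eq, R.q3_eq, R.height_eq]
    simpa using h.motion_start hκ hr le_rfl hs (.inl rfl)
  bottom_A t ht s hs := by
    rw [R.eA_eq, R.uA_eq]
    exact h.motion_bottom_A ht hs
  bottom_B t ht s hs := by
    rw [R.eB_eq, R.uB_eq]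
    exact h.motion_bottom_B ht hs
  top_A t ht s hs := by
    rw [R.q2_eq, R.eA_eq, R.uA_eq, R.q3_eq]
    exact h.motion_top_A ht hs
  top_B t ht s hs := by
    rw [R.q2_eq, R.eB_eq, R.uB_eq, R.q3_eq]
    exact h.motion_top_B ht hs
  cover t ht := h.cover R ht
  subdivision t ht i j hij := h.subdivision R ht hij
  rigid t ht i x hx y hy := by
    rw [R.face_eq] at hx hy
    exact h.dist_motion hκ ht hx hy
  out_A t ht := by
    have ht' := Ioo_subset_Icc_self ht
    have h1 := alt_pos (hκ.mem t ht').1 (hκ.lt h ⟨ht.1.le, ht.2⟩)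
    have h2 := hκ.pos h ⟨ht.1, ht.2.le⟩
    rw [R.q3_eq, R.uA_eq, R.uB_eq, R.pA'_eq, h.motion_a hκ ht', triple_A, triple_a]
    exact mul_neg_of_neg_of_pos (neg_neg_of_pos (mul_pos h1 G.s_pos)) (by positivity)
  out_B t ht := by
    have ht' := Ioo_subset_Icc_self ht
    have h1 := alt_pos (hκ.mem t ht').1 (hκ.lt h ⟨ht.1.le, ht.2⟩)
    have h2 := hκ.pos h ⟨ht.1, ht.2.le⟩
    rw [R.q3_eq, R.uA_eq, R.uB_eq, R.pB_eq, h.motion_b ht', triple_B, triple_b]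
    exact mul_neg_of_pos_of_neg (mul_pos h1 G.s_pos) (neg_neg_of_pos (by positivity))
  out_flat_A := by
    have h1 := flat_crease_neg G.LA_pos G.H_pos G.LA_sq
    rw [R.uA_eq, R.uB_eq, R.pA'_eq, h.motion_a hκ (by simp), triple_vert_A, triple_vert_a, hκ.one h]
    exact mul_neg_of_neg_of_pos (neg_neg_of_pos G.s_pos) (neg_pos.2 h1)
  out_flat_B := by
    have h1 := flat_crease_neg G.LB_pos G.H_pos G.LB_sq
    rw [R.uA_eq, R.uB_eq, R.pB_eq, h.motion_b (by simp), triple_vert_B, triple_vert_b, hκ.one h]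
    exact mul_neg_of_pos_of_neg G.s_pos h1

/-- Relative height 0 or 1 forces the coefficients of `a` and `b` to vanish and that of `q` to be 0
or 1, which puts the point on a bottom or top edge. -/
theorem Closes.motion_two_mem_Ioo (h : G.Closes) (R : G.Realizes θ α β l) (hκ : G.IsSchedule κ)
    {t : ℝ} (ht : t ∈ Ico (0 : ℝ) 1) {x : E2} (hx : x ∈ paper α β l \ horizontalEdges α β l) :
    G.motion κ t x 2 ∈ Ioo 0 (G.alt (κ t)) := by
  have ht' := Ico_subset_Icc_self ht
  have hk := (hκ.mem t ht').1
  have hpos := alt_pos hk (hκ.lt h ht)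
  obtain ⟨hx1, hx2⟩ := hx
  rw [R.paper_eq] at hx1
  obtain ⟨hw, e⟩ := h.coef_mem ht' hx1
  have hrel := relHeight_mem (G := G) hk hw
  obtain ⟨n, -, h34⟩ := cells_bounds hw
  have hedge : ∀ c : ℝ, (c = 0 ∨ c = 1) → G.coef t x 0 = 0 → G.coef t x 1 = 0 →
      G.coef t x 2 = c → x ∈ horizontalEdges α β l := by
    intro c hc h0 h1 h2
    have hx : x = c • G.q2v + G.coef t x 3 • u2 + G.coef t x 4 • G.v2 := by
      refine e.symm.trans ?_
      rw [dev, ev, h0, h1, h2]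
      module
    rw [horizontalEdges, R.q2_eq, R.eA_eq, R.eB_eq]
    rcases hc with rfl | rfl <;> rcases h34 with h3 | h3 <;> rw [h3] at hx
    · exact .inl (.inr (mem_halfStrip_self.2 ⟨_, n 4, hx.trans (by module)⟩))
    · exact .inl (.inl (mem_halfStrip_self.2 ⟨_, n 3, hx.trans (by module)⟩))
    · exact .inr (.inr (mem_halfStrip_self.2 ⟨_, n 4, hx.trans (by module)⟩))
    · exact .inr (.inl (mem_halfStrip_self.2 ⟨_, n 3, hx.trans (by module)⟩))
  have h0 : G.relHeight (κ t) (G.coef t x) ≠ 0 := fun h0 => by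
    obtain ⟨e0, e1, e2⟩ := relHeight_eq_zero hk hw h0
    exact hx2 (hedge 0 (.inl rfl) e0 e1 e2)
  have h1 : G.relHeight (κ t) (G.coef t x) ≠ 1 := fun h0 => by
    obtain ⟨e0, e1, e2⟩ := relHeight_eq_one hk hw h0
    exact hx2 (hedge 1 (.inr rfl) e0 e1 e2)
  rw [motion, fold_two]
  exact ⟨mul_pos hpos (hrel.1.lt_of_ne' h0), mul_lt_of_lt_one_right hpos (hrel.2.lt_of_ne h1)⟩

theorem Closes.avoidsCrossings (h : G.Closes) (R : G.Realizes θ α β l) (hκ : G.IsSchedule κ) :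
    AvoidsCrossings (paper α β l) (creases θ α β l 1) (G.motion κ) := by
  have hseam : ∀ {x}, x ∈ interior G.sheet → x ∉ creases θ α β l 1 → G.coef 1 x ∉ seams := by
    intro x hx hn hs
    have := R.mem_creases 1 hs
    rw [(h.coef_mem (t := 1) (by simp) (interior_subset hx)).2] at this
    exact hn this
  rw [R.paper_eq]
  exact ⟨fun t ht => h.motion_injOn hκ ht, fun x hx y hy hne hxy =>
    h.xor_liesAbove hκ hx.1 hy.1 (hseam hx.1 hx.2) (hseam hy.1 hy.2) hne hxy⟩

end Corner

/-! ### Consequences of length preservation. -/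

theorem intrinsicDist_congr {P : Set E2} {g g' : E2 → E3} (h : PreservesLengths P g)
    (h' : PreservesLengths P g') (x y : E2) : intrinsicDist P g x y = intrinsicDist P g' x y := by
  unfold intrinsicDist
  refine iInf_congr fun γ => iInf_congr fun hγ => iInf_congr fun hP => ?_
  rw [h γ hγ hP, h' γ hγ hP]

/-- A length preserving map fixing the origin does not move points further from the origin than
they are. -/
theorem norm_le_of_preservesLengths {P K : Set E2} {g : E2 → E3} (hg : PreservesLengths P g)
    (h0 : g 0 = 0) (hK : Convex ℝ K) (hK0 : (0 : E2) ∈ K) (hKP : K ⊆ P) {x : E2} (hx : x ∈ K) :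
    ‖g x‖ ≤ ‖x‖ := by
  have hmap : MapsTo (fun s : ℝ => s • x) (Icc 0 1) P := fun s hs =>
    hKP (hK.smul_mem_of_zero_mem hK0 hx hs)
  -- The radial segment stays in `K`, and its image joins 0 to `g x` with length at most ‖x‖.
  have h1 := hg (fun s => s • x) (by fun_prop) hmap
  have h2 : eVariationOn (fun s : ℝ => s • x) (Icc 0 1) ≤ ENNReal.ofReal ‖x‖ := by
    have hl : LipschitzOnWith ‖x‖₊ (fun s : ℝ => s • x) univ :=
      LipschitzOnWith.of_dist_le_mul fun s _ s' _ => by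
        rw [dist_eq_norm, ← sub_smul, norm_smul, dist_eq_norm, mul_comm]
        rfl
    have h3 := hl.comp_eVariationOn_le (g := id) (s := Icc (0 : ℝ) 1) (mapsTo_univ _ _)
    have h4 := (monotone_id.monotoneOn (Icc (0 : ℝ) 1)).eVariationOn_eq (left_mem_Icc.2 zero_le_one)
      (right_mem_Icc.2 zero_le_one)
    rw [inter_self] at h4
    refine h3.trans_eq ?_
    rw [h4]
    simp only [id, sub_zero, ENNReal.ofReal_one, mul_one, ofReal_norm]
    rfl
  have h3 := eVariationOn.edist_le (g ∘ fun s : ℝ => s • x) (s := Icc (0 : ℝ) 1)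
    (right_mem_Icc.2 zero_le_one) (left_mem_Icc.2 zero_le_one)
  rw [h1] at h3
  have h4 := h3.trans h2
  simp only [Function.comp_apply, one_smul, zero_smul, h0, edist_zero_right] at h4
  rw [← ofReal_norm] at h4
  exact (ENNReal.ofReal_le_ofReal_iff (norm_nonneg _)).1 h4

/-! ### The region of the gadget -/

namespace Corner

variable {G : Corner} {θ α β l : ℝ}

theorem Closes.gadgetRegion_subset (h : G.Closes) (R : G.Realizes θ α β l) :
    gadgetRegion θ α β l ⊆ paper α β l := by
  refine (convexHull_zero_triple_subset _ _ _).trans ?_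
  rintro x ⟨a, c, b, ha, hc, hb, hs, rfl⟩
  rw [R.paper_eq, R.pA_eq, R.pB_eq, R.q2_eq]
  obtain ⟨r, hr, s, hs', e⟩ := (h.placed (right_mem_Icc.2 G.SA_pos.le)).mem_corner ha hb hc
    (by linarith)
  rw [add_right_comm]
  exact ⟨r, hr, s, hs', e⟩

theorem Realizes.segment_cA_subset (R : G.Realizes θ α β l) :
    segment ℝ (cA θ α β l) (OutOut.pA θ α β l) ⊆ gadgetRegion θ α β l := by
  have hc := convex_convexHull ℝ ({0, OutOut.pA θ α β l, q2 α l, OutOut.pB θ α β l} : Set E2)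
  have hq : q2 α l ∈ gadgetRegion θ α β l := subset_convexHull ℝ _ (by simp)
  have h0 : (0 : E2) ∈ gadgetRegion θ α β l := subset_convexHull ℝ _ (by simp)
  refine hc.segment_subset ?_ (subset_convexHull ℝ _ (by simp))
  rw [R.cA_eq, ← R.q2_eq]
  exact hc.smul_mem_of_zero_mem h0 hq ⟨(G.κA_mem).1.le, (G.κA_mem).2.le⟩

theorem Realizes.pA'_mem (R : G.Realizes θ α β l) {t : ℝ} (ht : t ∈ Icc (0 : ℝ) 1) :
    pA' θ α β l t ∈ gadgetRegion θ α β l := by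
  refine R.segment_cA_subset ?_
  rw [segment_eq_image_lineMap]
  exact mem_image_of_mem _ ht

/-- The creases other than the spanning face creases lie in the gadget. -/
theorem Realizes.mem_of_mem_creases (R : G.Realizes θ α β l) {t : ℝ} (ht : t ∈ Icc (0 : ℝ) 1)
    {x : E2} (hx : x ∈ creases θ α β l t) : x ∈ gadgetRegion θ α β l ∨
      x ∈ halfStrip (pA' θ α β l t) (pA' θ α β l t) eA ∨
      x ∈ halfStrip (OutOut.pB θ α β l) (OutOut.pB θ α β l) (eB α β) := by
  have hc := convex_convexHull ℝ ({0, OutOut.pA θ α β l, q2 α l, OutOut.pB θ α β l} : Set E2)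
  have hq : q2 α l ∈ gadgetRegion θ α β l := subset_convexHull ℝ _ (by simp)
  have h0 : (0 : E2) ∈ gadgetRegion θ α β l := subset_convexHull ℝ _ (by simp)
  have hB : OutOut.pB θ α β l ∈ gadgetRegion θ α β l := subset_convexHull ℝ _ (by simp)
  have hA := R.pA'_mem ht
  rcases hx with (((((hx | hx) | hx) | hx) | hx) | hx) | hx
  · exact .inl (hc.segment_subset hA h0 hx)
  · exact .inl (hc.segment_subset hA hq hx)
  · exact .inl (hc.segment_subset hA hB hx)
  · exact .inl (hc.segment_subset hB h0 hx)
  · exact .inl (hc.segment_subset hB hq hx)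
  · exact .inr (.inl hx)
  · exact .inr (.inr hx)

theorem Realizes.creases_subset (R : G.Realizes θ α β l) {t : ℝ} (ht : t ∈ Icc (0 : ℝ) 1) :
    creases θ α β l t ⊆ gadgetRegion θ α β l ∪ spanningFaceCreases θ α β l := by
  intro x hx
  rcases R.mem_of_mem_creases ht hx with hx | hx | hx
  · exact .inl hx
  · obtain ⟨s, hs, rfl⟩ := mem_halfStrip_self.1 hx
    refine .inr (.inl (mem_halfStrip_self.2
      ⟨t * G.SA + s, add_nonneg (sA_mem ht).1 hs, ?_⟩))
    rw [R.pA'_eq, R.cA_eq, R.eA_eq, a2]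
    module
  · obtain ⟨s, hs, rfl⟩ := mem_halfStrip_self.1 hx
    refine .inr (.inr (mem_halfStrip_self.2 ⟨G.SB + s, add_nonneg G.SB_pos.le hs, ?_⟩))
    rw [R.pB_eq, R.cB_eq, R.eB_eq, b2]
    module

/-- A point of the spanning face crease of the `α` face beyond `p_α` is a crease point at all times,
and one before `p_α` lies on the segment from `c_α` to `p_α`. The crease starting at `p_β` never
moves. -/
theorem Realizes.movingRegion_subset (R : G.Realizes θ α β l) :
    movingRegion θ α β l ⊆ gadgetRegion θ α β l := by
  rintro x ⟨⟨t, ht, hx⟩, hn⟩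
  rcases R.mem_of_mem_creases ht hx with hx | hx | hx
  · exact hx
  · obtain ⟨s, hs, rfl⟩ := mem_halfStrip_self.1 hx
    rcases le_or_gt G.SA (t * G.SA + s) with hle | hlt
    · refine absurd (fun t' ht' => ?_) hn
      refine .inl (.inr (mem_halfStrip_self.2 ⟨t * G.SA + s - t' * G.SA,
        by linarith [(sA_mem (G := G) ht').2], ?_⟩))
      rw [R.pA'_eq, R.pA'_eq, R.eA_eq, a2, a2]
      module
    · refine R.segment_cA_subset ?_
      have h0 := add_nonneg (sA_mem (G := G) ht).1 hs
      rw [segment_eq_image_lineMap]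
      refine ⟨(t * G.SA + s) / G.SA,
        ⟨div_nonneg h0 G.SA_pos.le, (div_le_one G.SA_pos).2 hlt.le⟩, ?_⟩
      change pA' θ α β l _ = _
      rw [R.pA'_eq, R.pA'_eq, R.eA_eq, div_mul_cancel₀ _ G.SA_pos.ne', a2, a2]
      module
  · exact absurd (fun t' _ => .inr hx) hn

theorem Realizes.volume_movingRegion_pos (R : G.Realizes θ α β l) :
    0 < volume (movingRegion θ α β l) := by
  have hS := G.SA_pos
  have hL := G.LA_pos
  have hκ := (G.κA_mem).1
  have hκL := mul_pos hκ hL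
  -- The open triangle `o c_α p_α`, which the crease from `o` to the moving vertex sweeps out.
  set U : Set E2 := {x | 0 < x 1 ∧ x 1 < G.κA * G.LA ∧ x 1 * (G.κA * G.pA) < x 0 * (G.κA * G.LA) ∧
    x 0 * (G.κA * G.LA) < x 1 * (G.κA * G.pA + G.SA)} with hU
  have hopen : IsOpen U := by
    simp only [hU, ofPred_and]
    exact (isOpen_lt (by fun_prop) (by fun_prop)).inter ((isOpen_lt (by fun_prop)
      (by fun_prop)).inter ((isOpen_lt (by fun_prop) (by fun_prop)).inter
      (isOpen_lt (by fun_prop) (by fun_prop))))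
  have hne : U.Nonempty := by
    refine ⟨!₂[(G.κA * G.pA + G.SA / 2) / 2, G.κA * G.LA / 2], ?_⟩
    have := mul_pos hκL hS
    refine ⟨?_, ?_, ?_, ?_⟩ <;> simp only [Matrix.cons_val_zero, Matrix.cons_val_one,
      Matrix.cons_val_fin_one] <;> linarith
  have hsub : U \ creases θ α β l 0 ⊆ movingRegion θ α β l := by
    rintro x ⟨⟨h1, h2, h3, h4⟩, hx⟩
    -- The ray from `o` through `x` meets the spanning face crease at abscissa `x 0 * (κA * LA) / x
    -- 1`. Its distance from `c_α`, divided by `SA`, is the time.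
    refine ⟨⟨(x 0 * (G.κA * G.LA) / x 1 - G.κA * G.pA) / G.SA, ⟨div_nonneg ?_ hS.le,
      (div_le_one hS).2 ?_⟩, ?_⟩, fun hn => hx (hn 0 (by simp))⟩
    · rw [sub_nonneg, le_div_iff₀ h1]
      linarith
    · rw [sub_le_iff_le_add, div_le_iff₀ h1]
      linarith
    · refine .inl (.inl (.inl (.inl (.inl (.inl ⟨x 1 / (G.κA * G.LA), 1 - x 1 / (G.κA * G.LA),
        by positivity, sub_nonneg.2 ((div_le_one hκL).2 h2.le), by ring, ?_⟩)))))
      rw [R.pA'_eq, div_mul_cancel₀ _ hS.ne', smul_zero, add_zero]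
      ext i
      fin_cases i
      · simp [a2, q2v, u2]
        have := h1.ne'
        field_simp
        ring
      · simp [a2, q2v, u2]
        field_simp
  calc 0 < volume U := hopen.measure_pos _ hne
    _ = volume (U \ creases θ α β l 0) := (measure_sdiff_null (volume_creases θ α β l 0)).symm
    _ ≤ _ := measure_mono hsub

end Corner

/-! ### Scaling -/

section Scaling

open scoped Pointwise

variable (θ α β l t : ℝ)

theorem q2_eq_smul : q2 α l = l • q2 α 1 := by simp [q2]

theorem creaseDist_eq_mul : creaseDist θ α β l = l * creaseDist θ α β 1 := by
  simp only [creaseDist]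
  ring

theorem pA'_eq_smul : pA' θ α β l t = l • pA' θ α β 1 t := by
  simp only [pA', cA, pA, creaseDist_eq_mul θ α β l, AffineMap.lineMap_apply_module]
  module

theorem pA_eq_smul : pA θ α β l = l • pA θ α β 1 := by
  simp only [pA, creaseDist_eq_mul θ α β l]
  module

theorem pB_eq_smul : pB θ α β l = l • pB θ α β 1 := by
  simp only [pB, creaseDist_eq_mul θ β α l]
  module

theorem height_eq_mul : height θ α β l = l * height θ α β 1 := by simp [height]

theorem norm_le_of_mem_gadgetRegion (hl : 0 ≤ l) {x : E2} (hx : x ∈ gadgetRegion θ α β l) :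
    ‖x‖ ≤ l * (‖pA θ α β 1‖ + ‖q2 α 1‖ + ‖pB θ α β 1‖) := by
  obtain ⟨a, b, c, ha, hb, hc, hs, rfl⟩ := convexHull_zero_triple_subset _ _ _ hx
  rw [q2_eq_smul, pA_eq_smul, pB_eq_smul]
  have key : ∀ {r : ℝ} (y : E2), 0 ≤ r → r ≤ 1 → ‖r • l • y‖ ≤ l * ‖y‖ := fun y h0 h1 => by
    rw [norm_smul, norm_smul, Real.norm_of_nonneg h0, Real.norm_of_nonneg hl]
    exact mul_le_of_le_one_left (by positivity) h1
  refine (norm_add₃_le).trans ?_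
  have h1 := key (pA θ α β 1) ha (by linarith)
  have h2 := key (q2 α 1) hb (by linarith)
  have h3 := key (pB θ α β 1) hc (by linarith)
  linarith

variable {l}

theorem smul_segment_eq {r : ℝ} (x y : E2) : r • segment ℝ x y = segment ℝ (r • x) (r • y) :=
  image_segment ℝ (LinearMap.lsmul ℝ E2 r).toAffineMap x y

theorem smul_ray_eq (hl : 0 < l) (a e : E2) :
    l • halfStrip a a e = halfStrip (l • a) (l • a) e := by
  ext x
  simp only [mem_smul_set, mem_halfStrip_self]
  constructor
  · rintro ⟨_, ⟨s, hs, rfl⟩, rfl⟩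
    exact ⟨l * s, by positivity, by module⟩
  · rintro ⟨s, hs, rfl⟩
    refine ⟨_, ⟨s / l, by positivity, rfl⟩, ?_⟩
    rw [smul_add, smul_smul, mul_div_cancel₀ _ hl.ne']

theorem creases_eq_smul (hl : 0 < l) : creases θ α β l t = l • creases θ α β 1 t := by
  simp only [creases, smul_set_union, smul_segment_eq, smul_ray_eq hl, smul_zero,
    ← pA'_eq_smul, ← pB_eq_smul, ← q2_eq_smul]

theorem movingRegion_eq_smul (hl : 0 < l) : movingRegion θ α β l = l • movingRegion θ α β 1 := by
  ext x
  simp only [mem_smul_set_iff_inv_smul_mem₀ hl.ne', movingRegion, mem_ofPred_eq,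
    creases_eq_smul θ α β _ hl]

theorem volume_movingRegion (hl : 0 < l) :
    volume (movingRegion θ α β l) = ENNReal.ofReal (l ^ 2) * volume (movingRegion θ α β 1) := by
  rw [movingRegion_eq_smul θ α β hl, Measure.addHaar_smul, finrank_euclideanSpace_fin,
    abs_of_nonneg (by positivity)]

end Scaling

/-- Only the sizes are scaled, not the motion: each `l` gets its own corner. Lengths and height are
proportional to `l` and the area to its square, so the case `l = 1` fixes both constants. -/
theorem gadget_of_realizes {θ α β : ℝ}
    (h : ∀ l : ℝ, 0 < l → ∃ G : Corner, G.Closes ∧ G.Realizes θ α β l) :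
    ∃ R C : ℝ, 0 < R ∧ 0 < C ∧ ∀ l : ℝ, 0 < l →
      0 < height θ α β l ∧
      ∃ (z : ℝ → ℝ) (f : ℝ → E2 → E3), IsOutOutMotion θ α β l z f ∧
        gadgetRegion θ α β l ⊆ paper α β l ∧
        (∀ t ∈ Icc (0 : ℝ) 1,
          creases θ α β l t ⊆ gadgetRegion θ α β l ∪ spanningFaceCreases θ α β l) ∧
        gadgetRegion θ α β l ⊆ Metric.closedBall 0 (R * height θ α β l) ∧
        (∀ t ∈ Icc (0 : ℝ) 1,
          f t '' gadgetRegion θ α β l ⊆ Metric.closedBall 0 (R * height θ α β l)) ∧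
        (∀ t ∈ Icc (0 : ℝ) 1, ∀ x ∈ paper α β l, f t x 2 ∈ Icc 0 (z t)) ∧
        (∀ t ∈ Ico (0 : ℝ) 1, ∀ x ∈ paper α β l \ horizontalEdges α β l,
          f t x 2 ∈ Ioo 0 (z t)) ∧
        (∀ t ∈ Icc (0 : ℝ) 1, PreservesLengths (paper α β l) (f t)) ∧
        (∀ t ∈ Icc (0 : ℝ) 1, ∀ x ∈ paper α β l, ∀ y ∈ paper α β l,
          intrinsicDist (paper α β l) (f t) x y = intrinsicDist (paper α β l) (f 0) x y) ∧
        AvoidsCrossings (paper α β l) (creases θ α β l 1) f ∧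
        movingRegion θ α β l ⊆ gadgetRegion θ α β l ∧
        volume (movingRegion θ α β l) = ENNReal.ofReal (C * height θ α β l ^ 2) := by
  obtain ⟨G₁, -, R₁⟩ := h 1 one_pos
  set ρ := ‖pA θ α β 1‖ + ‖q2 α 1‖ + ‖pB θ α β 1‖ with hρ
  set η := height θ α β 1 with hη
  have hη0 : 0 < η := by
    rw [hη, R₁.height_eq]
    exact G₁.H_pos
  have hρ0 : 0 < ρ := by
    have : 0 < ‖q2 α 1‖ := by
      rw [norm_pos_iff, R₁.q2_eq]
      intro h0
      have := congrArg (fun x : E2 => x 1) h0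
      simp only [Corner.q2v, Matrix.cons_val_one, Matrix.cons_val_fin_one, PiLp.zero_apply] at this
      exact G₁.LA_pos.ne' this
    positivity
  have hball : ∀ l : ℝ, ρ / η * height θ α β l = l * ρ := fun l => by
    rw [height_eq_mul, ← hη]
    field_simp
  set V := (volume (movingRegion θ α β 1)).toReal with hV
  have hfin : volume (movingRegion θ α β 1) ≠ ⊤ := by
    refine ne_top_of_le_ne_top (b := volume (Metric.closedBall (0 : E2) ρ))
      measure_closedBall_lt_top.ne (measure_mono fun x hx => ?_)
    rw [mem_closedBall_zero_iff]
    simpa using norm_le_of_mem_gadgetRegion θ α β 1 zero_le_one (R₁.movingRegion_subset hx)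
  have hV0 : 0 < V := ENNReal.toReal_pos R₁.volume_movingRegion_pos.ne' hfin
  -- Here `ρ` bounds the gadget, `V` is the moving area and `η` the height, all for `l = 1`.
  refine ⟨ρ / η, V / η ^ 2, by positivity, by positivity, fun l hl => ?_⟩
  obtain ⟨G, hG, R⟩ := h l hl
  obtain ⟨κ, hκ⟩ := hG.exists_schedule
  have hlen : ∀ t ∈ Icc (0 : ℝ) 1, PreservesLengths (paper α β l) (G.motion κ t) := fun t ht => by
    rw [R.paper_eq]
    exact hG.preservesLengths hκ ht
  refine ⟨?_, fun t => G.alt (κ t), G.motion κ, hG.isOutOutMotion R hκ, hG.gadgetRegion_subset R,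
    fun t ht => R.creases_subset ht, fun x hx => ?_, fun t ht => ?_, fun t ht x hx => ?_,
    fun t ht x hx => hG.motion_two_mem_Ioo R hκ ht hx, hlen, fun t ht x _ y _ =>
    intrinsicDist_congr (hlen t ht) (hlen 0 (by simp)) x y, hG.avoidsCrossings R hκ,
    R.movingRegion_subset, ?_⟩
  · rw [R.height_eq]
    exact G.H_pos
  · rw [hball, mem_closedBall_zero_iff]
    exact norm_le_of_mem_gadgetRegion θ α β l hl.le hx
  · rintro _ ⟨x, hx, rfl⟩
    rw [hball, mem_closedBall_zero_iff]
    have h0 : G.motion κ t 0 = 0 := by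
      simpa using hG.motion_bottom_A (κ := κ) ht (le_refl (0 : ℝ))
    exact (norm_le_of_preservesLengths (hlen t ht) h0 (convex_convexHull ℝ _)
      (subset_convexHull ℝ _ (by simp)) (hG.gadgetRegion_subset R) hx).trans
      (norm_le_of_mem_gadgetRegion θ α β l hl.le hx)
  · rw [R.paper_eq] at hx
    exact hG.motion_two_mem hκ ht hx
  · rw [volume_movingRegion θ α β hl, height_eq_mul, ← hη, ← ENNReal.ofReal_toReal hfin, ← hV,
      ← ENNReal.ofReal_mul (by positivity)]
    congr 1
    field_simp

/-! ### The corner with given angles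

In terms of `ω = cornerAngle θ α β` the angles are `α = a + ω`, `β = b + ω`, `θ = a + b - 2 ω`. -/

section Angles

variable (a b ω : ℝ)

/-- In the angles of the corner the left side is cos(α - θ) - cos β. The new variables make this and
the next two differences of cosines factor. -/
theorem sin_mul_sin_sub : Real.sin (a + ω) * Real.sin (a + b - 2 * ω) -
    (Real.cos (b + ω) - Real.cos (a + ω) * Real.cos (a + b - 2 * ω)) =
      2 * Real.sin (2 * ω) * Real.sin (b - ω) := by
  have h := Real.cos_sub_cos (a + ω - (a + b - 2 * ω)) (b + ω)
  rw [Real.cos_sub, show (a + ω - (a + b - 2 * ω) + (b + ω)) / 2 = 2 * ω by ring,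
    show (a + ω - (a + b - 2 * ω) - (b + ω)) / 2 = -(b - ω) by ring, Real.sin_neg] at h
  linear_combination h

theorem sin_mul_sin_add : Real.sin (a + ω) * Real.sin (a + b - 2 * ω) +
    (Real.cos (b + ω) - Real.cos (a + ω) * Real.cos (a + b - 2 * ω)) =
      2 * Real.sin (a + b) * Real.sin (a - ω) := by
  have h := Real.cos_sub_cos (b + ω) (a + ω + (a + b - 2 * ω))
  rw [Real.cos_add (a + ω) (a + b - 2 * ω),
    show (b + ω + (a + ω + (a + b - 2 * ω))) / 2 = a + b by ring,
    show (b + ω - (a + ω + (a + b - 2 * ω))) / 2 = -(a - ω) by ring, Real.sin_neg] at h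
  linear_combination h

theorem cos_sub_cos_add : Real.cos (a + b - 2 * ω) - Real.cos (a + ω + (b + ω)) =
    2 * Real.sin (a + b) * Real.sin (2 * ω) := by
  have h := Real.cos_sub_cos (a + b - 2 * ω) (a + ω + (b + ω))
  rw [show (a + b - 2 * ω + (a + ω + (b + ω))) / 2 = a + b by ring,
    show (a + b - 2 * ω - (a + ω + (b + ω))) / 2 = -(2 * ω) by ring, Real.sin_neg] at h
  linear_combination h

variable {a b ω}

/-- The range of the angles. -/
structure Admissible (a b ω : ℝ) : Prop where
  pos : 0 < ω
  lt_a : ω < a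
  lt_b : ω < b
  le_pi : a + b + 2 * ω ≤ Real.pi

theorem Admissible.symm (h : Admissible a b ω) : Admissible b a ω :=
  ⟨h.pos, h.lt_b, h.lt_a, by linarith [h.le_pi]⟩

namespace Admissible

variable (h : Admissible a b ω)
include h

theorem sin_pos {x : ℝ} (h0 : 0 < x) (h1 : x < a + b + 2 * ω) : 0 < Real.sin x :=
  Real.sin_pos_of_pos_of_lt_pi h0 (h1.trans_le h.le_pi)

theorem sin_ω : 0 < Real.sin ω := h.sin_pos h.pos (by linarith [h.pos, h.lt_a, h.lt_b])

theorem sin_two_ω : 0 < Real.sin (2 * ω) :=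
  h.sin_pos (by linarith [h.pos]) (by linarith [h.pos, h.lt_a, h.lt_b])

theorem sin_a : 0 < Real.sin a :=
  h.sin_pos (by linarith [h.pos, h.lt_a]) (by linarith [h.pos, h.lt_a, h.lt_b])

theorem sin_α : 0 < Real.sin (a + ω) :=
  h.sin_pos (by linarith [h.pos, h.lt_a]) (by linarith [h.pos, h.lt_a, h.lt_b])

theorem sin_θ : 0 < Real.sin (a + b - 2 * ω) :=
  h.sin_pos (by linarith [h.pos, h.lt_a, h.lt_b]) (by linarith [h.pos, h.lt_a, h.lt_b])

theorem sin_add : 0 < Real.sin (a + b) :=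
  h.sin_pos (by linarith [h.pos, h.lt_a, h.lt_b]) (by linarith [h.pos, h.lt_a, h.lt_b])

theorem sin_sub : 0 < Real.sin (a - ω) :=
  h.sin_pos (by linarith [h.lt_a]) (by linarith [h.pos, h.lt_a, h.lt_b])

end Admissible

/-- Distance of `q` from the bottom edge, in horizontal projection. -/
def across (a b ω l : ℝ) : ℝ :=
  l * ((Real.cos (b + ω) - Real.cos (a + ω) * Real.cos (a + b - 2 * ω)) / Real.sin (a + b - 2 * ω))

/-- Distance of the crease from the bottom edge. -/
def gap (a b ω l : ℝ) : ℝ := l * Real.sin (2 * ω) * Real.sin (b - ω) / Real.sin (a + b - 2 * ω)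

/-- Distance of the final crease vertex from the spanning edge, along the crease. -/
def reach (a b ω l : ℝ) : ℝ := gap a b ω l * Real.sin a / (Real.sin ω * Real.sin (a + ω))

variable {l : ℝ}

theorem Admissible.gap_pos (h : Admissible a b ω) (hl : 0 < l) : 0 < gap a b ω l :=
  div_pos (mul_pos (mul_pos hl h.sin_two_ω) h.symm.sin_sub) h.sin_θ

theorem Admissible.reach_pos (h : Admissible a b ω) (hl : 0 < l) : 0 < reach a b ω l :=
  div_pos (mul_pos (h.gap_pos hl) h.sin_a) (mul_pos h.sin_ω h.sin_α)

theorem Admissible.sub_across (h : Admissible a b ω) :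
    l * Real.sin (a + ω) - across a b ω l = 2 * gap a b ω l := by
  have hθ := h.sin_θ.ne'
  have := sin_mul_sin_sub a b ω
  rw [across, gap]
  generalize a + b - 2 * ω = T at *
  generalize Real.sin (2 * ω) = S at *
  field_simp
  linear_combination l * this

theorem Admissible.add_across (h : Admissible a b ω) : l * Real.sin (a + ω) + across a b ω l =
    2 * l * Real.sin (a + b) * Real.sin (a - ω) / Real.sin (a + b - 2 * ω) := by
  have hθ := h.sin_θ.ne'
  have := sin_mul_sin_add a b ω
  rw [across]
  generalize a + b - 2 * ω = T at *
  field_simp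
  linear_combination l * this

theorem Admissible.sq_sub_across (h : Admissible a b ω) (hl : 0 < l) :
    0 < (l * Real.sin (a + ω)) ^ 2 - across a b ω l ^ 2 := by
  rw [sq_sub_sq, h.sub_across, h.add_across]
  exact mul_pos (div_pos (mul_pos (mul_pos (by positivity) h.sin_add) h.sin_sub) h.sin_θ)
    (mul_pos two_pos (h.gap_pos hl))

theorem Admissible.height_eq (hl : 0 < l) : height (a + b - 2 * ω) (a + ω) (b + ω) l =
    √((l * Real.sin (a + ω)) ^ 2 - across a b ω l ^ 2) := by
  rw [height, ← Real.sqrt_sq hl.le, ← Real.sqrt_mul (sq_nonneg _), Real.sqrt_sq hl.le]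
  congr 1
  rw [across]
  linear_combination l ^ 2 * (-Real.sin_sq_add_cos_sq (a + ω))

theorem Admissible.height_sq (h : Admissible a b ω) (hl : 0 < l) :
    height (a + b - 2 * ω) (a + ω) (b + ω) l ^ 2 =
      (l * Real.sin (a + ω)) ^ 2 - across a b ω l ^ 2 := by
  rw [Admissible.height_eq hl, Real.sq_sqrt (h.sq_sub_across hl).le]

theorem Admissible.across_symm (h : Admissible a b ω) : across b a ω l =
    l * Real.cos (a + ω) * Real.sin (a + b - 2 * ω) -
      across a b ω l * Real.cos (a + b - 2 * ω) := by
  have hθ := h.sin_θ.ne'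
  rw [across, across, add_comm b a]
  generalize a + b - 2 * ω = T at *
  field_simp
  linear_combination (-l * Real.cos (a + ω)) * Real.sin_sq_add_cos_sq T

theorem Admissible.along_symm (h : Admissible a b ω) : l * Real.cos (b + ω) =
    l * Real.cos (a + ω) * Real.cos (a + b - 2 * ω) +
      across a b ω l * Real.sin (a + b - 2 * ω) := by
  have hθ := h.sin_θ.ne'
  rw [across]
  generalize a + b - 2 * ω = T at *
  field_simp
  ring

/-- The corner with given angles and length of the spanning edge. -/
def Admissible.corner (h : Admissible a b ω) (hl : 0 < l) : Corner where
  c := Real.cos (a + b - 2 * ω)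
  s := Real.sin (a + b - 2 * ω)
  pA := l * Real.cos (a + ω)
  pB := l * Real.cos (b + ω)
  wA := across a b ω l
  wB := across b a ω l
  LA := l * Real.sin (a + ω)
  LB := l * Real.sin (b + ω)
  H := height (a + b - 2 * ω) (a + ω) (b + ω) l
  SA := reach a b ω l
  SB := reach b a ω l
  s_pos := h.sin_θ
  sq_add_sq := Real.cos_sq_add_sin_sq _
  pB_eq := h.along_symm
  wB_eq := h.across_symm
  LA_pos := mul_pos hl h.sin_α
  LB_pos := mul_pos hl h.symm.sin_α
  H_pos := by
    rw [Admissible.height_eq hl]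
    exact Real.sqrt_pos.2 (h.sq_sub_across hl)
  LA_sq := by
    rw [h.height_sq hl]
    ring
  LB_sq := by
    have h1 := h.across_symm (l := l)
    have h2 := h.along_symm (l := l)
    have h3 := Real.sin_sq_add_cos_sq (a + ω)
    have h4 := Real.sin_sq_add_cos_sq (b + ω)
    have h5 := Real.sin_sq_add_cos_sq (a + b - 2 * ω)
    rw [h.height_sq hl]
    -- Both expressions for the squared height are l² minus the squared length of the horizontal
    -- projection of `q`, once along each bottom edge; the two frames differ by an orthogonal map.
    linear_combination l ^ 2 * h4 - l ^ 2 * h3 -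
      (l * Real.cos (b + ω) + (l * Real.cos (a + ω) * Real.cos (a + b - 2 * ω) +
        across a b ω l * Real.sin (a + b - 2 * ω))) * h2 -
      (across b a ω l + (l * Real.cos (a + ω) * Real.sin (a + b - 2 * ω) -
        across a b ω l * Real.cos (a + b - 2 * ω))) * h1 -
      ((l * Real.cos (a + ω)) ^ 2 + across a b ω l ^ 2) * h5
  SA_pos := h.reach_pos hl
  SB_pos := h.symm.reach_pos hl

section Computations

variable (h : Admissible a b ω) (hl : 0 < l)

theorem Admissible.corner_lsq : (h.corner hl).lsq = l ^ 2 := by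
  simp only [Corner.lsq, Admissible.corner]
  linear_combination l ^ 2 * Real.sin_sq_add_cos_sq (a + ω)

theorem Admissible.corner_cD : (h.corner hl).cD = Real.cos (a + ω + (b + ω)) := by
  rw [Corner.cD, h.corner_lsq hl, Real.cos_add]
  simp only [Admissible.corner]
  field_simp

theorem Admissible.corner_sD : (h.corner hl).sD = Real.sin (a + ω + (b + ω)) := by
  rw [Corner.sD, h.corner_lsq hl, Real.sin_add]
  simp only [Admissible.corner]
  field_simp
  ring

theorem Admissible.corner_mu :
    (h.corner hl).mu = 2 * Real.sin (a + b) * Real.sin (2 * ω) := by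
  have h1 := (h.corner hl).c_sub_mu
  rw [h.corner_cD hl] at h1
  change Real.cos (a + b - 2 * ω) - _ = _ at h1
  linear_combination cos_sub_cos_add a b ω - h1

theorem Admissible.dip_corner :
    Real.sin (a + b - 2 * ω) * dip (h.corner hl).H (h.corner hl).LA (h.corner hl).H =
      2 * gap a b ω l * Real.sin (a + b) * Real.sin (a - ω) / Real.sin (a + ω) := by
  have hθ := h.sin_θ.ne'
  have hα := h.sin_α.ne'
  have h1 : dip (h.corner hl).H (h.corner hl).LA (h.corner hl).H =
      (h.corner hl).H ^ 2 / (h.corner hl).LA / 2 := by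
    simp [dip]
  have h2 : (h.corner hl).H ^ 2 = 2 * l * Real.sin (a + b) * Real.sin (a - ω) /
      Real.sin (a + b - 2 * ω) * (2 * gap a b ω l) := by
    refine (h.height_sq hl).trans ?_
    rw [sq_sub_sq, h.sub_across, h.add_across]
  rw [h1, h2]
  simp only [Admissible.corner]
  generalize a + b - 2 * ω = T at *
  field_simp

theorem Admissible.dip_corner' :
    Real.sin (a + b - 2 * ω) * dip (h.corner hl).H (h.corner hl).LB (h.corner hl).H =
      2 * gap b a ω l * Real.sin (a + b) * Real.sin (b - ω) / Real.sin (b + ω) := by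
  have h1 := h.symm.dip_corner hl
  have h2 : (h.symm.corner hl).H = (h.corner hl).H := by
    have e1 := (h.symm.corner hl).LB_sq
    have e2 := (h.corner hl).LA_sq
    refine (sq_eq_sq₀ (h.symm.corner hl).H_pos.le (h.corner hl).H_pos.le).1 ?_
    change (l * Real.sin (a + ω)) ^ 2 = across a b ω l ^ 2 + _ at e1
    change (l * Real.sin (a + ω)) ^ 2 = across a b ω l ^ 2 + _ at e2
    linarith
  rw [h2, add_comm b a] at h1
  exact h1

theorem Admissible.den_corner : (h.corner hl).mu * (h.corner hl).SB - (h.corner hl).s *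
    dip (h.corner hl).H (h.corner hl).LB (h.corner hl).H =
      2 * gap b a ω l * Real.sin (a + b) := by
  have hβ := h.symm.sin_α.ne'
  have hω := h.sin_ω.ne'
  have h1 := h.dip_corner' hl
  change _ - Real.sin (a + b - 2 * ω) * _ = _
  rw [h1, h.corner_mu hl]
  change _ * reach b a ω l - _ = _
  have h2 : 2 * Real.cos ω * Real.sin b - Real.sin (b - ω) = Real.sin (b + ω) := by
    rw [Real.sin_sub, Real.sin_add]
    ring
  rw [reach, Real.sin_two_mul]
  field_simp
  linear_combination Real.sin (a + b) * gap b a ω l * h2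

theorem Admissible.closes : (h.corner hl).Closes where
  convex := by
    have h1 : 0 ≤ Real.sin (a + ω + (b + ω)) :=
      Real.sin_nonneg_of_nonneg_of_le_pi (by linarith [h.pos, h.lt_a, h.lt_b])
        (by linarith [h.le_pi])
    rw [Real.sin_add] at h1
    have h2 := mul_nonneg (sq_nonneg l) h1
    simp only [Admissible.corner]
    linarith
  den_pos := by
    rw [h.den_corner hl]
    exact mul_pos (mul_pos two_pos (h.symm.gap_pos hl)) h.sin_add
  slide_H := by
    have hden := h.den_corner hl
    have hpos : 0 < 2 * gap b a ω l * Real.sin (a + b) :=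
      mul_pos (mul_pos two_pos (h.symm.gap_pos hl)) h.sin_add
    rw [Corner.slide, hden, div_eq_iff hpos.ne']
    have hα := h.sin_α.ne'
    have hβ := h.symm.sin_α.ne'
    have hω := h.sin_ω.ne'
    have hθ := h.sin_θ.ne'
    have hM : (h.corner hl).M = 2 * Real.sin (a + b) * Real.sin (2 * ω) * l ^ 2 := by
      rw [← h.corner_mu hl, ← h.corner_lsq hl, Corner.mu,
        div_mul_cancel₀ _ (h.corner hl).lsq_pos.ne']
    have hH : (h.corner hl).H ^ 2 = 2 * l * Real.sin (a + b) * Real.sin (a - ω) /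
        Real.sin (a + b - 2 * ω) * (2 * gap a b ω l) := by
      refine (h.height_sq hl).trans ?_
      rw [sq_sub_sq, h.sub_across, h.add_across]
    have hH' : (h.corner hl).H ^ 2 * Real.sin (2 * ω) =
        4 * gap a b ω l * gap b a ω l * Real.sin (a + b) := by
      rw [hH]
      simp only [gap]
      rw [add_comm b a]
      field_simp
      ring
    -- At k = H the second summand of the gain vanishes, and only the `M` term remains.
    have hgain : (h.corner hl).gain (h.corner hl).H = 2 * gap a b ω l * gap b a ω l *
        Real.sin (a + b) ^ 2 / (Real.sin (a + ω) * Real.sin (b + ω)) := by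
      have e : (h.corner hl).gain (h.corner hl).H =
          (h.corner hl).H ^ 2 / 4 * ((h.corner hl).M / ((h.corner hl).LA * (h.corner hl).LB)) := by
        simp [Corner.gain]
      rw [e, hM]
      change _ * (_ / (l * Real.sin (a + ω) * (l * Real.sin (b + ω)))) = _
      field_simp
      linear_combination Real.sin (a + b) * hH'
    have hdip := h.dip_corner hl
    have hs : (h.corner hl).s * (h.corner hl).SB *
        dip (h.corner hl).H (h.corner hl).LA (h.corner hl).H = reach b a ω l *
        (2 * gap a b ω l * Real.sin (a + b) * Real.sin (a - ω) / Real.sin (a + ω)) := by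
      rw [← hdip]
      change Real.sin (a + b - 2 * ω) * reach b a ω l * _ = _
      ring
    rw [hgain, hs]
    change _ = reach a b ω l * _
    rw [reach, reach]
    -- What remains of `slide H = SA` after cancelling the common factors. The final angle ω at `o`
    -- enters through the values `reach` of `SA` and `SB`.
    have key : Real.sin (a + b) * Real.sin ω + Real.sin b * Real.sin (a - ω) =
        Real.sin a * Real.sin (b + ω) := by
      simp only [Real.sin_add, Real.sin_sub]
      ring
    field_simp
    linear_combination gap a b ω l * gap b a ω l * Real.sin (a + b) * key

theorem Admissible.creaseDist_eq (h : Admissible a b ω) :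
    creaseDist (a + b - 2 * ω) (a + ω) (b + ω) l = gap a b ω l := by
  have hα := h.sin_α.ne'
  have hθ := h.sin_θ.ne'
  have h1 := h.sub_across (l := l)
  have h2 : creaseDist (a + b - 2 * ω) (a + ω) (b + ω) l =
      (l * Real.sin (a + ω) - across a b ω l) / 2 := by
    rw [creaseDist, cosDihedral, across]
    generalize a + b - 2 * ω = T at *
    field_simp
  linarith

theorem Admissible.creaseDist_eq' (h : Admissible a b ω) :
    creaseDist (a + b - 2 * ω) (b + ω) (a + ω) l = gap b a ω l := by
  rw [add_comm a b]
  exact h.symm.creaseDist_eq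

theorem cornerAngle_eq : cornerAngle (a + b - 2 * ω) (a + ω) (b + ω) = ω := by
  rw [cornerAngle]
  ring

theorem Admissible.κA_mul : (h.corner hl).κA * l = gap a b ω l / Real.sin (a + ω) := by
  have hα := h.sin_α.ne'
  have h1 := h.sub_across (l := l)
  change ratio (l * Real.sin (a + ω)) (across a b ω l) 0 * l = _
  rw [ratio, add_zero, h1]
  field_simp

theorem Admissible.κB_mul : (h.corner hl).κB * l = gap b a ω l / Real.sin (b + ω) :=
  h.symm.κA_mul hl

theorem Admissible.q2v_eq : (h.corner hl).q2v = l • dir2 (a + ω) := by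
  ext i
  fin_cases i <;> simp [Corner.q2v, Admissible.corner, dir2]

theorem Admissible.v2_eq : (h.corner hl).v2 = dir2 (a + ω + (b + ω)) := by
  rw [Corner.v2, h.corner_cD hl, h.corner_sD hl, dir2]

theorem Admissible.realizes :
    (h.corner hl).Realizes (a + b - 2 * ω) (a + ω) (b + ω) l where
  q2_eq := (h.q2v_eq hl).symm
  eA_eq := by simp [eA, dir2, Corner.u2]
  eB_eq := (h.v2_eq hl).symm
  uA_eq := by simp [uA, dir3, Corner.u3]
  uB_eq := rfl
  q3_eq _ := rfl
  height_eq := rfl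
  cA_eq := by
    rw [cA, h.creaseDist_eq, h.q2v_eq hl, smul_smul, h.κA_mul hl]
  cB_eq := by
    rw [cB, h.creaseDist_eq', h.q2v_eq hl, smul_smul, h.κB_mul hl]
  pA_eq := by
    have hα := h.sin_α.ne'
    have hω := h.sin_ω.ne'
    -- Along the crease, `p_α` lies at `gap * cot ω` and `c_α` at `gap * cot α` from the foot of the
    -- perpendicular from `o`; by this expansion their difference is `reach`.
    have h1 : Real.sin a = Real.sin (a + ω) * Real.cos ω - Real.cos (a + ω) * Real.sin ω := by
      rw [← Real.sin_sub, add_sub_cancel_right]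
    rw [pA, h.creaseDist_eq, cornerAngle_eq, Corner.a2, h.q2v_eq hl, smul_smul, h.κA_mul hl]
    change _ = _ + reach a b ω l • _
    rw [reach, h1]
    generalize a + ω = A at *
    ext i
    fin_cases i
    · simp [dir2, Corner.u2]
      field_simp
      ring
    · simp [dir2, Corner.u2]
      field_simp
  pB_eq := by
    have hβ := h.symm.sin_α.ne'
    have hω := h.sin_ω.ne'
    have h1 : Real.sin b = Real.sin (b + ω) * Real.cos ω - Real.cos (b + ω) * Real.sin ω := by
      rw [← Real.sin_sub, add_sub_cancel_right]
    rw [pB, h.creaseDist_eq', cornerAngle_eq, Corner.b2, h.q2v_eq hl, h.v2_eq hl, smul_smul,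
      h.κB_mul hl]
    change _ = _ + reach b a ω l • _
    rw [reach, h1]
    generalize a + ω = A at *
    generalize b + ω = B at *
    have hB := Real.sin_sq_add_cos_sq B
    ext i
    fin_cases i
    · simp [dir2, Real.cos_sub, Real.cos_add, Real.sin_add]
      field_simp
      linear_combination (gap b a ω l * Real.cos A * Real.sin ω) * hB
    · simp [dir2, Real.sin_sub, Real.cos_add, Real.sin_add]
      field_simp
      linear_combination (gap b a ω l * Real.sin A * Real.sin ω) * hB

end Computations

end Angles

end OutOut

end


open OutOut
theorem mainTheorem2 (θ α β : ℝ) (hθ : 0 < θ) (hdiff : |α - β| < θ) (hsum : θ < α + β)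
    (hprimary : α + β ≤ Real.pi) :
    ∃ R C : ℝ, 0 < R ∧ 0 < C ∧ ∀ l : ℝ, 0 < l →
      0 < height θ α β l ∧
      ∃ (z : ℝ → ℝ) (f : ℝ → E2 → E3), IsOutOutMotion θ α β l z f ∧
        -- bounded size
        gadgetRegion θ α β l ⊆ paper α β l ∧
        (∀ t ∈ Icc (0 : ℝ) 1,
          creases θ α β l t ⊆ gadgetRegion θ α β l ∪ spanningFaceCreases θ α β l) ∧
        gadgetRegion θ α β l ⊆ Metric.closedBall 0 (R * height θ α β l) ∧
        (∀ t ∈ Icc (0 : ℝ) 1,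
          f t '' gadgetRegion θ α β l ⊆ Metric.closedBall 0 (R * height θ α β l)) ∧
        -- between the bottom and top planes, strictly so before the end and off the attached edges
        (∀ t ∈ Icc (0 : ℝ) 1, ∀ x ∈ paper α β l, f t x 2 ∈ Icc 0 (z t)) ∧
        (∀ t ∈ Ico (0 : ℝ) 1, ∀ x ∈ paper α β l \ horizontalEdges α β l,
          f t x 2 ∈ Ioo 0 (z t)) ∧
        -- isometric
        (∀ t ∈ Icc (0 : ℝ) 1, PreservesLengths (paper α β l) (f t)) ∧
        (∀ t ∈ Icc (0 : ℝ) 1, ∀ x ∈ paper α β l, ∀ y ∈ paper α β l,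
          intrinsicDist (paper α β l) (f t) x y = intrinsicDist (paper α β l) (f 0) x y) ∧
        -- crossing-free
        AvoidsCrossings (paper α β l) (creases θ α β l 1) f ∧
        -- area supporting moving creases
        movingRegion θ α β l ⊆ gadgetRegion θ α β l ∧
        volume (movingRegion θ α β l) = ENNReal.ofReal (C * height θ α β l ^ 2) := by
  obtain ⟨h1, h2⟩ := abs_lt.1 hdiff
  -- In these variables ω < a and ω < b are the two halves of |α - β| < θ, and 0 < ω is θ < α + β.
  have h : Admissible (α - cornerAngle θ α β) (β - cornerAngle θ α β) (cornerAngle θ α β) := by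
    constructor <;> unfold cornerAngle <;> linarith
  refine gadget_of_realizes fun l hl => ⟨h.corner hl, h.closes hl, ?_⟩
  have hR := h.realizes hl
  have e : α - cornerAngle θ α β + (β - cornerAngle θ α β) - 2 * cornerAngle θ α β = θ := by
    unfold cornerAngle
    ring
  rwa [e, sub_add_cancel, sub_add_cancel] at hR
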